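/- Setting. Let $A\in\mathbb R^{n\times n}$, $0\ne B\in\mathbb R^{n\times m}$, and let $x_{t+1}=Ax_t+Bu_t+w_t$ ($t\ge1$), where $w_1,w_2,\dots$ are i.i.d. $\mathcal N(0,W)$ with $W\succeq0$, and $x_1$ is Gaussian and independent of $(w_t)_{t\ge 1}$. A linear policy $u=-Kx$ is *stable* if $\rho(A-BK)<1$; assume $(A,B)$ is stabilizable, i.e. a stable policy exists. Let $\sigma>\mu>0$, and let $Q_t\in\mathbb R^{n\times n}$, $R_t\in\mathbb R^{m\times m}$ ($t\ge1$) be (deterministic) symmetric matrices with $\mu I\preceq Q_t$, $\mu I\preceq R_t$, $\mathrm{Tr}(Q_t)\le\sigma$, $\mathrm{Tr}(R_t)\le\sigma$. For policies $(K_t)$, i.e. $u_t=-K_tx_t$, put $J_t=\mathbb E[x_t^\top Q_tx_t+u_t^\top R_tu_t]$ and $$R(T)=\sum_{t=1}^TJ_t(K_t)-\inf_{K\text{ stable}}\sum_{t=1}^TJ_t(K),$$ where in the second sum the fixed policy $K$ is used at all times. Norms of matrices are Euclidean operator norms. Algorithm (online Riccati update with reset). Given $\nu$, let $\kappa=\sqrt{\nu/\mu}$,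 $\gamma=1/(2\kappa^2)$, $\mathsf m=\frac{2\sigma}{\|B\|}+\frac{4\kappa^2\sigma(1+\kappa^2)}{\gamma}$ and $$t^\star=\Big\lceil\tfrac{4\kappa^3\|B\|}{\gamma\mu}\Big(2\sigma\kappa+\tfrac{2\kappa^3\|B\|\sigma(1+\kappa^2)}{\gamma}\Big)+1\Big\rceil .$$ Start with a stable $K_1$. For $t\ge1$ let $\bar Q_t=\frac1t\sum_{s\le t}Q_s$, $\bar R_t=\frac1t\sum_{s\le t}R_s$, let $P_t$ be the solution of $$P_t=(A-BK_t)^\top P_t(A-BK_t)+\bar Q_t+K_t^\top\bar R_tK_t ,$$ and let $K_{t+1}=(B^\top P_tB+\bar R_t)^{-1}B^\top P_tA$; except that at $t=t^\star$ the matrix $P_{t^\star}$ is replaced, before $K_{t^\star+1}$ is computed, by the output $\widehat P_\ell$ of the following loop: $\widehat K_0=K_{t^\star}$, $\widehat K_{\ell}=(B^\top\widehat P_{\ell-1}B+\bar R_{t^\star})^{-1}B^\top\widehat P_{\ell-1}A$, $\widehat P_\ell$ solves $\widehat P_\ell=(A-B\widehat K_\ell)^\top\widehat P_\ell(A-B\widehat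 K_\ell)+\bar Q_{t^\star}+\widehat K_\ell^\top\bar R_{t^\star}\widehat K_\ell$, and the loop stops at the first $\ell\ge1$ with $\|\widehat P_\ell-\widehat P_{\ell-1}\|\le\mathsf m/t^\star$. Theorem. Suppose that the matrices $P_t$ produced by the algorithm are uniformly bounded, $P_t\preceq\nu I$ for all $t\ge1$. Then $R(T)=\mathcal O(\log T)$. More precisely, let $\omega=\mathrm{Tr}(W)$, $\hat m=\max\{\mathsf m,\ t\|P_t-P_{t-1}\|:2\le t\le t^\star\}$, $$M=\tfrac{2\kappa^6\omega}{\mu\gamma^2}\|B\|(\|B\|\hat m+2\sigma),\qquad M'=\tfrac{\kappa^6\omega}{\mu\gamma^2}\|B\|^2(\|B\|\hat m+2\sigma)^2 .$$ There is a constant $C$ that depends only on $A,B,W,\mu,\sigma,\nu$ and the law of $x_1$ (not on $T$, the cost matrices or $K_1$) such that: 1. $|R(T)|\le C\log T$ for all $T\ge2$. 2. For all $T\ge1$, $$R(T)\le\Big(\frac{2\kappa^4\sigma M}{1-e^{-2\gamma^2}}+\frac{\kappa^4\omega}{\gamma\mu^3}(\|B\|\hat m+2\sigma)^2\Big)\log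 T+C .$$ 3. If $W\ne0$, then for every cost sequence and every run of the algorithm as above there is $l>0$, independent of $T$, such that for all $T\ge1$ $$\begin{aligned}R(T)\le{}&\Big(\tfrac{2\kappa^4\sigma M}{1-e^{-2\gamma^2}}+\tfrac{\kappa^4\omega}{\gamma\mu^3}(\|B\|\hat m+2\sigma)^2\Big)\log T-\tfrac{2\kappa^4\sigma M}{1-e^{-2\gamma^2}}\log t^\star+t^\star\sigma(1+\kappa^2)\max_{0<t\le t^\star}\|X_t-\widehat X_t\|\\&+2\kappa^4\sigma\Big(\|X_{t^\star}-\widehat X_{t^\star}\|\tfrac{e^{-2\gamma^2t^\star}}{1-e^{-2\gamma^2}}+\tfrac{M'\pi^2}{6(1-e^{-2\gamma^2})}\Big)+\omega l\hat m+\tfrac{\kappa^4\omega}{\gamma\mu^3}(\|B\|\hat m+2\sigma)^2+\tfrac{\sigma(1+\kappa^2)\kappa^2}{1-e^{-2\gamma}}\|\widehat X^\star-X_1\| ,\end{aligned}$$ where $X_t=\mathbb E[x_tx_t^\top]$ along the run, $\widehat X_t$ solves $\widehat X_t=(A-BK_t)\widehat X_t(A-BK_t)^\top+W$, $P^\star\succ0$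 solves the discrete algebraic Riccati equation $P^\star=A^\top P^\star A-A^\top P^\star B(B^\top P^\star B+\bar R_T)^{-1}B^\top P^\star A+\bar Q_T$, $K^\star=(B^\top P^\star B+\bar R_T)^{-1}B^\top P^\star A$, and $\widehat X^\star$ solves $\widehat X^\star=(A-BK^\star)\widehat X^\star(A-BK^\star)^\top+W$. -/

import Mathlib

open MeasureTheory ProbabilityTheory
open scoped Matrix Matrix.Norms.L2Operator

noncomputable section

namespace OnlineLQ

variable {n m : ℕ} {Ω : Type*} [MeasurableSpace Ω]

/-! ### Linear systems and stable policies

All norms of matrices are operator norms with respect to the Euclidean norms. -/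

/-- The closed-loop matrix `A - B K` of the linear policy `u = -K x`. -/
def closedLoop (A : Matrix (Fin n) (Fin n) ℝ) (B : Matrix (Fin n) (Fin m) ℝ)
    (K : Matrix (Fin m) (Fin n) ℝ) : Matrix (Fin n) (Fin n) ℝ :=
  A - B * K

/-- `K` is stable: `ρ(A - B K) < 1`, where the spectral radius is taken over all complex
eigenvalues. -/
def IsStable (A : Matrix (Fin n) (Fin n) ℝ) (B : Matrix (Fin n) (Fin m) ℝ)
    (K : Matrix (Fin m) (Fin n) ℝ) : Prop :=
  spectralRadius ℂ ((closedLoop A B K).map Complex.ofReal) < 1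

/-- `(A, B)` is stabilizable: it admits a stable policy. -/
def IsStabilizable (A : Matrix (Fin n) (Fin n) ℝ) (B : Matrix (Fin n) (Fin m) ℝ) : Prop :=
  ∃ K : Matrix (Fin m) (Fin n) ℝ, IsStable A B K

/-- The conditions on the cost matrices `Q_t`, `R_t`, `t ≥ 1`: `μ I ⪯ Q_t`, `μ I ⪯ R_t`,
`Tr Q_t ≤ σ`, `Tr R_t ≤ σ`. For `μ > 0` they entail that `Q_t`, `R_t` are symmetric positive
definite. -/
structure CostAssumption (Q : ℕ → Matrix (Fin n) (Fin n) ℝ) (R : ℕ → Matrix (Fin m) (Fin m) ℝ)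
    (μ σ : ℝ) : Prop where
  Q_lower : ∀ t, 1 ≤ t → (Q t - μ • (1 : Matrix (Fin n) (Fin n) ℝ)).PosSemidef
  R_lower : ∀ t, 1 ≤ t → (R t - μ • (1 : Matrix (Fin m) (Fin m) ℝ)).PosSemidef
  Q_trace : ∀ t, 1 ≤ t → (Q t).trace ≤ σ
  R_trace : ∀ t, 1 ≤ t → (R t).trace ≤ σ

/-! ### The stochastic system, the costs and the regret -/

/-- The state at time `t ≥ 1` (the value at `t = 0` is not used): `x_1` is given and
`x_{t+1} = A x_t + B u_t + w_t` with `u_t = -K_t x_t`. -/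
def state (A : Matrix (Fin n) (Fin n) ℝ) (B : Matrix (Fin n) (Fin m) ℝ)
    (x₁ : Ω → EuclideanSpace ℝ (Fin n)) (w : ℕ → Ω → EuclideanSpace ℝ (Fin n))
    (K : ℕ → Matrix (Fin m) (Fin n) ℝ) : ℕ → Ω → EuclideanSpace ℝ (Fin n)
  | 0 => 0
  | 1 => x₁
  | t + 2 => fun ω =>
      let x := state A B x₁ w K (t + 1) ω
      let u := -(Matrix.toEuclideanLin (K (t + 1)) x)
      Matrix.toEuclideanLin A x + Matrix.toEuclideanLin B u + w (t + 1) ω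

/-- The expected cost `E[x_tᵀ Q_t x_t + u_tᵀ R_t u_t]` at time `t`, with `u_t = -K_t x_t`. -/
def stepCost (A : Matrix (Fin n) (Fin n) ℝ) (B : Matrix (Fin n) (Fin m) ℝ)
    (Q : ℕ → Matrix (Fin n) (Fin n) ℝ) (R : ℕ → Matrix (Fin m) (Fin m) ℝ)
    (Pr : Measure Ω) (x₁ : Ω → EuclideanSpace ℝ (Fin n)) (w : ℕ → Ω → EuclideanSpace ℝ (Fin n))
    (K : ℕ → Matrix (Fin m) (Fin n) ℝ) (t : ℕ) : ℝ :=
  ∫ ω,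
    (let x := state A B x₁ w K t ω
     let u := -(Matrix.toEuclideanLin (K t) x)
     x.ofLp ⬝ᵥ (Q t *ᵥ x.ofLp) + u.ofLp ⬝ᵥ (R t *ᵥ u.ofLp)) ∂Pr

/-- The regret after `T` steps of the policies `K_t` against the best fixed stable policy in
hindsight. The minimum over the (open) set of stable policies is read as an infimum. -/
def regret (A : Matrix (Fin n) (Fin n) ℝ) (B : Matrix (Fin n) (Fin m) ℝ)
    (Q : ℕ → Matrix (Fin n) (Fin n) ℝ) (R : ℕ → Matrix (Fin m) (Fin m) ℝ)
    (Pr : Measure Ω) (x₁ : Ω → EuclideanSpace ℝ (Fin n)) (w : ℕ → Ω → EuclideanSpace ℝ (Fin n))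
    (K : ℕ → Matrix (Fin m) (Fin n) ℝ) (T : ℕ) : ℝ :=
  ∑ t ∈ Finset.Icc 1 T, stepCost A B Q R Pr x₁ w K t -
    ⨅ K' : {K' : Matrix (Fin m) (Fin n) ℝ // IsStable A B K'},
      ∑ t ∈ Finset.Icc 1 T, stepCost A B Q R Pr x₁ w (fun _ => K'.1) t

/-! ### The online Riccati algorithm with reset -/

/-- Running averages of a sequence: `M̄_t = ((t-1)/t) M̄_{t-1} + (1/t) M_t` for `t ≥ 1`. -/
def runAvg {d : ℕ} (M : ℕ → Matrix (Fin d) (Fin d) ℝ) : ℕ → Matrix (Fin d) (Fin d) ℝ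
  | 0 => 0
  | t + 1 => ((t : ℝ) / (t + 1)) • runAvg M t + (1 / ((t : ℝ) + 1)) • M (t + 1)

/-- The gain `(Bᵀ P B + R)⁻¹ Bᵀ P A`. -/
def gain (A : Matrix (Fin n) (Fin n) ℝ) (B : Matrix (Fin n) (Fin m) ℝ)
    (R : Matrix (Fin m) (Fin m) ℝ) (P : Matrix (Fin n) (Fin n) ℝ) : Matrix (Fin m) (Fin n) ℝ :=
  (Bᵀ * P * B + R)⁻¹ * Bᵀ * P * A

/-- `P` solves `P = (A - B K)ᵀ P (A - B K) + Q + Kᵀ R K`. -/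
def IsPolicyValue (A : Matrix (Fin n) (Fin n) ℝ) (B : Matrix (Fin n) (Fin m) ℝ)
    (Q : Matrix (Fin n) (Fin n) ℝ) (R : Matrix (Fin m) (Fin m) ℝ)
    (K : Matrix (Fin m) (Fin n) ℝ) (P : Matrix (Fin n) (Fin n) ℝ) : Prop :=
  P = (closedLoop A B K)ᵀ * P * closedLoop A B K + Q + Kᵀ * R * K

/-- `κ = √(ν/μ)`. -/
def kappa (μ ν : ℝ) : ℝ := √(ν / μ)

/-- `γ = 1 / (2 κ²)`. -/
def gam (μ ν : ℝ) : ℝ := 1 / (2 * kappa μ ν ^ 2)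

/-- `2σ/‖B‖ + 4κ²σ(1+κ²)/γ`; the reset loop stops at accuracy `resetConst / t⋆`. -/
def resetConst (B : Matrix (Fin n) (Fin m) ℝ) (μ σ ν : ℝ) : ℝ :=
  2 * σ / ‖B‖ + 4 * kappa μ ν ^ 2 * σ * (1 + kappa μ ν ^ 2) / gam μ ν

/-- The reset time `t⋆`. -/
def resetTime (B : Matrix (Fin n) (Fin m) ℝ) (μ σ ν : ℝ) : ℕ :=
  ⌈4 * kappa μ ν ^ 3 * ‖B‖ / (gam μ ν * μ) *
      (2 * σ * kappa μ ν +
        2 * kappa μ ν ^ 3 * ‖B‖ * σ * (1 + kappa μ ν ^ 2) / gam μ ν) + 1⌉₊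

/-- A run of the online Riccati algorithm with parameters `μ, σ, ν` on the cost matrices `Q_t`,
`R_t`, `t ≥ 1`: the policies `K_t`, the matrices `P_t`, and the iterates `K̂_ℓ`, `P̂_ℓ` of the
reset step (continued beyond the stopping index, where they are not used). Since `K_1` is stable,
each linear equation below has exactly one solution, so a run is determined by `K_1`. -/
structure Run (A : Matrix (Fin n) (Fin n) ℝ) (B : Matrix (Fin n) (Fin m) ℝ)
    (Q : ℕ → Matrix (Fin n) (Fin n) ℝ) (R : ℕ → Matrix (Fin m) (Fin m) ℝ) (μ σ ν : ℝ) where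
  K : ℕ → Matrix (Fin m) (Fin n) ℝ
  P : ℕ → Matrix (Fin n) (Fin n) ℝ
  Khat : ℕ → Matrix (Fin m) (Fin n) ℝ
  Phat : ℕ → Matrix (Fin n) (Fin n) ℝ
  K_one : IsStable A B (K 1)
  P_eq : ∀ t, 1 ≤ t → t ≠ resetTime B μ σ ν →
    IsPolicyValue A B (runAvg Q t) (runAvg R t) (K t) (P t)
  Khat_zero : Khat 0 = K (resetTime B μ σ ν)
  Khat_succ : ∀ ℓ, Khat (ℓ + 1) = gain A B (runAvg R (resetTime B μ σ ν)) (Phat ℓ)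
  Phat_eq : ∀ ℓ, IsPolicyValue A B (runAvg Q (resetTime B μ σ ν)) (runAvg R (resetTime B μ σ ν))
    (Khat ℓ) (Phat ℓ)
  /-- At the reset time, the output of the loop is `P̂_ℓ` for the first `ℓ ≥ 1` at which the
  stopping criterion holds. -/
  P_reset : P (resetTime B μ σ ν) =
    Phat (sInf {ℓ : ℕ | 1 ≤ ℓ ∧
      ‖Phat ℓ - Phat (ℓ - 1)‖ ≤ resetConst B μ σ ν / resetTime B μ σ ν})
  K_succ : ∀ t, 1 ≤ t → K (t + 1) = gain A B (runAvg R t) (P t)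

/-! ### The quantities in the explicit bound -/

/-- `m̂ = max {m, t ‖P_t - P_{t-1}‖ : 2 ≤ t ≤ t⋆}` with `m = 2σ/‖B‖ + 4κ²σ(1+κ²)/γ`. -/
def mHat (B : Matrix (Fin n) (Fin m) ℝ) (μ σ ν : ℝ) (P : ℕ → Matrix (Fin n) (Fin n) ℝ) : ℝ :=
  max (resetConst B μ σ ν)
    (⨆ t : Finset.Icc 2 (resetTime B μ σ ν), ((t : ℕ) : ℝ) * ‖P t - P ((t : ℕ) - 1)‖)

/-- `M = (2κ⁶ω/(μγ²)) ‖B‖ (‖B‖ m̂ + 2σ)`, with `ω = Tr W`. -/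
def constM (B : Matrix (Fin n) (Fin m) ℝ) (W : Matrix (Fin n) (Fin n) ℝ) (μ σ ν : ℝ)
    (P : ℕ → Matrix (Fin n) (Fin n) ℝ) : ℝ :=
  2 * kappa μ ν ^ 6 * W.trace / (μ * gam μ ν ^ 2) * ‖B‖ * (‖B‖ * mHat B μ σ ν P + 2 * σ)

/-- `M' = (κ⁶ω/(μγ²)) ‖B‖² (‖B‖ m̂ + 2σ)²`. -/
def constM' (B : Matrix (Fin n) (Fin m) ℝ) (W : Matrix (Fin n) (Fin n) ℝ) (μ σ ν : ℝ)
    (P : ℕ → Matrix (Fin n) (Fin n) ℝ) : ℝ :=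
  kappa μ ν ^ 6 * W.trace / (μ * gam μ ν ^ 2) * ‖B‖ ^ 2 *
    (‖B‖ * mHat B μ σ ν P + 2 * σ) ^ 2

/-- The coefficient of `log T` in the regret bound. -/
def logCoeff (B : Matrix (Fin n) (Fin m) ℝ) (W : Matrix (Fin n) (Fin n) ℝ) (μ σ ν : ℝ)
    (P : ℕ → Matrix (Fin n) (Fin n) ℝ) : ℝ :=
  2 * kappa μ ν ^ 4 * σ * (constM B W μ σ ν P / (1 - Real.exp (-2 * gam μ ν ^ 2))) +
    kappa μ ν ^ 4 * W.trace / (gam μ ν * μ ^ 3) * (‖B‖ * mHat B μ σ ν P + 2 * σ) ^ 2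

/-- The matrix `E[x xᵀ]` of second moments. -/
def secondMoment (Pr : Measure Ω) (x : Ω → EuclideanSpace ℝ (Fin n)) :
    Matrix (Fin n) (Fin n) ℝ :=
  Matrix.of fun i j => ∫ ω, x ω i * x ω j ∂Pr

/-- The steady-state covariance of a stable policy `K`: the solution
`∑_{i ≥ 0} (A - B K)^i W ((A - B K)^i)ᵀ` of `X = (A - B K) X (A - B K)ᵀ + W`. -/
def steadyCov (A : Matrix (Fin n) (Fin n) ℝ) (B : Matrix (Fin n) (Fin m) ℝ)
    (W : Matrix (Fin n) (Fin n) ℝ) (K : Matrix (Fin m) (Fin n) ℝ) : Matrix (Fin n) (Fin n) ℝ :=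
  ∑' i : ℕ, closedLoop A B K ^ i * W * (closedLoop A B K ^ i)ᵀ

/-- `P` is the positive-definite solution of the discrete algebraic Riccati equation
`P = Aᵀ P A - Aᵀ P B (Bᵀ P B + R)⁻¹ Bᵀ P A + Q`. -/
def IsDARESolution (A : Matrix (Fin n) (Fin n) ℝ) (B : Matrix (Fin n) (Fin m) ℝ)
    (Q : Matrix (Fin n) (Fin n) ℝ) (R : Matrix (Fin m) (Fin m) ℝ)
    (P : Matrix (Fin n) (Fin n) ℝ) : Prop :=
  P.PosDef ∧ P = Aᵀ * P * A - Aᵀ * P * B * (Bᵀ * P * B + R)⁻¹ * Bᵀ * P * A + Q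

/-- The right-hand side of the explicit regret bound after `T` steps. Here `Xdev t` stands for
`‖X_t - X̂_t‖`, `dstar` for `‖X̂⋆ - X_1⋆‖`, and `l` for the constant that multiplies `ω m̂`. -/
def explicitBound (B : Matrix (Fin n) (Fin m) ℝ) (W : Matrix (Fin n) (Fin n) ℝ) (μ σ ν : ℝ)
    (P : ℕ → Matrix (Fin n) (Fin n) ℝ) (Xdev : ℕ → ℝ) (dstar l : ℝ) (T : ℕ) : ℝ :=
  let κ := kappa μ ν
  let γ := gam μ ν
  let tstar := resetTime B μ σ ν
  let E := 1 - Real.exp (-2 * γ ^ 2)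
  logCoeff B W μ σ ν P * Real.log T
    - 2 * κ ^ 4 * σ * (constM B W μ σ ν P / E) * Real.log tstar
    + tstar * σ * (1 + κ ^ 2) * (⨆ t : Finset.Icc 1 tstar, Xdev t)
    + 2 * κ ^ 4 * σ * (Xdev tstar * (Real.exp (-2 * γ ^ 2 * tstar) / E)
        + constM' B W μ σ ν P * Real.pi ^ 2 / (6 * E))
    + W.trace * l * mHat B μ σ ν P
    + kappa μ ν ^ 4 * W.trace / (γ * μ ^ 3) * (‖B‖ * mHat B μ σ ν P + 2 * σ) ^ 2
    + σ * (1 + κ ^ 2) * κ ^ 2 / (1 - Real.exp (-2 * γ)) * dstar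

end OnlineLQ

end

noncomputable section

open scoped MatrixOrder

namespace OnlineLQ

/-! ### The Loewner order, traces and operator norms -/

section Loewner

variable {n m : ℕ}

/-! Write F_t = A - B K_{t+1} and C̄_t(K) = Q̄_t + Kᵀ R̄_t K, and let E_t = P_t - F_tᵀ P_t F_t -
C̄_t(K_{t+1}) be the Bellman residual. Since P_t is the value of some stable policy K', completing
the square gives E_t = (K' - K_{t+1})ᵀ (Bᵀ P_t B + R̄_t) (K' - K_{t+1}) ⪰ 0. Hence F_tᵀ P_t F_t ⪯
P_t - μI: each P_t is a Lyapunov certificate for the next policy, uniform in t because μI ⪯ P_t ⪯ νI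
(`IsPolicyValue.isCert_gain`).

Rates. Off the reset, P_{t+1} - P_t solves a Lyapunov equation whose source is the O(1/t) change of
the averaged costs minus E_t, and E_t is quadratic in the last gain step, hence in ‖P_t - P_{t-1}‖
and 1/t. So a bound m/t on one increment makes E_t = O(1/t²) and, once t ≥ t⋆, gives m/(t+1) for the
next increment; the reset starts this induction (`norm_P_succ_sub_le_of_resetTime_le`). Still later
E_t is negligible and the increment bound no longer involves m (`norm_P_succ_sub_le_tail`).

Cost of the run. From Q_{t+1} = (t+1) Q̄_{t+1} - t Q̄_t, the same for R, and X_{t+2} = F_t X_{t+1}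
F_tᵀ + W, the cost at time t+1 equals (t+1) tr(P_{t+1} W) - t tr(P_t W) plus t tr(E_t X_{t+1}) minus
a bounded weight paired with X_{t+2} - X_{t+1} (`stepCost_succ_eq`). The first part telescopes to T
tr(P_T W). The errors are O(1/t) up to summable terms, because F_t moves by O(1/t) and the
certificates damp the past; they sum to O(log T) (`SlowSystem.abs_sum_le`).

Benchmark. Every fixed policy costs at least T tr(P_T W) - O(1), uniformly in the policy, however
slowly it mixes (`le_cost_fixed`, resting on `le_cost_of_recursion`): noise that has not yet acted
lowers the early costs, but this deficit is paid for by the suboptimality gap. Conversely the fixed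
policy K_T costs at most T tr(P_T W) + O(1) (`cost_fixed_le`). The two comparisons give |R(T)| ≤ L
log T + C with L and C independent of the costs and of the run.

The explicit forms follow because L is at most the stated coefficient of log T
(`regretCoeff_le_logCoeff`), while the remaining constants fit into C or, when W ≠ 0, into the term
ω l m̂. -/

theorem isSymm_of_nonneg {A : Matrix (Fin n) (Fin n) ℝ} (hA : 0 ≤ A) : Aᵀ = A := by
  have h := (Matrix.nonneg_iff_posSemidef.1 hA).1
  simpa [Matrix.IsHermitian, Matrix.conjTranspose_eq_transpose_of_trivial] using h

theorem isSymm_of_ge {A B : Matrix (Fin n) (Fin n) ℝ} (hB : Bᵀ = B) (h : B ≤ A) : Aᵀ = A := by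
  have := isSymm_of_nonneg (sub_nonneg.2 h)
  rw [Matrix.transpose_sub, hB] at this
  exact sub_left_inj.1 this

theorem isSymm_of_le {A B : Matrix (Fin n) (Fin n) ℝ} (hB : Bᵀ = B) (h : A ≤ B) : Aᵀ = A := by
  have := isSymm_of_nonneg (sub_nonneg.2 h)
  rw [Matrix.transpose_sub, hB] at this
  exact sub_right_inj.1 this

theorem smul_one_isSymm (c : ℝ) :
    (c • (1 : Matrix (Fin n) (Fin n) ℝ))ᵀ = c • 1 := by simp

theorem conj_nonneg {A : Matrix (Fin n) (Fin n) ℝ} (hA : 0 ≤ A) (M : Matrix (Fin n) (Fin m) ℝ) :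
    0 ≤ Mᵀ * A * M := by
  have := (Matrix.nonneg_iff_posSemidef.1 hA).conjTranspose_mul_mul_same M
  rw [Matrix.conjTranspose_eq_transpose_of_trivial] at this
  exact Matrix.nonneg_iff_posSemidef.2 this

theorem conj_mono {A B : Matrix (Fin n) (Fin n) ℝ} (h : A ≤ B) (M : Matrix (Fin n) (Fin m) ℝ) :
    Mᵀ * A * M ≤ Mᵀ * B * M := by
  have := conj_nonneg (sub_nonneg.2 h) M
  rw [Matrix.mul_sub, Matrix.sub_mul] at this
  exact sub_nonneg.1 this

theorem conj_nonneg' {A : Matrix (Fin n) (Fin n) ℝ} (hA : 0 ≤ A) (M : Matrix (Fin m) (Fin n) ℝ) :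
    0 ≤ M * A * Mᵀ := by
  simpa using conj_nonneg hA Mᵀ

theorem conj_mono' {A B : Matrix (Fin n) (Fin n) ℝ} (h : A ≤ B) (M : Matrix (Fin m) (Fin n) ℝ) :
    M * A * Mᵀ ≤ M * B * Mᵀ := by
  simpa using conj_mono h Mᵀ

theorem gram_nonneg (M : Matrix (Fin n) (Fin m) ℝ) : 0 ≤ Mᵀ * M := by
  have := Matrix.posSemidef_conjTranspose_mul_self M
  rw [Matrix.conjTranspose_eq_transpose_of_trivial] at this
  exact Matrix.nonneg_iff_posSemidef.2 this

theorem one_nonneg_matrix : (0 : Matrix (Fin n) (Fin n) ℝ) ≤ 1 :=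
  Matrix.nonneg_iff_posSemidef.2 Matrix.PosSemidef.one

theorem smul_nonneg_matrix {A : Matrix (Fin n) (Fin n) ℝ} {c : ℝ} (hc : 0 ≤ c) (hA : 0 ≤ A) :
    0 ≤ c • A :=
  Matrix.nonneg_iff_posSemidef.2 ((Matrix.nonneg_iff_posSemidef.1 hA).smul hc)

theorem smul_le_smul_matrix {A B : Matrix (Fin n) (Fin n) ℝ} {c : ℝ} (hc : 0 ≤ c) (h : A ≤ B) :
    c • A ≤ c • B := by
  have := smul_nonneg_matrix hc (sub_nonneg.2 h)
  rw [smul_sub] at this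
  exact sub_nonneg.1 this

theorem smul_le_smul_right_matrix {A : Matrix (Fin n) (Fin n) ℝ} {c d : ℝ} (h : c ≤ d)
    (hA : 0 ≤ A) : c • A ≤ d • A := by
  have := smul_nonneg_matrix (sub_nonneg.2 h) hA
  rw [sub_smul] at this
  exact sub_nonneg.1 this

theorem trace_nonneg_of_nonneg {A : Matrix (Fin n) (Fin n) ℝ} (hA : 0 ≤ A) : 0 ≤ A.trace :=
  (Matrix.nonneg_iff_posSemidef.1 hA).trace_nonneg

theorem trace_mono {A B : Matrix (Fin n) (Fin n) ℝ} (h : A ≤ B) : A.trace ≤ B.trace := by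
  have := trace_nonneg_of_nonneg (sub_nonneg.2 h)
  rw [Matrix.trace_sub] at this
  linarith

theorem trace_mul_nonneg {A B : Matrix (Fin n) (Fin n) ℝ} (hA : 0 ≤ A) (hB : 0 ≤ B) :
    0 ≤ (A * B).trace := by
  obtain ⟨C, hC⟩ := CStarAlgebra.nonneg_iff_eq_star_mul_self.1 hB
  rw [Matrix.star_eq_conjTranspose, Matrix.conjTranspose_eq_transpose_of_trivial] at hC
  rw [hC, ← Matrix.mul_assoc, Matrix.trace_mul_comm, ← Matrix.mul_assoc]
  exact trace_nonneg_of_nonneg (conj_nonneg' hA C)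

theorem trace_mul_mono {A B Z : Matrix (Fin n) (Fin n) ℝ} (h : A ≤ B) (hZ : 0 ≤ Z) :
    (A * Z).trace ≤ (B * Z).trace := by
  have := trace_mul_nonneg (sub_nonneg.2 h) hZ
  rw [Matrix.sub_mul, Matrix.trace_sub] at this
  linarith

theorem trace_mul_le_of_le_smul_one {A Z : Matrix (Fin n) (Fin n) ℝ} {c : ℝ} (h : A ≤ c • 1)
    (hZ : 0 ≤ Z) : (A * Z).trace ≤ c * Z.trace := by
  simpa using trace_mul_mono h hZ

theorem le_trace_mul_of_smul_one_le {A Z : Matrix (Fin n) (Fin n) ℝ} {c : ℝ} (h : c • 1 ≤ A)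
    (hZ : 0 ≤ Z) : c * Z.trace ≤ (A * Z).trace := by
  simpa using trace_mul_mono h hZ

/-- The adjoint action inside a trace. -/
theorem trace_conj_mul (P X : Matrix (Fin n) (Fin n) ℝ) (F : Matrix (Fin n) (Fin n) ℝ) :
    (Fᵀ * P * F * X).trace = (P * (F * X * Fᵀ)).trace := by
  rw [Matrix.mul_assoc, Matrix.mul_assoc, Matrix.trace_mul_comm]
  simp only [Matrix.mul_assoc]

theorem nonneg_iff_dotProduct {A : Matrix (Fin n) (Fin n) ℝ} (hA : Aᵀ = A) :
    0 ≤ A ↔ ∀ x : Fin n → ℝ, 0 ≤ x ⬝ᵥ A *ᵥ x := by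
  rw [Matrix.nonneg_iff_posSemidef, Matrix.posSemidef_iff_dotProduct_mulVec]
  simp [Matrix.IsHermitian, Matrix.conjTranspose_eq_transpose_of_trivial, hA]

theorem dotProduct_self_eq_norm_sq (x : Fin n → ℝ) : x ⬝ᵥ x = ‖WithLp.toLp 2 x‖ ^ 2 := by
  rw [EuclideanSpace.norm_sq_eq]
  simp [dotProduct, sq]

/-- `Mᵀ M ⪯ ‖M‖² I`. -/
theorem gram_le (M : Matrix (Fin n) (Fin m) ℝ) : Mᵀ * M ≤ (‖M‖ ^ 2) • 1 := by
  rw [← sub_nonneg, nonneg_iff_dotProduct (by simp)]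
  intro x
  have h := Matrix.l2_opNorm_mulVec M (WithLp.toLp 2 x)
  have h1 : x ⬝ᵥ (Mᵀ * M) *ᵥ x = (M *ᵥ x) ⬝ᵥ (M *ᵥ x) := by
    rw [← Matrix.mulVec_mulVec, Matrix.dotProduct_mulVec, Matrix.vecMul_transpose]
  rw [Matrix.sub_mulVec, dotProduct_sub, h1, Matrix.smul_mulVec, Matrix.one_mulVec, dotProduct_smul,
    dotProduct_self_eq_norm_sq, dotProduct_self_eq_norm_sq, smul_eq_mul]
  change ‖WithLp.toLp 2 (M *ᵥ x)‖ ≤ _ at h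
  have h2 := pow_le_pow_left₀ (norm_nonneg _) h 2
  rw [mul_pow] at h2
  linarith

theorem norm_le_of_gram_le {M : Matrix (Fin n) (Fin m) ℝ} {c : ℝ} (hc : 0 ≤ c)
    (h : Mᵀ * M ≤ (c ^ 2) • 1) : ‖M‖ ≤ c := by
  rw [Matrix.l2_opNorm_def]
  refine ContinuousLinearMap.opNorm_le_bound _ hc fun x => ?_
  have h0 := (nonneg_iff_dotProduct (by simp)).1 (sub_nonneg.2 h) x.ofLp
  have h1 : x.ofLp ⬝ᵥ (Mᵀ * M) *ᵥ x.ofLp = (M *ᵥ x.ofLp) ⬝ᵥ (M *ᵥ x.ofLp) := by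
    rw [← Matrix.mulVec_mulVec, Matrix.dotProduct_mulVec, Matrix.vecMul_transpose]
  rw [Matrix.sub_mulVec, dotProduct_sub, h1, Matrix.smul_mulVec, Matrix.one_mulVec, dotProduct_smul,
    dotProduct_self_eq_norm_sq, dotProduct_self_eq_norm_sq, smul_eq_mul] at h0
  have h2 : ‖WithLp.toLp 2 (M *ᵥ x.ofLp)‖ ^ 2 ≤ (c * ‖x‖) ^ 2 := by
    rw [mul_pow]; linarith
  exact abs_le_of_sq_le_sq' h2 (by positivity) |>.2

theorem norm_transpose (M : Matrix (Fin n) (Fin m) ℝ) : ‖Mᵀ‖ = ‖M‖ := by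
  rw [← Matrix.conjTranspose_eq_transpose_of_trivial, Matrix.l2_opNorm_conjTranspose]

/-- A symmetric matrix with `-c I ⪯ Y ⪯ c I` has norm at most `c`. -/
theorem norm_le_of_abs_le {Y : Matrix (Fin n) (Fin n) ℝ} {c : ℝ} (hc : 0 ≤ c)
    (h1 : -(c • 1) ≤ Y) (h2 : Y ≤ c • 1) : ‖Y‖ ≤ c := by
  have hY : Yᵀ = Y := isSymm_of_le (smul_one_isSymm c) h2
  -- A strict d > c allows division by 2d even if c = 0. The bound on Y² comes from (d-Y)(d+Y)(d-Y)
  -- + (d+Y)(d-Y)(d+Y) = 2d (d² - Y²).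
  have key : ∀ d : ℝ, c < d → ‖Y‖ ≤ d := by
    intro d hd
    have hd0 : 0 < d := hc.trans_lt hd
    have hcd : (c • 1 : Matrix (Fin n) (Fin n) ℝ) ≤ d • 1 :=
      smul_le_smul_right_matrix hd.le one_nonneg_matrix
    have a1 : 0 ≤ d • 1 + Y := by
      have := add_le_add hcd h1
      rw [← sub_nonneg] at this
      convert this using 1; abel
    have a2 : 0 ≤ d • 1 - Y := sub_nonneg.2 (h2.trans hcd)
    have b1 := conj_nonneg a1 (d • 1 - Y)
    have b2 := conj_nonneg a2 (d • 1 + Y)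
    refine norm_le_of_gram_le hd0.le ?_
    rw [hY, ← sub_nonneg]
    have b3 := smul_nonneg_matrix (c := (2 * d)⁻¹) (by positivity) (add_nonneg b1 b2)
    convert b3 using 1
    simp only [Matrix.transpose_sub, Matrix.transpose_add, hY, smul_one_isSymm]
    simp only [Matrix.sub_mul, Matrix.mul_sub, Matrix.add_mul, Matrix.mul_add, Matrix.smul_mul,
      Matrix.mul_smul, Matrix.one_mul, Matrix.mul_one, smul_sub, smul_add, smul_smul]
    match_scalars <;> field_simp <;> ring
  exact le_of_forall_gt_imp_ge_of_dense key

theorem le_norm_smul_one {Y : Matrix (Fin n) (Fin n) ℝ} (hY : Yᵀ = Y) : Y ≤ ‖Y‖ • 1 := by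
  rw [← sub_nonneg, nonneg_iff_dotProduct (by simp [hY])]
  intro x
  rw [Matrix.sub_mulVec, dotProduct_sub, Matrix.smul_mulVec, Matrix.one_mulVec, dotProduct_smul,
    dotProduct_self_eq_norm_sq, smul_eq_mul]
  have h := Matrix.l2_opNorm_mulVec Y (WithLp.toLp 2 x)
  have h2 : x ⬝ᵥ Y *ᵥ x ≤ ‖WithLp.toLp 2 x‖ * ‖WithLp.toLp 2 (Y *ᵥ x)‖ := by
    have := real_inner_le_norm (WithLp.toLp 2 x) (WithLp.toLp 2 (Y *ᵥ x))
    rwa [EuclideanSpace.inner_toLp_toLp, dotProduct_comm, star_trivial] at this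
  simp only at h
  have h3 := mul_le_mul_of_nonneg_left h (norm_nonneg (WithLp.toLp 2 x))
  change _ * ‖WithLp.toLp 2 (Y *ᵥ x)‖ ≤ _ at h3
  nlinarith

theorem le_smul_one_of_norm_le {Y : Matrix (Fin n) (Fin n) ℝ} {c : ℝ} (hY : Yᵀ = Y)
    (h : ‖Y‖ ≤ c) : Y ≤ c • 1 :=
  (le_norm_smul_one hY).trans (smul_le_smul_right_matrix h one_nonneg_matrix)

theorem norm_le_of_nonneg_of_le {Y : Matrix (Fin n) (Fin n) ℝ} {c : ℝ} (hc : 0 ≤ c)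
    (h1 : 0 ≤ Y) (h2 : Y ≤ c • 1) : ‖Y‖ ≤ c :=
  norm_le_of_abs_le hc ((neg_nonpos.2 (smul_nonneg_matrix hc one_nonneg_matrix)).trans h1) h2

/-- The traces of (u-U)(Z-D) and (u+U)(Z+D) are nonnegative and add up to 2 tr(uZ + UD); the mixed
products give the other sign. This handles an indefinite D through a dominating Z. -/
theorem abs_trace_mul_le {U D Z : Matrix (Fin n) (Fin n) ℝ} {u : ℝ} (hU : Uᵀ = U) (hu : ‖U‖ ≤ u)
    (h1 : -Z ≤ D) (h2 : D ≤ Z) : |(U * D).trace| ≤ u * Z.trace := by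
  have a1 : 0 ≤ u • 1 - U := sub_nonneg.2 (le_smul_one_of_norm_le hU hu)
  have a2 : 0 ≤ u • 1 + U := by
    have := le_smul_one_of_norm_le (Y := -U) (c := u) (by simp [hU]) (by simpa using hu)
    rw [← sub_nonneg] at this
    simpa using this
  have b1 : 0 ≤ Z - D := sub_nonneg.2 h2
  have b2 : 0 ≤ Z + D := by
    rw [← sub_nonneg] at h1; convert h1 using 1; abel
  have c1 := trace_mul_nonneg a1 b1
  have c2 := trace_mul_nonneg a2 b2
  have c3 := trace_mul_nonneg a1 b2
  have c4 := trace_mul_nonneg a2 b1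
  simp only [Matrix.sub_mul, Matrix.mul_sub, Matrix.add_mul, Matrix.mul_add, Matrix.smul_mul,
    Matrix.one_mul, Matrix.trace_sub, Matrix.trace_add, Matrix.trace_smul, smul_eq_mul]
    at c1 c2 c3 c4
  rw [abs_le]
  constructor <;> linarith

theorem trace_conj_le {X : Matrix (Fin n) (Fin n) ℝ} (hX : 0 ≤ X)
    (M : Matrix (Fin m) (Fin n) ℝ) : (M * X * Mᵀ).trace ≤ ‖M‖ ^ 2 * X.trace := by
  rw [Matrix.trace_mul_comm, ← Matrix.mul_assoc]
  exact trace_mul_le_of_le_smul_one (gram_le M) hX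

/-- With A = CᵀC, Cauchy-Schwarz in each row of C bounds ‖Cx‖² by the squared Frobenius norm of C,
which is tr A. This turns the trace bounds on the costs into Loewner bounds. -/
theorem le_trace_smul_one {A : Matrix (Fin n) (Fin n) ℝ} (hA : 0 ≤ A) : A ≤ A.trace • 1 := by
  obtain ⟨C, hC⟩ := CStarAlgebra.nonneg_iff_eq_star_mul_self.1 hA
  rw [Matrix.star_eq_conjTranspose, Matrix.conjTranspose_eq_transpose_of_trivial] at hC
  rw [← sub_nonneg, nonneg_iff_dotProduct (by simp [isSymm_of_nonneg hA])]
  intro x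
  rw [Matrix.sub_mulVec, dotProduct_sub, Matrix.smul_mulVec, Matrix.one_mulVec, dotProduct_smul,
    smul_eq_mul]
  have h1 : x ⬝ᵥ A *ᵥ x = (C *ᵥ x) ⬝ᵥ (C *ᵥ x) := by
    rw [hC, ← Matrix.mulVec_mulVec, Matrix.dotProduct_mulVec, Matrix.vecMul_transpose]
  have h2 : A.trace = ∑ i, ∑ j, C i j ^ 2 := by
    rw [hC, Matrix.trace, Finset.sum_comm]
    simp [Matrix.mul_apply, sq]
  rw [h1, h2, sub_nonneg, dotProduct, Finset.sum_mul]
  refine Finset.sum_le_sum fun i _ => ?_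
  have := Finset.sum_mul_sq_le_sq_mul_sq Finset.univ (fun j => C i j) x
  simpa [Matrix.mulVec, dotProduct, sq] using this

theorem norm_le_trace {A : Matrix (Fin n) (Fin n) ℝ} (hA : 0 ≤ A) : ‖A‖ ≤ A.trace :=
  norm_le_of_nonneg_of_le (trace_nonneg_of_nonneg hA) hA (le_trace_smul_one hA)

theorem nonneg_of_tendsto {A : ℕ → Matrix (Fin n) (Fin n) ℝ} {B : Matrix (Fin n) (Fin n) ℝ}
    (hA : ∀ k, 0 ≤ A k) (h : Filter.Tendsto A Filter.atTop (nhds B)) : 0 ≤ B := by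
  have hB : Bᵀ = B := by
    have h1 : Filter.Tendsto (fun k => (A k)ᵀ) Filter.atTop (nhds Bᵀ) :=
      (Continuous.matrix_transpose continuous_id).continuousAt.tendsto.comp h
    simp only [isSymm_of_nonneg (hA _)] at h1
    exact tendsto_nhds_unique h1 h
  rw [nonneg_iff_dotProduct hB]
  intro x
  have hc : Continuous fun M : Matrix (Fin n) (Fin n) ℝ => x ⬝ᵥ M *ᵥ x := by fun_prop
  exact ge_of_tendsto' (hc.continuousAt.tendsto.comp h)
    fun k => (nonneg_iff_dotProduct (isSymm_of_nonneg (hA k))).1 (hA k) x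

end Loewner

/-! ### Stability and Lyapunov certificates -/

section Stability

open Filter Topology

variable {n m : ℕ}

/-- Gelfand's formula: for r between the spectral radius and 1, eventually ‖a ^ k‖ ≤ r ^ k. -/
theorem tendsto_pow_of_spectralRadius_lt_one {E : Type*} [NormedRing E] [NormedAlgebra ℂ E]
    [CompleteSpace E] {a : E} (h : spectralRadius ℂ a < 1) :
    Tendsto (fun k : ℕ => a ^ k) atTop (𝓝 0) := by
  obtain ⟨r, hr1, hr2⟩ := exists_between h
  have h1 := spectrum.pow_nnnorm_pow_one_div_tendsto_nhds_spectralRadius a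
  have h2 : ∀ᶠ k : ℕ in atTop, (‖a ^ k‖₊ : ENNReal) ≤ r ^ k := by
    filter_upwards [h1.eventually (gt_mem_nhds hr1), eventually_ge_atTop 1] with k hk hk1
    have hk0 : (0 : ℝ) < k := by exact_mod_cast hk1
    have := ENNReal.rpow_le_rpow hk.le hk0.le
    rwa [← ENNReal.rpow_mul, one_div, inv_mul_cancel₀ hk0.ne', ENNReal.rpow_one,
      ENNReal.rpow_natCast] at this
  have h3 : Tendsto (fun k : ℕ => (‖a ^ k‖₊ : ENNReal)) atTop (𝓝 0) :=
    tendsto_of_tendsto_of_tendsto_of_le_of_le' tendsto_const_nhds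
      (ENNReal.tendsto_pow_atTop_nhds_zero_of_lt_one hr2) (Eventually.of_forall fun _ => zero_le) h2
  rw [tendsto_zero_iff_norm_tendsto_zero]
  have h4 := (ENNReal.tendsto_toReal ENNReal.zero_ne_top).comp h3
  simpa [Function.comp_def] using h4

/-- A single power of norm below 1 suffices, since its root bounds the spectral radius. -/
theorem spectralRadius_lt_one_of_tendsto_pow {E : Type*} [NormedRing E] [NormedAlgebra ℂ E]
    [CompleteSpace E] [NormOneClass E] {a : E} (h : Tendsto (fun k : ℕ => a ^ k) atTop (𝓝 0)) :
    spectralRadius ℂ a < 1 := by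
  rw [tendsto_zero_iff_norm_tendsto_zero] at h
  have h1 := (tendsto_add_atTop_iff_nat 1).2 h
  obtain ⟨k, hk⟩ := (h1.eventually (gt_mem_nhds one_pos)).exists
  refine (spectrum.spectralRadius_le_pow_nnnorm_pow_one_div ℂ a k).trans_lt ?_
  rw [nnnorm_one, ENNReal.coe_one, ENNReal.one_rpow, mul_one]
  refine ENNReal.rpow_lt_one ?_ (by positivity)
  exact_mod_cast hk

theorem map_ofReal_pow (F : Matrix (Fin n) (Fin n) ℝ) (k : ℕ) :
    (F.map Complex.ofReal) ^ k = (F ^ k).map Complex.ofReal :=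
  (map_pow (Complex.ofRealHom.mapMatrix (m := Fin n)) F k).symm

/-- Real powers are compared with complex ones through the continuous entrywise maps
`Complex.ofReal` and `Complex.re`. From here on stability is used only through powers. -/
theorem isStable_iff_tendsto_pow [NeZero n] {A : Matrix (Fin n) (Fin n) ℝ}
    {B : Matrix (Fin n) (Fin m) ℝ} {K : Matrix (Fin m) (Fin n) ℝ} :
    IsStable A B K ↔ Tendsto (fun k : ℕ => closedLoop A B K ^ k) atTop (𝓝 0) := by
  have hc1 : Continuous fun M : Matrix (Fin n) (Fin n) ℝ => M.map Complex.ofReal :=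
    Continuous.matrix_map continuous_id Complex.continuous_ofReal
  have hc2 : Continuous fun M : Matrix (Fin n) (Fin n) ℂ => M.map Complex.re :=
    Continuous.matrix_map continuous_id Complex.continuous_re
  constructor
  · intro h
    have h1 := (hc2.tendsto 0).comp (tendsto_pow_of_spectralRadius_lt_one h)
    convert h1 using 1
    · ext k : 1
      simp only [Function.comp, map_ofReal_pow]
      ext i j; simp
    · simp
  · intro h
    refine spectralRadius_lt_one_of_tendsto_pow ?_
    have h1 := (hc1.tendsto 0).comp h
    convert h1 using 1
    · ext k : 1
      simp only [Function.comp, map_ofReal_pow]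
    · simp

theorem tendsto_conj_pow_zero {F : Matrix (Fin n) (Fin n) ℝ}
    (hF : Tendsto (fun k : ℕ => F ^ k) atTop (𝓝 0)) (N : Matrix (Fin n) (Fin n) ℝ) :
    Tendsto (fun k : ℕ => (F ^ k)ᵀ * N * F ^ k) atTop (𝓝 0) := by
  have hc : Continuous fun M : Matrix (Fin n) (Fin n) ℝ => Mᵀ * N * M := by fun_prop
  have h := (hc.tendsto 0).comp hF
  simp only [Matrix.mul_zero] at h
  exact h

/-- A matrix that decreases under the conjugation by a stable matrix is positive semidefinite. -/
theorem nonneg_of_conj_le {F N : Matrix (Fin n) (Fin n) ℝ}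
    (hF : Tendsto (fun k : ℕ => F ^ k) atTop (𝓝 0)) (h : Fᵀ * N * F ≤ N) : 0 ≤ N := by
  -- The difference is a sum of conjugates of N - FᵀNF, and it converges to N.
  have h1 : ∀ k : ℕ, 0 ≤ N - (F ^ k)ᵀ * N * F ^ k := by
    intro k
    induction k with
    | zero => simp
    | succ k ih =>
      have := add_nonneg (sub_nonneg.2 h) (conj_nonneg ih F)
      convert this using 1
      rw [pow_succ, Matrix.transpose_mul]
      noncomm_ring
  refine nonneg_of_tendsto h1 ?_
  simpa using (tendsto_conj_pow_zero hF N).const_sub N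

/-- `P` certifies the stability of `F`: `μ I ⪯ P ⪯ ν I` and `Fᵀ P F ⪯ P - μ I`. -/
structure IsCert (μ ν : ℝ) (P F : Matrix (Fin n) (Fin n) ℝ) : Prop where
  lower : μ • 1 ≤ P
  upper : P ≤ ν • 1
  decr : Fᵀ * P * F ≤ P - μ • 1

namespace IsCert

variable {μ ν : ℝ} {P F : Matrix (Fin n) (Fin n) ℝ}

theorem nonneg (h : IsCert μ ν P F) (hμ : 0 < μ) : 0 ≤ P :=
  (smul_nonneg_matrix hμ.le one_nonneg_matrix).trans h.lower

theorem contract (h : IsCert μ ν P F) (hμ : 0 < μ) (hν : 0 < ν) :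
    Fᵀ * P * F ≤ (1 - μ / ν) • P := by
  refine h.decr.trans ?_
  have := smul_le_smul_matrix (c := μ / ν) (by positivity) h.upper
  rw [smul_smul, div_mul_cancel₀ _ hν.ne'] at this
  rw [sub_smul, one_smul]
  exact sub_le_sub_left this P

theorem conj_pow_le (h : IsCert μ ν P F) (hμ : 0 < μ) (hν : 0 < ν) (hμν : μ ≤ ν) (k : ℕ) :
    (F ^ k)ᵀ * P * F ^ k ≤ ((1 - μ / ν) ^ k) • P := by
  have h0 : 0 ≤ 1 - μ / ν := sub_nonneg.2 ((div_le_one hν).2 hμν)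
  induction k with
  | zero => simp
  | succ k ih =>
    have h1 : (F ^ (k + 1))ᵀ * P * F ^ (k + 1) = Fᵀ * ((F ^ k)ᵀ * P * F ^ k) * F := by
      rw [pow_succ, Matrix.transpose_mul]; simp only [Matrix.mul_assoc]
    rw [h1]
    refine (conj_mono ih F).trans ?_
    rw [Matrix.mul_smul, Matrix.smul_mul, pow_succ, mul_smul]
    exact smul_le_smul_matrix (by positivity) (h.contract hμ hν)

/-- The lower bound on the weight M converts an M-weighted bound into an operator norm; the closed
loops, their powers, the gains and the gain steps are all bounded this way. -/
theorem norm_le_of_conj_le {M : Matrix (Fin m) (Fin m) ℝ} {G : Matrix (Fin m) (Fin n) ℝ} {c : ℝ}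
    (hμ : 0 < μ) (hc : 0 ≤ c) (hM : μ • 1 ≤ M) (h : Gᵀ * M * G ≤ (c ^ 2 * μ) • 1) : ‖G‖ ≤ c := by
  refine norm_le_of_gram_le hc ?_
  have h1 := (conj_mono hM G).trans h
  rw [Matrix.mul_smul, Matrix.smul_mul, Matrix.mul_one] at h1
  have h2 := smul_le_smul_matrix (c := μ⁻¹) (by positivity) h1
  rwa [smul_smul, smul_smul, inv_mul_cancel₀ hμ.ne', one_smul, mul_comm (c ^ 2), ← mul_assoc,
    inv_mul_cancel₀ hμ.ne', one_mul] at h2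

theorem norm_le (h : IsCert μ ν P F) (hμ : 0 < μ) {κ : ℝ} (hκ : 0 ≤ κ) (hκν : κ ^ 2 * μ = ν) :
    ‖F‖ ≤ κ := by
  refine norm_le_of_conj_le hμ hκ h.lower (h.decr.trans ?_)
  rw [hκν]
  exact (sub_le_self _ (smul_nonneg_matrix hμ.le one_nonneg_matrix)).trans h.upper

theorem tendsto_pow (h : IsCert μ ν P F) (hμ : 0 < μ) (hμν : μ ≤ ν) :
    Tendsto (fun k : ℕ => F ^ k) atTop (𝓝 0) := by
  have hν : 0 < ν := hμ.trans_le hμν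
  have hl0 : 0 ≤ 1 - μ / ν := sub_nonneg.2 ((div_le_one hν).2 hμν)
  have hl1 : 1 - μ / ν < 1 := by have : 0 < μ / ν := by positivity
                                 linarith
  rw [tendsto_zero_iff_norm_tendsto_zero]
  refine squeeze_zero (g := fun k => √((1 - μ / ν) ^ k * (ν / μ))) (fun _ => norm_nonneg _)
    (fun k => ?_) ?_
  · refine norm_le_of_conj_le hμ (Real.sqrt_nonneg _) h.lower
      ((h.conj_pow_le hμ hν hμν k).trans ?_)
    rw [Real.sq_sqrt (by positivity), mul_assoc, div_mul_cancel₀ _ hμ.ne', mul_smul]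
    exact smul_le_smul_matrix (by positivity) h.upper
  · have h1 := ((tendsto_pow_atTop_nhds_zero_of_lt_one hl0 hl1).mul_const (ν / μ)).sqrt
    simpa using h1

/-- Bound on the solution of a Lyapunov equation. -/
theorem norm_lyapunov_le (h : IsCert μ ν P F) (hμ : 0 < μ) (hμν : μ ≤ ν)
    {X Y : Matrix (Fin n) (Fin n) ℝ} {y : ℝ} (hX : X = Fᵀ * X * F + Y) (hy : 0 ≤ y)
    (h1 : -(y • 1) ≤ Y) (h2 : Y ≤ y • 1) : ‖X‖ ≤ ν / μ * y := by
  have hF := h.tendsto_pow hμ hμν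
  have hν : 0 < ν := hμ.trans_le hμν
  have key : ∀ X Y : Matrix (Fin n) (Fin n) ℝ, X = Fᵀ * X * F + Y → Y ≤ y • 1 →
      X ≤ (ν / μ * y) • 1 := by
    intro X Y hX h2
    -- Comparison principle: (y/μ) P is a supersolution, because P drops by at least μI under
    -- conjugation.
    have e1 : Fᵀ * ((y / μ) • P - X) * F ≤ (y / μ) • P - X := by
      have a1 := smul_le_smul_matrix (c := y / μ) (by positivity) h.decr
      rw [smul_sub, smul_smul, div_mul_cancel₀ _ hμ.ne'] at a1
      rw [← sub_nonneg] at a1 h2 ⊢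
      have := add_nonneg a1 h2
      convert this using 1
      nth_rw 1 [hX]
      simp only [Matrix.mul_sub, Matrix.sub_mul, Matrix.mul_smul, Matrix.smul_mul]
      abel
    have e2 := sub_nonneg.1 (nonneg_of_conj_le hF e1)
    refine e2.trans ((smul_le_smul_matrix (by positivity) h.upper).trans_eq ?_)
    rw [smul_smul]; congr 1; ring
  refine norm_le_of_abs_le (by positivity) ?_ (key X Y hX h2)
  refine neg_le.1 (key (-X) (-Y) ?_ (neg_le.1 h1))
  nth_rw 1 [hX]
  simp only [Matrix.mul_neg, Matrix.neg_mul]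
  abel

/-- The trace against a certificate contracts along `Z ↦ F Z Fᵀ`. -/
theorem trace_mul_conj_le (h : IsCert μ ν P F) (hμ : 0 < μ) (hν : 0 < ν)
    {Z : Matrix (Fin n) (Fin n) ℝ} (hZ : 0 ≤ Z) :
    (P * (F * Z * Fᵀ)).trace ≤ (1 - μ / ν) * (P * Z).trace := by
  rw [← trace_conj_mul]
  have := trace_mul_mono (h.contract hμ hν) hZ
  rwa [Matrix.smul_mul, Matrix.trace_smul, smul_eq_mul] at this

end IsCert

end Stability

/-! ### One step of the Riccati recursion -/

section Riccati

variable {n m : ℕ}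

/-- The matrix `Q + Kᵀ R K` of the stage cost of the policy `u = -K x`. -/
def stageCost (Q : Matrix (Fin n) (Fin n) ℝ) (R : Matrix (Fin m) (Fin m) ℝ)
    (K : Matrix (Fin m) (Fin n) ℝ) : Matrix (Fin n) (Fin n) ℝ :=
  Q + Kᵀ * R * K

theorem stageCost_mono {Q Q' : Matrix (Fin n) (Fin n) ℝ} {R R' : Matrix (Fin m) (Fin m) ℝ}
    (hQ : Q ≤ Q') (hR : R ≤ R') (K : Matrix (Fin m) (Fin n) ℝ) :
    stageCost Q R K ≤ stageCost Q' R' K :=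
  add_le_add hQ (conj_mono hR K)

theorem stageCost_smul_one (c : ℝ) (K : Matrix (Fin m) (Fin n) ℝ) :
    stageCost (c • 1) (c • 1) K = c • stageCost 1 1 K := by
  simp [stageCost]

theorem stageCost_sub (Q Q' : Matrix (Fin n) (Fin n) ℝ) (R R' : Matrix (Fin m) (Fin m) ℝ)
    (K : Matrix (Fin m) (Fin n) ℝ) :
    stageCost (Q - Q') (R - R') K = stageCost Q R K - stageCost Q' R' K := by
  simp only [stageCost, Matrix.mul_sub, Matrix.sub_mul]; abel

theorem one_le_stageCost_one (K : Matrix (Fin m) (Fin n) ℝ) : 1 ≤ stageCost 1 1 K := by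
  simpa [stageCost] using gram_nonneg K

theorem stageCost_one_le (K : Matrix (Fin m) (Fin n) ℝ) :
    stageCost 1 1 K ≤ (1 + ‖K‖ ^ 2) • 1 := by
  rw [add_smul, one_smul, stageCost, Matrix.mul_one]
  exact add_le_add_right (gram_le K) 1

variable {A : Matrix (Fin n) (Fin n) ℝ} {B : Matrix (Fin n) (Fin m) ℝ}
  {P : Matrix (Fin n) (Fin n) ℝ} {R : Matrix (Fin m) (Fin m) ℝ} {μ : ℝ}

theorem smul_one_le_conj_add (hP : 0 ≤ P) (hR : μ • 1 ≤ R) : μ • 1 ≤ Bᵀ * P * B + R :=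
  hR.trans (le_add_of_nonneg_left (conj_nonneg hP B))

theorem isUnit_det_of_smul_one_le {S : Matrix (Fin m) (Fin m) ℝ} (hμ : 0 < μ) (hS : μ • 1 ≤ S) :
    IsUnit S.det := by
  have h1 : (μ • (1 : Matrix (Fin m) (Fin m) ℝ)).PosDef := Matrix.PosDef.one.smul hμ
  have h2 : S.PosDef := by
    have := h1.add_posSemidef (Matrix.le_iff.1 hS)
    simpa using this
  exact isUnit_iff_ne_zero.2 h2.det_pos.ne'

theorem mul_gain (hμ : 0 < μ) (hP : 0 ≤ P) (hR : μ • 1 ≤ R) :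
    (Bᵀ * P * B + R) * gain A B R P = Bᵀ * P * A := by
  rw [gain, ← Matrix.mul_assoc, ← Matrix.mul_assoc, ← Matrix.mul_assoc, Matrix.mul_nonsing_inv _
    (isUnit_det_of_smul_one_le hμ (smul_one_le_conj_add hP hR)), Matrix.one_mul]

/-- This form of the normal equation has Bᵀ on the left, so it bounds the gain by a multiple of ‖B‖
in `norm_K_succ_le`. -/
theorem mul_gain_eq_closedLoop (hμ : 0 < μ) (hP : 0 ≤ P) (hR : μ • 1 ≤ R) :
    R * gain A B R P = Bᵀ * P * closedLoop A B (gain A B R P) := by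
  rw [closedLoop, Matrix.mul_sub, ← mul_gain hμ hP hR, Matrix.add_mul, ← Matrix.mul_assoc]
  abel

/-- Completing the square in the Bellman equation. -/
theorem bellman_eq_gain_add (hμ : 0 < μ) (hP : 0 ≤ P) (hR : μ • 1 ≤ R)
    (Q : Matrix (Fin n) (Fin n) ℝ) (K : Matrix (Fin m) (Fin n) ℝ) :
    (closedLoop A B K)ᵀ * P * closedLoop A B K + stageCost Q R K =
      (closedLoop A B (gain A B R P))ᵀ * P * closedLoop A B (gain A B R P) +
        stageCost Q R (gain A B R P) +
        (K - gain A B R P)ᵀ * (Bᵀ * P * B + R) * (K - gain A B R P) := by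
  have hRs : Rᵀ = R := isSymm_of_ge (smul_one_isSymm μ) hR
  have hPs : Pᵀ = P := isSymm_of_nonneg hP
  have h0 := mul_gain (A := A) (B := B) hμ hP hR
  set G := gain A B R P with hG
  have h1 : Bᵀ * (P * A) = Bᵀ * (P * (B * G)) + R * G := by
    rw [← Matrix.mul_assoc, ← h0, Matrix.add_mul]; simp only [Matrix.mul_assoc]
  have h2 : Aᵀ * (P * B) = Gᵀ * (Bᵀ * (P * B)) + Gᵀ * R := by
    have := congrArg Matrix.transpose h1
    simpa [Matrix.transpose_mul, hPs, hRs, Matrix.mul_assoc] using this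
  -- `h2` with a trailing factor, as needed for rewriting right-associated products.
  have h3 : ∀ L : Matrix (Fin m) (Fin n) ℝ,
      Aᵀ * (P * (B * L)) = Gᵀ * (Bᵀ * (P * (B * L))) + Gᵀ * (R * L) := by
    intro L
    have := congrArg (· * L) h2
    simpa [Matrix.mul_assoc, Matrix.add_mul] using this
  simp only [closedLoop, stageCost, Matrix.transpose_sub, Matrix.transpose_mul, Matrix.sub_mul,
    Matrix.mul_sub, Matrix.add_mul, Matrix.mul_add, Matrix.mul_assoc, h1, h3]
  abel

/-- Difference of two normal equations. The factor Bᵀ P B + R stays on the left because the Bellman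
residual is the quadratic form of the gain step in exactly this matrix. -/
theorem mul_gain_sub_gain {P₀ : Matrix (Fin n) (Fin n) ℝ} {R₀ : Matrix (Fin m) (Fin m) ℝ}
    (hμ : 0 < μ) (hP : 0 ≤ P) (hR : μ • 1 ≤ R) (hP₀ : 0 ≤ P₀) (hR₀ : μ • 1 ≤ R₀) :
    (Bᵀ * P * B + R) * (gain A B R P - gain A B R₀ P₀) =
      Bᵀ * (P - P₀) * closedLoop A B (gain A B R₀ P₀) - (R - R₀) * gain A B R₀ P₀ := by
  have h1 := mul_gain (A := A) (B := B) hμ hP hR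
  have h0 := mul_gain (A := A) (B := B) hμ hP₀ hR₀
  rw [Matrix.mul_sub, h1]
  set G := gain A B R₀ P₀
  have h2 : Bᵀ * (P₀ * A) = Bᵀ * (P₀ * (B * G)) + R₀ * G := by
    rw [← Matrix.mul_assoc, ← h0, Matrix.add_mul]; simp only [Matrix.mul_assoc]
  simp only [closedLoop, Matrix.sub_mul, Matrix.mul_sub, Matrix.add_mul, Matrix.mul_assoc, h2]
  abel

theorem conj_le_of_mul_eq {S : Matrix (Fin m) (Fin m) ℝ} {D G : Matrix (Fin m) (Fin n) ℝ}
    (hS : Sᵀ = S) (h : S * D = G) : Dᵀ * S * D ≤ (‖D‖ * ‖G‖) • 1 := by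
  refine le_smul_one_of_norm_le ?_ ?_
  · simp [Matrix.transpose_mul, hS, Matrix.mul_assoc]
  · rw [Matrix.mul_assoc, h]
    exact (Matrix.l2_opNorm_mul _ _).trans_eq (by rw [norm_transpose])

theorem norm_le_of_mul_eq {S : Matrix (Fin m) (Fin m) ℝ} {D G : Matrix (Fin m) (Fin n) ℝ}
    (hμ : 0 < μ) (hS : μ • 1 ≤ S) (h : S * D = G) : ‖D‖ ≤ ‖G‖ / μ := by
  have hs : Sᵀ = S := isSymm_of_ge (smul_one_isSymm μ) hS
  have h1 : ‖D‖ ≤ √(‖D‖ * ‖G‖ / μ) := by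
    refine IsCert.norm_le_of_conj_le hμ (Real.sqrt_nonneg _) hS ((conj_le_of_mul_eq hs h).trans_eq ?_)
    rw [Real.sq_sqrt (by positivity), div_mul_cancel₀ _ hμ.ne']
  have h2 := Real.le_sqrt' (x := ‖D‖) (y := ‖D‖ * ‖G‖ / μ)
  rcases (norm_nonneg D).eq_or_lt with h0 | h0
  · rw [← h0]; positivity
  · have h3 := (h2 h0).1 h1
    rw [sq, mul_div_assoc] at h3
    exact le_of_mul_le_mul_left h3 h0

/-- Since DᵀSD = DᵀG and ‖D‖ ≤ ‖G‖/μ, no upper bound on S enters. Applied to gain steps, it makes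
the Bellman residual quadratically small. -/
theorem conj_le_sq_of_mul_eq {S : Matrix (Fin m) (Fin m) ℝ} {D G : Matrix (Fin m) (Fin n) ℝ}
    (hμ : 0 < μ) (hS : μ • 1 ≤ S) (h : S * D = G) : Dᵀ * S * D ≤ (‖G‖ ^ 2 / μ) • 1 := by
  refine (conj_le_of_mul_eq (isSymm_of_ge (smul_one_isSymm μ) hS) h).trans
    (smul_le_smul_right_matrix ?_ one_nonneg_matrix)
  calc ‖D‖ * ‖G‖ ≤ ‖G‖ / μ * ‖G‖ := by gcongr; exact norm_le_of_mul_eq hμ hS h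
    _ = ‖G‖ ^ 2 / μ := by ring

/-- Policy evaluation under a stable policy dominates the stage cost. -/
theorem IsPolicyValue.stageCost_le {Q : Matrix (Fin n) (Fin n) ℝ} {K : Matrix (Fin m) (Fin n) ℝ}
    (h : IsPolicyValue A B Q R K P)
    (hF : Filter.Tendsto (fun k : ℕ => closedLoop A B K ^ k) Filter.atTop (nhds 0))
    (hQ : 0 ≤ stageCost Q R K) : stageCost Q R K ≤ P := by
  have h' : P = (closedLoop A B K)ᵀ * P * closedLoop A B K + stageCost Q R K := by
    rw [stageCost, ← add_assoc]; exact h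
  have hP : 0 ≤ P := nonneg_of_conj_le hF (by
    nth_rw 2 [h']
    exact le_add_of_nonneg_right hQ)
  nth_rw 1 [h']
  exact le_add_of_nonneg_left (conj_nonneg hP _)

theorem IsPolicyValue.eq_add_stageCost {Q : Matrix (Fin n) (Fin n) ℝ}
    {K : Matrix (Fin m) (Fin n) ℝ} (h : IsPolicyValue A B Q R K P) :
    P = (closedLoop A B K)ᵀ * P * closedLoop A B K + stageCost Q R K := by
  rw [stageCost, ← add_assoc]; exact h

end Riccati

/-! ### Running averages -/

section RunAvg

variable {d : ℕ} {M : ℕ → Matrix (Fin d) (Fin d) ℝ} {μ σ : ℝ}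

theorem smul_runAvg (t : ℕ) : (t : ℝ) • runAvg M t = ∑ s ∈ Finset.Icc 1 t, M s := by
  induction t with
  | zero => simp
  | succ t ih =>
    rw [Finset.sum_Icc_succ_top (by omega), ← ih, runAvg, smul_add, smul_smul, smul_smul]
    push_cast
    congr 2
    · field_simp
    · rw [mul_one_div_cancel (by positivity), one_smul]

theorem succ_smul_runAvg_sub (t : ℕ) :
    ((t : ℝ) + 1) • (runAvg M (t + 1) - runAvg M t) = M (t + 1) - runAvg M t := by
  rw [runAvg]
  match_scalars <;> field_simp
  ring

theorem runAvg_mem_Icc {a b : Matrix (Fin d) (Fin d) ℝ} (hM : ∀ t, 1 ≤ t → a ≤ M t ∧ M t ≤ b)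
    {t : ℕ} (ht : 1 ≤ t) : a ≤ runAvg M t ∧ runAvg M t ≤ b := by
  have ht0 : (0 : ℝ) < t := by exact_mod_cast ht
  have key : runAvg M t = (t : ℝ)⁻¹ • ∑ s ∈ Finset.Icc 1 t, M s := by
    rw [← smul_runAvg, smul_smul, inv_mul_cancel₀ ht0.ne', one_smul]
  have cst : ∀ c : Matrix (Fin d) (Fin d) ℝ, c = (t : ℝ)⁻¹ • ∑ s ∈ Finset.Icc 1 t, c := by
    intro c
    rw [Finset.sum_const, Nat.card_Icc, Nat.add_sub_cancel, ← Nat.cast_smul_eq_nsmul ℝ, smul_smul,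
      inv_mul_cancel₀ ht0.ne', one_smul]
  rw [key]
  constructor
  · rw [cst a]
    exact smul_le_smul_matrix (by positivity)
      (Finset.sum_le_sum fun s hs => (hM s (Finset.mem_Icc.1 hs).1).1)
  · rw [cst b]
    exact smul_le_smul_matrix (by positivity)
      (Finset.sum_le_sum fun s hs => (hM s (Finset.mem_Icc.1 hs).1).2)

theorem runAvg_succ_sub_le (hM : ∀ t, 1 ≤ t → 0 ≤ M t ∧ M t ≤ σ • 1) {t : ℕ}
    (ht : 1 ≤ t) :
    -((σ / (t + 1)) • 1) ≤ runAvg M (t + 1) - runAvg M t ∧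
      runAvg M (t + 1) - runAvg M t ≤ (σ / (t + 1)) • 1 := by
  have h := succ_smul_runAvg_sub (M := M) t
  have hA := runAvg_mem_Icc hM ht
  have hB := hM (t + 1) (by omega)
  have e : runAvg M (t + 1) - runAvg M t = ((t : ℝ) + 1)⁻¹ • (M (t + 1) - runAvg M t) := by
    rw [← h, smul_smul, inv_mul_cancel₀ (by positivity), one_smul]
  have e2 : (σ / ((t : ℝ) + 1)) • (1 : Matrix (Fin d) (Fin d) ℝ) =
      ((t : ℝ) + 1)⁻¹ • (σ • 1) := by rw [smul_smul]; congr 1; field_simp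
  rw [e, e2, ← smul_neg]
  constructor
  · refine smul_le_smul_matrix (by positivity) ?_
    have := add_le_add hB.1 (neg_le_neg hA.2)
    simpa [sub_eq_add_neg] using this
  · refine smul_le_smul_matrix (by positivity) ?_
    have := add_le_add hB.2 (neg_nonpos.2 hA.1)
    simpa [sub_eq_add_neg] using this

theorem norm_runAvg_succ_sub_le (hσ : 0 ≤ σ) (hM : ∀ t, 1 ≤ t → 0 ≤ M t ∧ M t ≤ σ • 1) {t : ℕ}
    (ht : 1 ≤ t) : ‖runAvg M (t + 1) - runAvg M t‖ ≤ σ / (t + 1) :=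
  norm_le_of_abs_le (by positivity) (runAvg_succ_sub_le hM ht).1 (runAvg_succ_sub_le hM ht).2

end RunAvg

/-! ### Loewner bounds and averages for the stage costs. -/

section CostBounds

variable {n m : ℕ} {Q : ℕ → Matrix (Fin n) (Fin n) ℝ} {R : ℕ → Matrix (Fin m) (Fin m) ℝ}
  {μ σ : ℝ}

theorem CostAssumption.Q_bounds (h : CostAssumption Q R μ σ) (hμ : 0 < μ) (t : ℕ) (ht : 1 ≤ t) :
    μ • 1 ≤ Q t ∧ Q t ≤ σ • 1 := by
  have h1 : μ • 1 ≤ Q t := Matrix.le_iff.2 (h.Q_lower t ht)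
  exact ⟨h1, (le_trace_smul_one ((smul_nonneg_matrix hμ.le one_nonneg_matrix).trans h1)).trans
    (smul_le_smul_right_matrix (h.Q_trace t ht) one_nonneg_matrix)⟩

theorem CostAssumption.R_bounds (h : CostAssumption Q R μ σ) (hμ : 0 < μ) (t : ℕ) (ht : 1 ≤ t) :
    μ • 1 ≤ R t ∧ R t ≤ σ • 1 := by
  have h1 : μ • 1 ≤ R t := Matrix.le_iff.2 (h.R_lower t ht)
  exact ⟨h1, (le_trace_smul_one ((smul_nonneg_matrix hμ.le one_nonneg_matrix).trans h1)).trans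
    (smul_le_smul_right_matrix (h.R_trace t ht) one_nonneg_matrix)⟩

theorem smul_stageCost_runAvg (t : ℕ) (K : Matrix (Fin m) (Fin n) ℝ) :
    (t : ℝ) • stageCost (runAvg Q t) (runAvg R t) K =
      ∑ s ∈ Finset.Icc 1 t, stageCost (Q s) (R s) K := by
  simp only [stageCost]
  rw [smul_add, smul_runAvg, Finset.sum_add_distrib, ← Matrix.smul_mul, ← Matrix.mul_smul,
    smul_runAvg, Matrix.mul_sum, Matrix.sum_mul]

end CostBounds

/-! ### Runs of the algorithm: stability and certificates -/

section RunBasic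

open Filter Topology

variable {n m : ℕ}

theorem pos_of_ne_zero {B : Matrix (Fin n) (Fin m) ℝ} (hB : B ≠ 0) : NeZero n := by
  refine ⟨?_⟩
  rintro rfl
  exact hB (Subsingleton.elim _ _)

theorem le_of_smul_one_le_smul_one [NeZero n] {a b : ℝ}
    (h : (a • 1 : Matrix (Fin n) (Fin n) ℝ) ≤ b • 1) : a ≤ b := by
  have := trace_mono h
  have hn : (0 : ℝ) < n := by exact_mod_cast Nat.pos_of_ne_zero (NeZero.ne n)
  simp only [Matrix.trace_smul, Matrix.trace_one, Fintype.card_fin, smul_eq_mul] at this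
  exact le_of_mul_le_mul_right this hn

variable {A : Matrix (Fin n) (Fin n) ℝ} {B : Matrix (Fin n) (Fin m) ℝ}
  {P Q : Matrix (Fin n) (Fin n) ℝ} {R : Matrix (Fin m) (Fin m) ℝ} {K : Matrix (Fin m) (Fin n) ℝ}
  {μ ν : ℝ}

/-- The Bellman residual of `P`. -/
def bellmanResidual (A : Matrix (Fin n) (Fin n) ℝ) (B : Matrix (Fin n) (Fin m) ℝ)
    (Q : Matrix (Fin n) (Fin n) ℝ) (R : Matrix (Fin m) (Fin m) ℝ)
    (P : Matrix (Fin n) (Fin n) ℝ) : Matrix (Fin n) (Fin n) ℝ :=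
  P - (closedLoop A B (gain A B R P))ᵀ * P * closedLoop A B (gain A B R P) -
    stageCost Q R (gain A B R P)

/-- The completed square at the policy whose value is P. Its sign is policy improvement, its size
measures how far one improvement step moves the gain. -/
theorem IsPolicyValue.bellmanResidual_eq (h : IsPolicyValue A B Q R K P) (hμ : 0 < μ) (hP : 0 ≤ P)
    (hR : μ • 1 ≤ R) : bellmanResidual A B Q R P =
      (K - gain A B R P)ᵀ * (Bᵀ * P * B + R) * (K - gain A B R P) := by
  have h1 := bellman_eq_gain_add (A := A) (B := B) hμ hP hR Q K
  rw [← h.eq_add_stageCost] at h1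
  rw [bellmanResidual, sub_sub, sub_eq_iff_eq_add, add_comm _ (_ + _)]
  exact h1

theorem IsPolicyValue.bellmanResidual_nonneg (h : IsPolicyValue A B Q R K P) (hμ : 0 < μ)
    (hP : 0 ≤ P) (hR : μ • 1 ≤ R) : 0 ≤ bellmanResidual A B Q R P := by
  rw [h.bellmanResidual_eq hμ hP hR]
  exact conj_nonneg ((smul_nonneg_matrix hμ.le one_nonneg_matrix).trans
    (smul_one_le_conj_add hP hR)) _

theorem smul_one_le_stageCost (hμ : 0 < μ) (hQ : μ • 1 ≤ Q) (hR : μ • 1 ≤ R)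
    (K : Matrix (Fin m) (Fin n) ℝ) : μ • 1 ≤ stageCost Q R K :=
  hQ.trans (le_add_of_nonneg_right
    (conj_nonneg ((smul_nonneg_matrix hμ.le one_nonneg_matrix).trans hR) K))

theorem IsPolicyValue.smul_one_le [NeZero n] (h : IsPolicyValue A B Q R K P) (hμ : 0 < μ)
    (hQ : μ • 1 ≤ Q) (hR : μ • 1 ≤ R) (hK : IsStable A B K) : μ • 1 ≤ P := by
  have h1 := smul_one_le_stageCost hμ hQ hR K
  exact h1.trans (h.stageCost_le (isStable_iff_tendsto_pow.1 hK)
    ((smul_nonneg_matrix hμ.le one_nonneg_matrix).trans h1))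

theorem IsPolicyValue.isCert (h : IsPolicyValue A B Q R K P) (hμ : 0 < μ)
    (hQ : μ • 1 ≤ Q) (hR : μ • 1 ≤ R) (hP : μ • 1 ≤ P) (hP' : P ≤ ν • 1) :
    IsCert μ ν P (closedLoop A B K) := by
  refine ⟨hP, hP', ?_⟩
  have h1 := smul_one_le_stageCost hμ hQ hR K
  have h2 := h.eq_add_stageCost
  have h3 : (closedLoop A B K)ᵀ * P * closedLoop A B K = P - stageCost Q R K :=
    eq_sub_iff_add_eq.2 h2.symm
  rw [h3]
  exact sub_le_sub_left h1 P

/-- The residual is nonnegative, so under the improved gain P still drops by at least the stage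
cost, hence by μI. Stability thus passes from each policy to the next, with the same constants. -/
theorem IsPolicyValue.isCert_gain (h : IsPolicyValue A B Q R K P) (hμ : 0 < μ)
    (hQ : μ • 1 ≤ Q) (hR : μ • 1 ≤ R) (hP : μ • 1 ≤ P) (hP' : P ≤ ν • 1) :
    IsCert μ ν P (closedLoop A B (gain A B R P)) := by
  refine ⟨hP, hP', ?_⟩
  have h1 := smul_one_le_stageCost hμ hQ hR (gain A B R P)
  have h2 := h.bellmanResidual_nonneg hμ ((smul_nonneg_matrix hμ.le one_nonneg_matrix).trans hP) hR
  rw [bellmanResidual] at h2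
  have h3 := sub_nonneg.1 h2
  rw [← sub_nonneg] at h1 h3 ⊢
  convert add_nonneg h1 h3 using 1
  abel

theorem IsCert.isStable [NeZero n] (h : IsCert μ ν P (closedLoop A B K)) (hμ : 0 < μ) :
    IsStable A B K :=
  isStable_iff_tendsto_pow.2 (h.tendsto_pow hμ (le_of_smul_one_le_smul_one (h.lower.trans h.upper)))

theorem IsPolicyValue.isStable_gain [NeZero n] (h : IsPolicyValue A B Q R K P) (hμ : 0 < μ)
    (hQ : μ • 1 ≤ Q) (hR : μ • 1 ≤ R) (hP : μ • 1 ≤ P) : IsStable A B (gain A B R P) :=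
  -- Any upper bound on P will do here, and ‖P‖ always is one; this also covers the reset iterates,
  -- on which no uniform bound is imposed.
  (h.isCert_gain hμ hQ hR hP (ν := ‖P‖)
    (le_norm_smul_one (isSymm_of_ge (smul_one_isSymm μ) hP))).isStable hμ

theorem IsCert.norm_gain_le_kappa (h : IsCert μ ν P (closedLoop A B K)) (hμ : 0 < μ)
    {κ : ℝ} (hκ : 0 ≤ κ) (hκν : κ ^ 2 * μ = ν) (hQ : 0 ≤ Q) (hR : μ • 1 ≤ R)
    (h1 : stageCost Q R K ≤ P) : ‖K‖ ≤ κ := by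
  refine IsCert.norm_le_of_conj_le hμ hκ hR ?_
  rw [hκν]
  exact (le_add_of_nonneg_left hQ).trans (h1.trans h.upper)

/-- Policy iteration is monotone. -/
theorem IsPolicyValue.gain_le [NeZero n] {P' : Matrix (Fin n) (Fin n) ℝ}
    (h : IsPolicyValue A B Q R K P) (h' : IsPolicyValue A B Q R (gain A B R P) P') (hμ : 0 < μ)
    (hQ : μ • 1 ≤ Q) (hR : μ • 1 ≤ R) (hP : μ • 1 ≤ P) : P' ≤ P := by
  have hs := isStable_iff_tendsto_pow.1 (h.isStable_gain hμ hQ hR hP)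
  refine sub_nonneg.1 (nonneg_of_conj_le hs ?_)
  have h2 := h.bellmanResidual_nonneg hμ ((smul_nonneg_matrix hμ.le one_nonneg_matrix).trans hP) hR
  rw [bellmanResidual] at h2
  have h3 := h'.eq_add_stageCost
  rw [← sub_nonneg]
  convert h2 using 1
  nth_rw 1 [h3]
  simp only [Matrix.mul_sub, Matrix.sub_mul]
  abel

theorem kappa_sq_mul (hμ : 0 < μ) (hν : 0 ≤ ν) : kappa μ ν ^ 2 * μ = ν := by
  rw [kappa, Real.sq_sqrt (by positivity), div_mul_cancel₀ _ hμ.ne']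

theorem one_le_kappa (hμ : 0 < μ) (hμν : μ ≤ ν) : 1 ≤ kappa μ ν := by
  rw [kappa, Real.one_le_sqrt]
  exact (one_le_div hμ).2 hμν

theorem resetConst_eq (B : Matrix (Fin n) (Fin m) ℝ) (μ σ ν : ℝ) : resetConst B μ σ ν =
    2 * σ / ‖B‖ + 8 * kappa μ ν ^ 4 * σ * (1 + kappa μ ν ^ 2) := by
  rw [resetConst, gam]
  field_simp
  ring

/-- After inserting γ = 1/(2κ²), the number under the ceiling in t⋆ is exactly the left-hand side.
It is the threshold of `rate_step`. -/
theorem le_resetTime_sub_one {B : Matrix (Fin n) (Fin m) ℝ} (hB : B ≠ 0) {σ : ℝ}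
    (hμ : 0 < μ) (hμν : μ ≤ ν) :
    4 * kappa μ ν ^ 6 * ‖B‖ * (‖B‖ * resetConst B μ σ ν + 2 * σ) / μ + 1 ≤ resetTime B μ σ ν := by
  have hb : 0 < ‖B‖ := norm_pos_iff.2 hB
  have hκ : 0 < kappa μ ν := one_pos.trans_le (one_le_kappa hμ hμν)
  refine le_trans (le_of_eq ?_) (Nat.le_ceil _)
  rw [resetConst_eq, gam]
  field_simp
  ring

theorem two_le_resetTime {B : Matrix (Fin n) (Fin m) ℝ} (hB : B ≠ 0) {σ : ℝ} (hσ : 0 < σ)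
    (hμ : 0 < μ) (hμν : μ ≤ ν) : 2 ≤ resetTime B μ σ ν := by
  have hb : 0 < ‖B‖ := norm_pos_iff.2 hB
  have hκ : 0 < kappa μ ν := one_pos.trans_le (one_le_kappa hμ hμν)
  have h1 := le_resetTime_sub_one hB (σ := σ) hμ hμν
  have h2 : 0 < resetConst B μ σ ν := by rw [resetConst_eq]; positivity
  have h3 : (1 : ℝ) < resetTime B μ σ ν := lt_of_lt_of_le (lt_add_of_pos_left _ (by positivity)) h1
  exact_mod_cast h3

variable {Qs : ℕ → Matrix (Fin n) (Fin n) ℝ} {Rs : ℕ → Matrix (Fin m) (Fin m) ℝ} {σ : ℝ}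

theorem CostAssumption.runAvg_Q_bounds (h : CostAssumption Qs Rs μ σ) (hμ : 0 < μ) {t : ℕ}
    (ht : 1 ≤ t) : μ • 1 ≤ runAvg Qs t ∧ runAvg Qs t ≤ σ • 1 :=
  runAvg_mem_Icc (h.Q_bounds hμ) ht

theorem CostAssumption.runAvg_R_bounds (h : CostAssumption Qs Rs μ σ) (hμ : 0 < μ) {t : ℕ}
    (ht : 1 ≤ t) : μ • 1 ≤ runAvg Rs t ∧ runAvg Rs t ≤ σ • 1 :=
  runAvg_mem_Icc (h.R_bounds hμ) ht

namespace Run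

variable [NeZero n]

theorem Phat_stable (r : Run A B Qs Rs μ σ ν) (h : CostAssumption Qs Rs μ σ) (hμ : 0 < μ)
    (ht : 1 ≤ resetTime B μ σ ν) (hK : IsStable A B (r.K (resetTime B μ σ ν))) (ℓ : ℕ) :
    IsStable A B (r.Khat ℓ) ∧ μ • 1 ≤ r.Phat ℓ := by
  have hQ := (h.runAvg_Q_bounds hμ ht).1
  have hR := (h.runAvg_R_bounds hμ ht).1
  induction ℓ with
  | zero =>
    rw [← r.Khat_zero] at hK
    exact ⟨hK, (r.Phat_eq 0).smul_one_le hμ hQ hR hK⟩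
  | succ ℓ ih =>
    have h1 : IsStable A B (r.Khat (ℓ + 1)) := by
      rw [r.Khat_succ]
      exact (r.Phat_eq ℓ).isStable_gain hμ hQ hR ih.2
    exact ⟨h1, (r.Phat_eq (ℓ + 1)).smul_one_le hμ hQ hR h1⟩

/-- The reset loop terminates. -/
theorem exists_norm_Phat_sub_le (r : Run A B Qs Rs μ σ ν) (h : CostAssumption Qs Rs μ σ) (hμ : 0 < μ)
    (ht : 1 ≤ resetTime B μ σ ν) (hK : IsStable A B (r.K (resetTime B μ σ ν)))
    {ε : ℝ} (hε : 0 < ε) : ∃ ℓ, 1 ≤ ℓ ∧ ‖r.Phat ℓ - r.Phat (ℓ - 1)‖ ≤ ε := by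
  have hQ := (h.runAvg_Q_bounds hμ ht).1
  have hR := (h.runAvg_R_bounds hμ ht).1
  have hs := r.Phat_stable h hμ ht hK
  have hle : ∀ ℓ, r.Phat (ℓ + 1) ≤ r.Phat ℓ := fun ℓ => by
    have h1 := r.Phat_eq (ℓ + 1)
    rw [r.Khat_succ] at h1
    exact (r.Phat_eq ℓ).gain_le h1 hμ hQ hR (hs ℓ).2
  -- The traces decrease and are bounded below, so consecutive differences tend to 0; for a monotone
  -- sequence the trace of a difference dominates its norm.
  have hanti : Antitone fun ℓ => (r.Phat ℓ).trace := antitone_nat_of_succ_le fun ℓ =>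
    trace_mono (hle ℓ)
  have hlim := tendsto_atTop_ciInf hanti ⟨0, by
    rintro _ ⟨ℓ, rfl⟩
    exact trace_nonneg_of_nonneg ((smul_nonneg_matrix hμ.le one_nonneg_matrix).trans (hs ℓ).2)⟩
  have hdiff := hlim.sub ((tendsto_add_atTop_iff_nat 1).2 hlim)
  rw [sub_self] at hdiff
  obtain ⟨ℓ, hℓ⟩ := (hdiff.eventually (gt_mem_nhds hε)).exists
  refine ⟨ℓ + 1, by omega, ?_⟩
  rw [Nat.add_sub_cancel, norm_sub_rev]
  refine (norm_le_trace (sub_nonneg.2 (hle ℓ))).trans ?_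
  rw [Matrix.trace_sub]
  exact hℓ.le

/-- The matrix `P_t` is the value of a stable policy: of `K_t` unless `t = t⋆`, and of the last
policy of the reset loop if `t = t⋆`. -/
theorem exists_policy (r : Run A B Qs Rs μ σ ν) (h : CostAssumption Qs Rs μ σ) (hμ : 0 < μ)
    (hm : 0 < resetConst B μ σ ν) {t : ℕ} (ht : 1 ≤ t) (hK : IsStable A B (r.K t)) :
    ∃ K', IsStable A B K' ∧ IsPolicyValue A B (runAvg Qs t) (runAvg Rs t) K' (r.P t) ∧
      (t ≠ resetTime B μ σ ν → K' = r.K t) ∧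
      (t = resetTime B μ σ ν → ∃ P₀, μ • 1 ≤ P₀ ∧ K' = gain A B (runAvg Rs t) P₀ ∧
        ‖r.P t - P₀‖ ≤ resetConst B μ σ ν / t) := by
  by_cases hts : t = resetTime B μ σ ν
  · subst hts
    have hs := r.Phat_stable h hμ ht hK
    have hhalt := r.exists_norm_Phat_sub_le h hμ ht hK (ε := resetConst B μ σ ν / resetTime B μ σ ν)
      (div_pos hm (by exact_mod_cast ht))
    -- Termination is essential: the infimum of an empty set would be the default value 0, which
    -- violates ℓ ≥ 1.
    have hmem := Nat.sInf_mem (s := {ℓ : ℕ | 1 ≤ ℓ ∧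
      ‖r.Phat ℓ - r.Phat (ℓ - 1)‖ ≤ resetConst B μ σ ν / resetTime B μ σ ν}) hhalt
    set ℓ := sInf {ℓ : ℕ | 1 ≤ ℓ ∧
      ‖r.Phat ℓ - r.Phat (ℓ - 1)‖ ≤ resetConst B μ σ ν / resetTime B μ σ ν} with hℓ
    have hP := r.P_reset
    rw [← hℓ] at hP
    rw [hP]
    obtain ⟨h1, h2⟩ := hmem
    refine ⟨r.Khat ℓ, (hs ℓ).1, r.Phat_eq ℓ, fun hne => absurd rfl hne, fun _ =>
      ⟨r.Phat (ℓ - 1), (hs _).2, ?_, h2⟩⟩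
    rw [← r.Khat_succ, Nat.sub_add_cancel h1]
  · exact ⟨r.K t, hK, r.P_eq t ht hts, fun _ => rfl, fun h' => absurd h' hts⟩

theorem stable (r : Run A B Qs Rs μ σ ν) (h : CostAssumption Qs Rs μ σ) (hμ : 0 < μ)
    (hm : 0 < resetConst B μ σ ν) {t : ℕ} (ht : 1 ≤ t) : IsStable A B (r.K t) := by
  induction t, ht using Nat.le_induction with
  | base => exact r.K_one
  | succ t ht ih =>
    obtain ⟨K', hK', hv, -⟩ := r.exists_policy h hμ hm ht ih
    have hQ := (h.runAvg_Q_bounds hμ ht).1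
    have hR := (h.runAvg_R_bounds hμ ht).1
    rw [r.K_succ t ht]
    exact hv.isStable_gain hμ hQ hR (hv.smul_one_le hμ hQ hR hK')

theorem le_P (r : Run A B Qs Rs μ σ ν) (h : CostAssumption Qs Rs μ σ) (hμ : 0 < μ)
    (hm : 0 < resetConst B μ σ ν) {t : ℕ} (ht : 1 ≤ t) : μ • 1 ≤ r.P t := by
  obtain ⟨K', hK', hv, -⟩ := r.exists_policy h hμ hm ht (r.stable h hμ hm ht)
  exact hv.smul_one_le hμ (h.runAvg_Q_bounds hμ ht).1 (h.runAvg_R_bounds hμ ht).1 hK'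

theorem isCert (r : Run A B Qs Rs μ σ ν) (h : CostAssumption Qs Rs μ σ) (hμ : 0 < μ)
    (hm : 0 < resetConst B μ σ ν) {t : ℕ} (ht : 1 ≤ t) (hP : r.P t ≤ ν • 1) :
    IsCert μ ν (r.P t) (closedLoop A B (r.K (t + 1))) := by
  obtain ⟨K', hK', hv, -⟩ := r.exists_policy h hμ hm ht (r.stable h hμ hm ht)
  have hQ := (h.runAvg_Q_bounds hμ ht).1
  have hR := (h.runAvg_R_bounds hμ ht).1
  rw [r.K_succ t ht]
  exact hv.isCert_gain hμ hQ hR (hv.smul_one_le hμ hQ hR hK') hP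

theorem bellmanResidual_nonneg (r : Run A B Qs Rs μ σ ν) (h : CostAssumption Qs Rs μ σ)
    (hμ : 0 < μ) (hm : 0 < resetConst B μ σ ν) {t : ℕ} (ht : 1 ≤ t) :
    0 ≤ bellmanResidual A B (runAvg Qs t) (runAvg Rs t) (r.P t) := by
  obtain ⟨K', hK', hv, -⟩ := r.exists_policy h hμ hm ht (r.stable h hμ hm ht)
  exact hv.bellmanResidual_nonneg hμ ((smul_nonneg_matrix hμ.le one_nonneg_matrix).trans
    (r.le_P h hμ hm ht)) (h.runAvg_R_bounds hμ ht).1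

end Run

end RunBasic

/-! ### Runs with uniformly bounded `P_t`: rates of convergence -/

section BoundedRun

variable {n m : ℕ} {A : Matrix (Fin n) (Fin n) ℝ} {B : Matrix (Fin n) (Fin m) ℝ}
  {Qs : ℕ → Matrix (Fin n) (Fin n) ℝ} {Rs : ℕ → Matrix (Fin m) (Fin m) ℝ} {μ σ ν : ℝ}

theorem conj_sub_comm (S : Matrix (Fin m) (Fin m) ℝ) (x y : Matrix (Fin m) (Fin n) ℝ) :
    (x - y)ᵀ * S * (x - y) = (y - x)ᵀ * S * (y - x) := by
  simp only [Matrix.transpose_sub, Matrix.mul_sub, Matrix.sub_mul]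
  abel

/-- The standing assumptions on a run. -/
structure BoundedRun (r : Run A B Qs Rs μ σ ν) : Prop where
  B_ne : B ≠ 0
  mu_pos : 0 < μ
  mu_lt : μ < σ
  cost : CostAssumption Qs Rs μ σ
  P_le : ∀ t, 1 ≤ t → r.P t ≤ ν • 1

namespace BoundedRun

variable {r : Run A B Qs Rs μ σ ν}

theorem sigma_pos (hr : BoundedRun r) : 0 < σ := hr.mu_pos.trans hr.mu_lt

theorem norm_B_pos (hr : BoundedRun r) : 0 < ‖B‖ := norm_pos_iff.2 hr.B_ne

theorem resetConst_pos (hr : BoundedRun r) : 0 < resetConst B μ σ ν := by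
  have := hr.norm_B_pos
  have := hr.sigma_pos
  rw [resetConst_eq]
  have : 0 ≤ kappa μ ν := Real.sqrt_nonneg _
  positivity

theorem smul_one_le_P (hr : BoundedRun r) {t : ℕ} (ht : 1 ≤ t) : μ • 1 ≤ r.P t := by
  have := pos_of_ne_zero hr.B_ne
  exact r.le_P hr.cost hr.mu_pos hr.resetConst_pos ht

theorem P_nonneg (hr : BoundedRun r) {t : ℕ} (ht : 1 ≤ t) : 0 ≤ r.P t :=
  (smul_nonneg_matrix hr.mu_pos.le one_nonneg_matrix).trans (hr.smul_one_le_P ht)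

theorem mu_le_nu (hr : BoundedRun r) : μ ≤ ν := by
  have := pos_of_ne_zero hr.B_ne
  exact le_of_smul_one_le_smul_one ((hr.smul_one_le_P le_rfl).trans (hr.P_le 1 le_rfl))

theorem nu_pos (hr : BoundedRun r) : 0 < ν := hr.mu_pos.trans_le hr.mu_le_nu

theorem one_le_kappa (hr : BoundedRun r) : 1 ≤ kappa μ ν :=
  OnlineLQ.one_le_kappa hr.mu_pos hr.mu_le_nu

theorem kappa_pos (hr : BoundedRun r) : 0 < kappa μ ν := one_pos.trans_le hr.one_le_kappa

theorem kappa_sq_mul (hr : BoundedRun r) : kappa μ ν ^ 2 * μ = ν :=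
  OnlineLQ.kappa_sq_mul hr.mu_pos hr.nu_pos.le

theorem nu_div_mu (hr : BoundedRun r) : ν / μ = kappa μ ν ^ 2 :=
  (eq_div_of_mul_eq hr.mu_pos.ne' hr.kappa_sq_mul).symm

theorem two_le_resetTime (hr : BoundedRun r) : 2 ≤ resetTime B μ σ ν :=
  OnlineLQ.two_le_resetTime hr.B_ne hr.sigma_pos hr.mu_pos hr.mu_le_nu

theorem norm_P_le (hr : BoundedRun r) {t : ℕ} (ht : 1 ≤ t) : ‖r.P t‖ ≤ ν :=
  norm_le_of_nonneg_of_le hr.nu_pos.le (hr.P_nonneg ht) (hr.P_le t ht)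

theorem isStable (hr : BoundedRun r) {t : ℕ} (ht : 1 ≤ t) : IsStable A B (r.K t) := by
  have := pos_of_ne_zero hr.B_ne
  exact r.stable hr.cost hr.mu_pos hr.resetConst_pos ht

theorem isCert (hr : BoundedRun r) {t : ℕ} (ht : 1 ≤ t) :
    IsCert μ ν (r.P t) (closedLoop A B (r.K (t + 1))) := by
  have := pos_of_ne_zero hr.B_ne
  exact r.isCert hr.cost hr.mu_pos hr.resetConst_pos ht (hr.P_le t ht)

theorem runAvg_Q (hr : BoundedRun r) {t : ℕ} (ht : 1 ≤ t) : μ • 1 ≤ runAvg Qs t :=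
  (hr.cost.runAvg_Q_bounds hr.mu_pos ht).1

theorem runAvg_R (hr : BoundedRun r) {t : ℕ} (ht : 1 ≤ t) : μ • 1 ≤ runAvg Rs t :=
  (hr.cost.runAvg_R_bounds hr.mu_pos ht).1

theorem smul_one_nonneg (hr : BoundedRun r) {d : ℕ} : (0 : Matrix (Fin d) (Fin d) ℝ) ≤ μ • 1 :=
  smul_nonneg_matrix hr.mu_pos.le one_nonneg_matrix

theorem Q_nonneg (hr : BoundedRun r) (t : ℕ) (ht : 1 ≤ t) : 0 ≤ Qs t ∧ Qs t ≤ σ • 1 :=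
  ⟨hr.smul_one_nonneg.trans (hr.cost.Q_bounds hr.mu_pos t ht).1,
    (hr.cost.Q_bounds hr.mu_pos t ht).2⟩

theorem R_nonneg (hr : BoundedRun r) (t : ℕ) (ht : 1 ≤ t) : 0 ≤ Rs t ∧ Rs t ≤ σ • 1 :=
  ⟨hr.smul_one_nonneg.trans (hr.cost.R_bounds hr.mu_pos t ht).1,
    (hr.cost.R_bounds hr.mu_pos t ht).2⟩

theorem bellmanResidual_nonneg (hr : BoundedRun r) {t : ℕ} (ht : 1 ≤ t) :
    0 ≤ bellmanResidual A B (runAvg Qs t) (runAvg Rs t) (r.P t) := by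
  have := pos_of_ne_zero hr.B_ne
  exact r.bellmanResidual_nonneg hr.cost hr.mu_pos hr.resetConst_pos ht

/-- K_1 is not the gain of an earlier matrix, so its bounds must come from its own value. As t⋆ ≥ 2,
P_1 is this value. -/
theorem isPolicyValue_one (hr : BoundedRun r) :
    IsPolicyValue A B (runAvg Qs 1) (runAvg Rs 1) (r.K 1) (r.P 1) :=
  r.P_eq 1 le_rfl (by have := hr.two_le_resetTime; omega)

theorem norm_closedLoop_le (hr : BoundedRun r) {t : ℕ} (ht : 1 ≤ t) :
    ‖closedLoop A B (r.K t)‖ ≤ kappa μ ν := by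
  obtain rfl | ⟨s, hs, rfl⟩ : t = 1 ∨ ∃ s, 1 ≤ s ∧ t = s + 1 := by
    rcases ht.eq_or_lt with h | h
    · exact Or.inl h.symm
    · exact Or.inr ⟨t - 1, by omega, by omega⟩
  · exact (hr.isPolicyValue_one.isCert hr.mu_pos (hr.runAvg_Q le_rfl) (hr.runAvg_R le_rfl)
      (hr.smul_one_le_P le_rfl) (hr.P_le 1 le_rfl)).norm_le hr.mu_pos hr.kappa_pos.le
      hr.kappa_sq_mul
  · exact (hr.isCert hs).norm_le hr.mu_pos hr.kappa_pos.le hr.kappa_sq_mul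

theorem stageCost_le (hr : BoundedRun r) {t : ℕ} (ht : 1 ≤ t) :
    stageCost (runAvg Qs t) (runAvg Rs t) (r.K (t + 1)) ≤ r.P t := by
  have h1 := hr.bellmanResidual_nonneg ht
  rw [bellmanResidual, ← r.K_succ t ht] at h1
  exact (sub_nonneg.1 h1).trans (sub_le_self _ (conj_nonneg (hr.P_nonneg ht) _))

theorem norm_K_le (hr : BoundedRun r) {t : ℕ} (ht : 1 ≤ t) : ‖r.K t‖ ≤ kappa μ ν := by
  have := pos_of_ne_zero hr.B_ne
  obtain rfl | ⟨s, hs, rfl⟩ : t = 1 ∨ ∃ s, 1 ≤ s ∧ t = s + 1 := by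
    rcases ht.eq_or_lt with h | h
    · exact Or.inl h.symm
    · exact Or.inr ⟨t - 1, by omega, by omega⟩
  · refine (hr.isPolicyValue_one.isCert hr.mu_pos (hr.runAvg_Q le_rfl) (hr.runAvg_R le_rfl)
      (hr.smul_one_le_P le_rfl) (hr.P_le 1 le_rfl)).norm_gain_le_kappa hr.mu_pos hr.kappa_pos.le
      hr.kappa_sq_mul (hr.smul_one_nonneg.trans (hr.runAvg_Q le_rfl)) (hr.runAvg_R le_rfl)
      (hr.isPolicyValue_one.stageCost_le (isStable_iff_tendsto_pow.1 (hr.isStable le_rfl)) ?_)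
    exact hr.smul_one_nonneg.trans
      (smul_one_le_stageCost hr.mu_pos (hr.runAvg_Q le_rfl) (hr.runAvg_R le_rfl) _)
  · exact (hr.isCert hs).norm_gain_le_kappa hr.mu_pos hr.kappa_pos.le hr.kappa_sq_mul
      (hr.smul_one_nonneg.trans (hr.runAvg_Q hs)) (hr.runAvg_R hs) (hr.stageCost_le hs)

theorem norm_mul_mul_le (hr : BoundedRun r) (X : Matrix (Fin n) (Fin n) ℝ)
    {F : Matrix (Fin n) (Fin n) ℝ} {x : ℝ} (hX : ‖X‖ ≤ x) (hF : ‖F‖ ≤ kappa μ ν) :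
    ‖Bᵀ * X * F‖ ≤ ‖B‖ * x * kappa μ ν := by
  have := hr.kappa_pos
  have hx : 0 ≤ x := (norm_nonneg _).trans hX
  calc ‖Bᵀ * X * F‖ ≤ ‖Bᵀ * X‖ * ‖F‖ := Matrix.l2_opNorm_mul _ _
    _ ≤ (‖Bᵀ‖ * ‖X‖) * ‖F‖ := by gcongr; exact Matrix.l2_opNorm_mul _ _
    _ ≤ ‖B‖ * x * kappa μ ν := by rw [norm_transpose]; gcongr

/-- The factor ‖B‖, absent from `norm_K_le`, makes late gain steps proportional to ‖B‖ and
`regretCoeff` proportional to ‖B‖². -/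
theorem norm_K_succ_le (hr : BoundedRun r) {t : ℕ} (ht : 1 ≤ t) :
    ‖r.K (t + 1)‖ ≤ ‖B‖ * kappa μ ν ^ 3 := by
  have h1 := mul_gain_eq_closedLoop (A := A) (B := B) hr.mu_pos (hr.P_nonneg ht) (hr.runAvg_R ht)
  rw [← r.K_succ t ht] at h1
  refine (norm_le_of_mul_eq hr.mu_pos (hr.runAvg_R ht) h1).trans ?_
  rw [div_le_iff₀ hr.mu_pos]
  refine (hr.norm_mul_mul_le _ (hr.norm_P_le ht) (hr.norm_closedLoop_le (by omega))).trans_eq ?_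
  nth_rw 1 [← hr.kappa_sq_mul]
  ring

theorem exists_gain_step (hr : BoundedRun r) {t : ℕ} (ht : 1 ≤ t) :
    ∃ G, (Bᵀ * r.P (t + 1) * B + runAvg Rs (t + 1)) * (r.K (t + 2) - r.K (t + 1)) = G ∧
      ‖G‖ ≤ ‖B‖ * ‖r.P (t + 1) - r.P t‖ * kappa μ ν + σ / (t + 1) * ‖r.K (t + 1)‖ := by
  have h1 := mul_gain_sub_gain (A := A) (B := B) hr.mu_pos (hr.P_nonneg (t := t + 1) (by omega))
    (hr.runAvg_R (t := t + 1) (by omega)) (hr.P_nonneg ht) (hr.runAvg_R ht)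
  rw [← r.K_succ t ht, ← r.K_succ (t + 1) (by omega)] at h1
  refine ⟨_, h1, (norm_sub_le _ _).trans (add_le_add ?_ ?_)⟩
  · exact hr.norm_mul_mul_le _ le_rfl (hr.norm_closedLoop_le (by omega))
  · refine (Matrix.l2_opNorm_mul _ _).trans ?_
    gcongr
    exact norm_runAvg_succ_sub_le hr.sigma_pos.le hr.R_nonneg ht

theorem norm_K_sub_le (hr : BoundedRun r) {t : ℕ} (ht : 1 ≤ t) :
    ‖r.K (t + 2) - r.K (t + 1)‖ ≤
      (‖B‖ * ‖r.P (t + 1) - r.P t‖ * kappa μ ν + σ / (t + 1) * ‖r.K (t + 1)‖) / μ := by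
  obtain ⟨G, hG, hG'⟩ := hr.exists_gain_step ht
  have h2 := norm_le_of_mul_eq hr.mu_pos (smul_one_le_conj_add (B := B)
    (hr.P_nonneg (t := t + 1) (by omega)) (hr.runAvg_R (t := t + 1) (by omega))) hG
  exact h2.trans (div_le_div_of_nonneg_right hG' hr.mu_pos.le)

/-- Off the reset, P_{t+1} is the value of K_{t+1}, so its residual is quadratic in K_{t+2} -
K_{t+1}. -/
theorem residual_le (hr : BoundedRun r) {t : ℕ} (ht : 1 ≤ t) (hts : t + 1 ≠ resetTime B μ σ ν) :
    bellmanResidual A B (runAvg Qs (t + 1)) (runAvg Rs (t + 1)) (r.P (t + 1)) ≤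
      ((‖B‖ * ‖r.P (t + 1) - r.P t‖ * kappa μ ν + σ / (t + 1) * ‖r.K (t + 1)‖) ^ 2 / μ) • 1 := by
  obtain ⟨G, hG, hG'⟩ := hr.exists_gain_step ht
  have hP := hr.P_nonneg (t := t + 1) (by omega)
  have hR := hr.runAvg_R (t := t + 1) (by omega)
  rw [(r.P_eq (t + 1) (by omega) hts).bellmanResidual_eq hr.mu_pos hP hR, ← r.K_succ _ (by omega)]
  rw [conj_sub_comm]
  refine (conj_le_sq_of_mul_eq hr.mu_pos (smul_one_le_conj_add hP hR) hG).trans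
    (smul_le_smul_right_matrix ?_ one_nonneg_matrix)
  have := hr.mu_pos
  gcongr

/-- At the reset, P_t is the value of the gain of the preceding iterate, formed with the same R̄_t.
Only the difference of the last two iterates contributes, and the stopping rule controls it. -/
theorem residual_reset_le (hr : BoundedRun r) {t : ℕ} (hts : t = resetTime B μ σ ν) :
    bellmanResidual A B (runAvg Qs t) (runAvg Rs t) (r.P t) ≤
      ((‖B‖ * (resetConst B μ σ ν / t) * kappa μ ν) ^ 2 / μ) • 1 := by
  have := pos_of_ne_zero hr.B_ne
  have ht : 1 ≤ t := by have := hr.two_le_resetTime; omega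
  have hP := hr.P_nonneg ht
  have hR := hr.runAvg_R ht
  obtain ⟨K', hK', hv, -, h2⟩ :=
    r.exists_policy hr.cost hr.mu_pos hr.resetConst_pos ht (hr.isStable ht)
  obtain ⟨P₀, hP₀, rfl, hd⟩ := h2 hts
  rw [hv.bellmanResidual_eq hr.mu_pos hP hR]
  have hF : ‖closedLoop A B (gain A B (runAvg Rs t) P₀)‖ ≤ kappa μ ν :=
    (hv.isCert hr.mu_pos (hr.runAvg_Q ht) hR (hr.smul_one_le_P ht) (hr.P_le t ht)).norm_le
      hr.mu_pos hr.kappa_pos.le hr.kappa_sq_mul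
  have h1 := mul_gain_sub_gain (A := A) (B := B) hr.mu_pos hP hR
    (hr.smul_one_nonneg.trans hP₀) hR
  rw [sub_self, Matrix.zero_mul, sub_zero] at h1
  rw [conj_sub_comm]
  refine (conj_le_sq_of_mul_eq hr.mu_pos (smul_one_le_conj_add hP hR) h1).trans
    (smul_le_smul_right_matrix ?_ one_nonneg_matrix)
  have := hr.mu_pos
  gcongr
  exact hr.norm_mul_mul_le _ hd hF

/-- Under the same closed loop, P_{t+1} solves its evaluation equation exactly and P_t solves the
previous one up to its residual. The difference solves a Lyapunov equation, and the certificate P_t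
bounds its solution. -/
theorem norm_P_succ_sub_le (hr : BoundedRun r) {t : ℕ} (ht : 1 ≤ t)
    (hts : t + 1 ≠ resetTime B μ σ ν) {e : ℝ} (he : 0 ≤ e)
    (hE : bellmanResidual A B (runAvg Qs t) (runAvg Rs t) (r.P t) ≤ e • 1) :
    ‖r.P (t + 1) - r.P t‖ ≤
      kappa μ ν ^ 2 * (σ * (1 + kappa μ ν ^ 2) / (t + 1) + e) := by
  have hE0 := hr.bellmanResidual_nonneg ht
  have hv := (r.P_eq (t + 1) (by omega) hts).eq_add_stageCost
  have hσ := hr.sigma_pos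
  set E := bellmanResidual A B (runAvg Qs t) (runAvg Rs t) (r.P t) with hEdef
  set K := r.K (t + 1) with hK
  set F := closedLoop A B K with hF
  have hE1 : r.P t = Fᵀ * r.P t * F + stageCost (runAvg Qs t) (runAvg Rs t) K + E := by
    rw [hEdef, bellmanResidual, ← r.K_succ t ht]; abel
  have hX : r.P (t + 1) - r.P t = Fᵀ * (r.P (t + 1) - r.P t) * F +
      (stageCost (runAvg Qs (t + 1) - runAvg Qs t) (runAvg Rs (t + 1) - runAvg Rs t) K - E) := by
    rw [stageCost_sub]
    nth_rw 1 [hv, hE1]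
    simp only [Matrix.mul_sub, Matrix.sub_mul]
    abel
  have hQd := runAvg_succ_sub_le hr.Q_nonneg ht
  have hRd := runAvg_succ_sub_le hr.R_nonneg ht
  have hK2 : ‖K‖ ^ 2 ≤ kappa μ ν ^ 2 := by
    gcongr; exact hr.norm_K_le (by omega)
  have hs0 : (0 : ℝ) ≤ σ / (t + 1) := by positivity
  have hS : (σ / (t + 1)) • stageCost 1 1 K ≤
      (σ * (1 + kappa μ ν ^ 2) / (t + 1)) • (1 : Matrix (Fin n) (Fin n) ℝ) := by
    refine (smul_le_smul_matrix hs0 (stageCost_one_le K)).trans ?_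
    rw [smul_smul]
    refine smul_le_smul_right_matrix ?_ one_nonneg_matrix
    rw [mul_comm σ, mul_div_assoc, mul_comm]
    gcongr
  have u1 := (stageCost_mono hQd.2 hRd.2 K).trans_eq (stageCost_smul_one _ K)
  have u2 : -((σ / ((t : ℝ) + 1)) • stageCost 1 1 K) ≤
      stageCost (runAvg Qs (t + 1) - runAvg Qs t) (runAvg Rs (t + 1) - runAvg Rs t) K := by
    refine le_trans (le_of_eq ?_) (stageCost_mono hQd.1 hRd.1 K)
    rw [← neg_smul, ← neg_smul, ← neg_smul, stageCost_smul_one]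
  have h := (hr.isCert ht).norm_lyapunov_le hr.mu_pos hr.mu_le_nu hX
    (y := σ * (1 + kappa μ ν ^ 2) / (t + 1) + e) (by positivity) ?_ ?_
  · rwa [hr.nu_div_mu] at h
  · rw [add_smul, neg_add, ← sub_eq_add_neg]
    exact sub_le_sub ((neg_le_neg hS).trans u2) hE
  · rw [add_smul]
    exact (sub_le_self _ hE0).trans ((u1.trans hS).trans
      (le_add_of_nonneg_right (smul_nonneg_matrix he one_nonneg_matrix)))

end BoundedRun

end BoundedRun

/-! ### Rates 1/t for the increments and 1/t² for the residuals. -/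

section Rates

variable {n m : ℕ} {A : Matrix (Fin n) (Fin n) ℝ} {B : Matrix (Fin n) (Fin m) ℝ}
  {Qs : ℕ → Matrix (Fin n) (Fin n) ℝ} {Rs : ℕ → Matrix (Fin m) (Fin m) ℝ} {μ σ ν : ℝ}

/-- Closes the induction on increments. The threshold on t cancels one of the two factors L, using
(t-1)(t+1) ≤ t²; the quadratic part is then at most L/(4b) = c/4 + σ/(2b), and c is large enough to
leave room for the source. -/
theorem rate_step {κ b c t σ μ L : ℝ} (hκ : 1 ≤ κ) (hb : 0 < b) (hσ : 0 < σ) (hμ : 0 < μ)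
    (hc : c = 2 * σ / b + 8 * κ ^ 4 * σ * (1 + κ ^ 2)) (hL : L = b * c + 2 * σ)
    (ht : 4 * κ ^ 6 * b * L / μ + 1 ≤ t) :
    κ ^ 2 * (σ * (1 + κ ^ 2) / (t + 1) + κ ^ 2 * L ^ 2 / (μ * t ^ 2)) ≤ c / (t + 1) := by
  have hκ0 : 0 < κ := by linarith
  have hc0 : 0 < c := by rw [hc]; positivity
  have hL0 : 0 < L := by rw [hL]; positivity
  have ht0 : 0 < t := lt_of_lt_of_le (by positivity) ht
  rw [le_div_iff₀ (by positivity)]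
  have h1 : κ ^ 2 * (σ * (1 + κ ^ 2) / (t + 1) + κ ^ 2 * L ^ 2 / (μ * t ^ 2)) * (t + 1) =
      κ ^ 2 * σ * (1 + κ ^ 2) +
        (4 * κ ^ 6 * b * L / μ) * ((t + 1) / t ^ 2) * (L / (4 * κ ^ 2 * b)) := by
    field_simp
  have h2 : (4 * κ ^ 6 * b * L / μ) * ((t + 1) / t ^ 2) ≤ 1 := by
    calc _ ≤ (t - 1) * ((t + 1) / t ^ 2) := by gcongr; linarith
      _ ≤ 1 := by
        rw [← mul_div_assoc, div_le_one (by positivity)]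
        nlinarith
  have h3 : L / (4 * κ ^ 2 * b) ≤ L / (4 * b) := by
    gcongr
    nlinarith [one_le_pow₀ hκ (n := 2)]
  have h4 : L / (4 * b) = c / 4 + σ / (2 * b) := by rw [hL]; field_simp; ring
  have h5 : c / 4 = σ / (2 * b) + 2 * κ ^ 4 * σ * (1 + κ ^ 2) := by
    rw [hc]; field_simp; ring
  have h6 : κ ^ 2 * σ * (1 + κ ^ 2) ≤ κ ^ 4 * σ * (1 + κ ^ 2) := by
    gcongr
    norm_num
  have h7 : 0 < κ ^ 4 * σ * (1 + κ ^ 2) := by positivity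
  have h8 : (4 * κ ^ 6 * b * L / μ) * ((t + 1) / t ^ 2) * (L / (4 * κ ^ 2 * b)) ≤
      1 * (L / (4 * b)) := by gcongr
  rw [h1]
  linarith

/-- For late t the quadratic part is at most σ after multiplication by t+1, so the bound forgets L
and with it the reset accuracy. -/
theorem rate_tail {κ t σ μ L : ℝ} (hκ : 1 ≤ κ) (hσ : 0 < σ) (hμ : 0 < μ)
    (ht1 : 1 ≤ t) (ht : 2 * κ ^ 4 * L ^ 2 / (μ * σ) ≤ t) :
    κ ^ 2 * (σ * (1 + κ ^ 2) / (t + 1) + κ ^ 2 * L ^ 2 / (μ * t ^ 2)) ≤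
      4 * κ ^ 4 * σ / (t + 1) := by
  have hκ0 : 0 < κ := by linarith
  have ht0 : 0 < t := by linarith
  have hk2 : 1 ≤ κ ^ 2 := one_le_pow₀ hκ
  rw [le_div_iff₀ (by positivity)]
  have h1 : κ ^ 2 * (σ * (1 + κ ^ 2) / (t + 1) + κ ^ 2 * L ^ 2 / (μ * t ^ 2)) * (t + 1) =
      κ ^ 2 * σ * (1 + κ ^ 2) + (2 * κ ^ 4 * L ^ 2 / (μ * σ)) * σ * ((t + 1) / (2 * t ^ 2)) := by
    field_simp
  have h2 : (2 * κ ^ 4 * L ^ 2 / (μ * σ)) * σ * ((t + 1) / (2 * t ^ 2)) ≤ σ := by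
    calc _ ≤ t * σ * ((t + 1) / (2 * t ^ 2)) := by gcongr
      _ ≤ σ := by
        rw [← mul_div_assoc, div_le_iff₀ (by positivity)]
        nlinarith [mul_pos hσ ht0]
  rw [h1]
  have h3 : κ ^ 2 * σ ≤ κ ^ 4 * σ := by
    gcongr
    norm_num
  have h4 : σ ≤ κ ^ 2 * σ := by nlinarith
  nlinarith

/-- The time from which the asymptotic rates hold. -/
def tailStart (B : Matrix (Fin n) (Fin m) ℝ) (μ σ ν : ℝ) : ℕ :=
  resetTime B μ σ ν + 2 +
    ⌈2 * kappa μ ν ^ 4 * (‖B‖ * resetConst B μ σ ν + 2 * σ) ^ 2 / (μ * σ)⌉₊ +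
    ⌈16 * kappa μ ν ^ 6 * σ / μ⌉₊

namespace BoundedRun

variable {r : Run A B Qs Rs μ σ ν}

/-- The increment bound is demanded only off the reset, so the same statement serves the start of
the induction, where the stopping rule replaces it, and every later step. -/
theorem residual_le_of_rate (hr : BoundedRun r) {t : ℕ} (ht : resetTime B μ σ ν ≤ t)
    (hd : t ≠ resetTime B μ σ ν → ‖r.P t - r.P (t - 1)‖ ≤ resetConst B μ σ ν / t) :
    bellmanResidual A B (runAvg Qs t) (runAvg Rs t) (r.P t) ≤
      (kappa μ ν ^ 2 * (‖B‖ * resetConst B μ σ ν + 2 * σ) ^ 2 / (μ * t ^ 2)) • 1 := by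
  have hκ := hr.kappa_pos
  have hb := hr.norm_B_pos
  have hσ := hr.sigma_pos
  have hμ := hr.mu_pos
  have hm := hr.resetConst_pos
  have ht2 : 2 ≤ t := hr.two_le_resetTime.trans ht
  have ht0 : (0 : ℝ) < t := by exact_mod_cast (by omega : 0 < t)
  have e : kappa μ ν ^ 2 * (‖B‖ * resetConst B μ σ ν + 2 * σ) ^ 2 / (μ * t ^ 2) =
      (‖B‖ * (resetConst B μ σ ν / t) * kappa μ ν + 2 * σ / t * kappa μ ν) ^ 2 / μ := by
    field_simp
  rw [e]
  by_cases hts : t = resetTime B μ σ ν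
  · refine (hr.residual_reset_le hts).trans (smul_le_smul_right_matrix ?_ one_nonneg_matrix)
    gcongr
    exact le_add_of_nonneg_right (by positivity)
  · have hd := hd hts
    obtain ⟨s, hs, rfl⟩ : ∃ s, 1 ≤ s ∧ t = s + 1 := ⟨t - 1, by omega, by omega⟩
    refine (hr.residual_le hs hts).trans (smul_le_smul_right_matrix ?_ one_nonneg_matrix)
    rw [Nat.add_sub_cancel] at hd
    push_cast at hd ⊢
    gcongr
    · linarith
    · exact hr.norm_K_le (by omega)

theorem norm_P_succ_sub_le_of_resetTime_le (hr : BoundedRun r) {t : ℕ}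
    (ht : resetTime B μ σ ν ≤ t) :
    ‖r.P (t + 1) - r.P t‖ ≤ resetConst B μ σ ν / (t + 1) := by
  have hμ := hr.mu_pos
  have h2 := hr.two_le_resetTime
  -- One induction step, whose hypothesis on the previous increment is vacuous at t⋆.
  have key : ∀ t, resetTime B μ σ ν ≤ t →
      (t ≠ resetTime B μ σ ν → ‖r.P t - r.P (t - 1)‖ ≤ resetConst B μ σ ν / t) →
      ‖r.P (t + 1) - r.P t‖ ≤ resetConst B μ σ ν / (t + 1) := by
    intro t ht hd
    refine (hr.norm_P_succ_sub_le (by omega) (by omega) (by positivity)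
      (hr.residual_le_of_rate ht hd)).trans ?_
    refine rate_step hr.one_le_kappa hr.norm_B_pos hr.sigma_pos hμ (resetConst_eq B μ σ ν) rfl ?_
    exact (le_resetTime_sub_one hr.B_ne hμ hr.mu_le_nu).trans (by exact_mod_cast ht)
  induction t, ht using Nat.le_induction with
  | base => exact key _ le_rfl fun h => absurd rfl h
  | succ t ht ih =>
    refine key _ (by omega) fun _ => ?_
    push_cast
    exact ih

theorem residual_le_tail (hr : BoundedRun r) {t : ℕ} (ht : resetTime B μ σ ν ≤ t) :
    bellmanResidual A B (runAvg Qs t) (runAvg Rs t) (r.P t) ≤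
      (kappa μ ν ^ 2 * (‖B‖ * resetConst B μ σ ν + 2 * σ) ^ 2 / (μ * t ^ 2)) • 1 := by
  refine hr.residual_le_of_rate ht fun hts => ?_
  obtain ⟨s, hs, rfl⟩ : ∃ s, resetTime B μ σ ν ≤ s ∧ t = s + 1 := ⟨t - 1, by omega, by omega⟩
  push_cast
  exact hr.norm_P_succ_sub_le_of_resetTime_le hs

theorem tailStart_bounds (hr : BoundedRun r) {t : ℕ} (ht : tailStart B μ σ ν ≤ t + 1) :
    resetTime B μ σ ν + 1 ≤ t ∧
    2 * kappa μ ν ^ 4 * (‖B‖ * resetConst B μ σ ν + 2 * σ) ^ 2 / (μ * σ) ≤ t ∧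
    16 * kappa μ ν ^ 6 * σ / μ ≤ t := by
  have h2 := hr.two_le_resetTime
  unfold tailStart at ht
  refine ⟨by omega, (Nat.le_ceil _).trans ?_, (Nat.le_ceil _).trans ?_⟩ <;>
  · norm_cast; omega

theorem norm_P_succ_sub_le_tail (hr : BoundedRun r) {t : ℕ} (ht : tailStart B μ σ ν ≤ t + 1) :
    ‖r.P (t + 1) - r.P t‖ ≤ 4 * kappa μ ν ^ 4 * σ / (t + 1) := by
  have h2 := hr.two_le_resetTime
  have hμ := hr.mu_pos
  obtain ⟨h1, h3, -⟩ := hr.tailStart_bounds ht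
  refine (hr.norm_P_succ_sub_le (by omega) (by omega) (by positivity)
    (hr.residual_le_tail (by omega))).trans ?_
  exact rate_tail hr.one_le_kappa hr.sigma_pos hμ (by exact_mod_cast (by omega : 1 ≤ t)) h3

/-- An increment of at most μ/(4κ²) inflates the certificate by a factor of at most 1 + 1/(4κ²),
which the contraction 1 - 1/κ² can afford. -/
theorem rate_le_tail (hr : BoundedRun r) {t : ℕ} (ht : tailStart B μ σ ν ≤ t + 1) :
    4 * kappa μ ν ^ 4 * σ / (t + 1) ≤ μ / (4 * kappa μ ν ^ 2) := by
  obtain ⟨-, -, h⟩ := hr.tailStart_bounds ht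
  have hκ := hr.kappa_pos
  have hμ := hr.mu_pos
  have hσ := hr.sigma_pos
  rw [div_le_iff₀ hμ] at h
  rw [div_le_div_iff₀ (by positivity) (by positivity)]
  nlinarith

theorem gain_step_le_tail (hr : BoundedRun r) {t : ℕ} (ht : tailStart B μ σ ν ≤ t + 1) :
    ‖B‖ * ‖r.P (t + 1) - r.P t‖ * kappa μ ν + σ / (t + 1) * ‖r.K (t + 1)‖ ≤
      5 * ‖B‖ * kappa μ ν ^ 5 * σ / (t + 1) := by
  obtain ⟨h1, -, -⟩ := hr.tailStart_bounds ht
  have h2 := hr.two_le_resetTime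
  have hκ := hr.kappa_pos
  have hσ := hr.sigma_pos
  have h3 := hr.norm_P_succ_sub_le_tail ht
  have h4 := hr.norm_K_succ_le (t := t) (by omega)
  calc _ ≤ ‖B‖ * (4 * kappa μ ν ^ 4 * σ / (t + 1)) * kappa μ ν +
        σ / (t + 1) * (‖B‖ * kappa μ ν ^ 3) := by gcongr
    _ ≤ ‖B‖ * (4 * kappa μ ν ^ 4 * σ / (t + 1)) * kappa μ ν +
        σ / (t + 1) * (‖B‖ * kappa μ ν ^ 5) := by
      gcongr
      · exact hr.one_le_kappa
      · norm_num
    _ = _ := by field_simp; ring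

theorem norm_closedLoop_sub_le_tail (hr : BoundedRun r) {t : ℕ}
    (ht : tailStart B μ σ ν ≤ t + 1) :
    ‖closedLoop A B (r.K (t + 2)) - closedLoop A B (r.K (t + 1))‖ ≤
      5 * ‖B‖ ^ 2 * kappa μ ν ^ 5 * σ / μ / (t + 1) := by
  obtain ⟨h1, -, -⟩ := hr.tailStart_bounds ht
  have h2 := hr.two_le_resetTime
  have hμ := hr.mu_pos
  have e : closedLoop A B (r.K (t + 2)) - closedLoop A B (r.K (t + 1)) =
      -(B * (r.K (t + 2) - r.K (t + 1))) := by
    simp only [closedLoop, Matrix.mul_sub]; abel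
  rw [e, norm_neg]
  refine (Matrix.l2_opNorm_mul _ _).trans ?_
  calc _ ≤ ‖B‖ * (5 * ‖B‖ * kappa μ ν ^ 5 * σ / (t + 1) / μ) := by
        gcongr
        refine (hr.norm_K_sub_le (by omega)).trans ?_
        gcongr
        exact hr.gain_step_le_tail ht
    _ = _ := by field_simp

theorem residual_succ_le_tail (hr : BoundedRun r) {t : ℕ} (ht : tailStart B μ σ ν ≤ t + 1) :
    bellmanResidual A B (runAvg Qs (t + 1)) (runAvg Rs (t + 1)) (r.P (t + 1)) ≤
      (25 * ‖B‖ ^ 2 * kappa μ ν ^ 10 * σ ^ 2 / μ / (t + 1) ^ 2) • 1 := by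
  obtain ⟨h1, -, -⟩ := hr.tailStart_bounds ht
  have h2 := hr.two_le_resetTime
  have hμ := hr.mu_pos
  have hσ := hr.sigma_pos
  have hκ := hr.kappa_pos
  refine (hr.residual_le (by omega) (by omega)).trans
    (smul_le_smul_right_matrix ?_ one_nonneg_matrix)
  calc _ ≤ (5 * ‖B‖ * kappa μ ν ^ 5 * σ / (t + 1)) ^ 2 / μ := by
        gcongr
        exact hr.gain_step_le_tail ht
    _ = _ := by field_simp; ring

end BoundedRun

end Rates

/-! ### Second moments along slowly varying policies -/

section ScalarRecursions

theorem sum_le_of_contraction {q : ℝ} (hq1 : q < 1) {a c : ℕ → ℝ} (ha : ∀ k, 0 ≤ a k)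
    (h : ∀ k, a (k + 1) ≤ q * a k + c k) (N : ℕ) :
    ∑ k ∈ Finset.range N, a k ≤ (a 0 + ∑ k ∈ Finset.range N, c k) / (1 - q) := by
  rw [le_div_iff₀ (by linarith)]
  have key : (1 - q) * ∑ k ∈ Finset.range N, a k + a N ≤ a 0 + ∑ k ∈ Finset.range N, c k := by
    induction N with
    | zero => simp
    | succ N ih =>
      rw [Finset.sum_range_succ, Finset.sum_range_succ]
      have := h N
      linarith
  have := ha N
  linarith

theorem le_of_contraction {q c : ℝ} (hq0 : 0 ≤ q) (hq1 : q < 1) (hc : 0 ≤ c) {a : ℕ → ℝ}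
    (h : ∀ k, a (k + 1) ≤ q * a k + c) (k : ℕ) : a k ≤ q ^ k * a 0 + c / (1 - q) := by
  have h1 : 0 < 1 - q := by linarith
  induction k with
  | zero => simp only [pow_zero, one_mul]; exact le_add_of_nonneg_right (by positivity)
  | succ k ih =>
    calc a (k + 1) ≤ q * a k + c := h k
      _ ≤ q * (q ^ k * a 0 + c / (1 - q)) + c := by gcongr
      _ = q ^ (k + 1) * a 0 + c / (1 - q) := by field_simp; ring

theorem sum_pow_le {q : ℝ} (hq0 : 0 ≤ q) (hq1 : q < 1) (N : ℕ) :
    ∑ k ∈ Finset.range N, q ^ k ≤ 1 / (1 - q) := by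
  have := (summable_geometric_of_lt_one hq0 hq1).sum_le_tsum (Finset.range N)
    (fun k _ => pow_nonneg hq0 k)
  rwa [tsum_geometric_of_lt_one hq0 hq1, ← one_div] at this


/-- Telescopes 1/s ≤ log s - log (s-1); T₀ ≥ 2 makes the discarded log (T₀ - 1) nonnegative. -/
theorem sum_inv_le_log {T₀ : ℕ} (hT : 2 ≤ T₀) (N : ℕ) :
    ∑ k ∈ Finset.range N, 1 / ((T₀ : ℝ) + k) ≤ Real.log ((T₀ + N : ℕ) : ℝ) := by
  have hT' : (2 : ℝ) ≤ T₀ := by exact_mod_cast hT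
  have key : ∑ k ∈ Finset.range N, 1 / ((T₀ : ℝ) + k) ≤
      Real.log ((T₀ : ℝ) + N - 1) - Real.log ((T₀ : ℝ) - 1) := by
    induction N with
    | zero => simp
    | succ N ih =>
      rw [Finset.sum_range_succ]
      have hN : (0 : ℝ) ≤ N := N.cast_nonneg
      have h1 := Real.log_le_sub_one_of_pos
        (x := ((T₀ : ℝ) + N - 1) / (T₀ + N)) (div_pos (by linarith) (by linarith))
      rw [Real.log_div (by linarith) (by linarith)] at h1
      have h2 : ((T₀ : ℝ) + N - 1) / (T₀ + N) - 1 = -(1 / (T₀ + N)) := by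
        field_simp; ring
      push_cast
      rw [show (T₀ : ℝ) + (N + 1) - 1 = T₀ + N by ring]
      linarith
  have h1 : Real.log ((T₀ : ℝ) + N - 1) ≤ Real.log ((T₀ + N : ℕ) : ℝ) := by
    push_cast
    have hN : (0 : ℝ) ≤ N := N.cast_nonneg
    exact Real.log_le_log (by linarith) (by linarith)
  have h2 : 0 ≤ Real.log ((T₀ : ℝ) - 1) := Real.log_nonneg (by linarith)
  linarith

theorem sum_inv_sq_le {T₀ : ℕ} (hT : 2 ≤ T₀) (N : ℕ) :
    ∑ k ∈ Finset.range N, (1 / ((T₀ : ℝ) + k)) ^ 2 ≤ 1 := by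
  have hT' : (2 : ℝ) ≤ T₀ := by exact_mod_cast hT
  have key : ∑ k ∈ Finset.range N, (1 / ((T₀ : ℝ) + k)) ^ 2 ≤
      1 / ((T₀ : ℝ) - 1) - 1 / ((T₀ : ℝ) + N - 1) := by
    induction N with
    | zero => simp
    | succ N ih =>
      rw [Finset.sum_range_succ]
      have hN : (0 : ℝ) ≤ N := N.cast_nonneg
      have a1 : (0 : ℝ) < T₀ + N - 1 := by linarith
      have a2 : (0 : ℝ) < T₀ + N := by linarith
      have h1 : (1 / ((T₀ : ℝ) + N)) ^ 2 ≤ 1 / ((T₀ : ℝ) + N - 1) - 1 / (T₀ + N) := by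
        rw [div_sub_div _ _ a1.ne' a2.ne', div_pow, one_pow,
          div_le_div_iff₀ (by positivity) (by positivity)]
        nlinarith
      push_cast
      rw [show (T₀ : ℝ) + (N + 1) - 1 = T₀ + N by ring]
      linarith
  have hN : (0 : ℝ) ≤ N := N.cast_nonneg
  have h1 : 0 ≤ 1 / ((T₀ : ℝ) + N - 1) := by
    apply div_nonneg <;> linarith
  have h2 : 1 / ((T₀ : ℝ) - 1) ≤ 1 := by
    rw [div_le_one (by linarith)]; linarith
  linarith

end ScalarRecursions

/-! ### Contraction of second moments and their increments. -/

section SecondMoments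

variable {n m : ℕ}

/-- Two-sided bound on the effect of a perturbation of `F` on `F X Fᵀ`. -/
theorem conj_sub_conj_bounds {X F G : Matrix (Fin n) (Fin n) ℝ} (hX : 0 ≤ X) {κ d : ℝ}
    (hκ : 0 < κ) (hd : 0 < d) (hF : ‖F‖ ≤ κ) (hG : ‖G - F‖ ≤ d) :
    ∃ N : Matrix (Fin n) (Fin n) ℝ, 0 ≤ N ∧ -N ≤ G * X * Gᵀ - F * X * Fᵀ ∧
      G * X * Gᵀ - F * X * Fᵀ ≤ N ∧ N.trace ≤ (2 * κ * d + d ^ 2) * X.trace := by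
  set D := G - F with hD
  have hGD : G = F + D := by rw [hD]; abel
  -- Young's inequality from (εF ± D) X (εF ± D)ᵀ ⪰ 0. The choice ε = d/κ balances εκ² and d²/ε,
  -- which together give 2κd.
  set ε := d / κ with hε
  have hε0 : 0 < ε := by positivity
  have a1 := conj_nonneg' hX F
  have a2 := conj_nonneg' hX D
  have a3 := smul_nonneg_matrix (inv_nonneg.2 hε0.le) (conj_nonneg' hX (ε • F - D))
  have a4 := smul_nonneg_matrix (inv_nonneg.2 hε0.le) (conj_nonneg' hX (ε • F + D))
  refine ⟨ε • (F * X * Fᵀ) + (1 + ε⁻¹) • (D * X * Dᵀ), ?_, ?_, ?_, ?_⟩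
  · exact add_nonneg (smul_nonneg_matrix hε0.le a1) (smul_nonneg_matrix (by positivity) a2)
  · rw [← sub_nonneg]
    convert add_nonneg a4 (add_nonneg a2 a2) using 1
    rw [hGD]
    simp only [Matrix.transpose_add, Matrix.transpose_smul, Matrix.add_mul, Matrix.mul_add,
      Matrix.smul_mul, Matrix.mul_smul]
    match_scalars <;> field_simp <;> ring
  · rw [← sub_nonneg]
    convert a3 using 1
    rw [hGD]
    simp only [Matrix.transpose_add, Matrix.transpose_sub, Matrix.transpose_smul, Matrix.add_mul,
      Matrix.mul_add, Matrix.sub_mul, Matrix.mul_sub, Matrix.smul_mul, Matrix.mul_smul]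
    match_scalars <;> field_simp <;> ring
  · have hx := trace_nonneg_of_nonneg hX
    rw [Matrix.trace_add, Matrix.trace_smul, Matrix.trace_smul, smul_eq_mul, smul_eq_mul]
    calc _ ≤ ε * (κ ^ 2 * X.trace) + (1 + ε⁻¹) * (d ^ 2 * X.trace) := by
          gcongr
          · exact (trace_conj_le hX F).trans (by gcongr)
          · exact (trace_conj_le hX D).trans (by gcongr)
      _ = _ := by rw [hε]; field_simp; ring

/-- Duality: tr(FᵀPFX) = tr(P FXFᵀ), and FXFᵀ is the next second moment without its noise. The cost
becomes the stationary value tr(PW) plus corrections from the motion of X and from the residual E.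
-/
theorem trace_stageCost_mul {P F C E X X' W : Matrix (Fin n) (Fin n) ℝ}
    (hP : P = Fᵀ * P * F + C + E) (hX : X' = F * X * Fᵀ + W) :
    (C * X).trace = (P * W).trace - (P * (X' - X)).trace - (E * X).trace := by
  have h1 : C = P - Fᵀ * P * F - E := by nth_rw 1 [hP]; abel
  rw [h1, hX]
  simp only [Matrix.sub_mul, Matrix.mul_sub, Matrix.mul_add, Matrix.trace_sub, Matrix.trace_add,
    trace_conj_mul]
  ring

/-- A slowly varying closed loop with certificates, after a burn-in of `T₀` steps; the index `k`
stands for the time `T₀ + k`. -/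
structure SlowSystem (μ ν κ δ β θ : ℝ) (T₀ : ℕ) (P F E X : ℕ → Matrix (Fin n) (Fin n) ℝ)
    (W : Matrix (Fin n) (Fin n) ℝ) : Prop where
  mu_pos : 0 < μ
  one_le_kappa : 1 ≤ κ
  kappa_sq_mul : κ ^ 2 * μ = ν
  two_le : 2 ≤ T₀
  delta_nonneg : 0 ≤ δ
  beta_pos : 0 < β
  theta_nonneg : 0 ≤ θ
  W_nonneg : 0 ≤ W
  X_nonneg : ∀ k, 0 ≤ X k
  cert : ∀ k, IsCert μ ν (P k) (F k)
  P_diff : ∀ k, ‖P (k + 1) - P k‖ ≤ δ / ((T₀ : ℝ) + k + 1)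
  delta_le : δ / ((T₀ : ℝ) + 1) ≤ μ / (4 * κ ^ 2)
  F_diff : ∀ k, ‖F (k + 1) - F k‖ ≤ β / ((T₀ : ℝ) + k + 1)
  E_nonneg : ∀ k, 0 ≤ E k
  E_le : ∀ k, E k ≤ (θ / ((T₀ : ℝ) + k) ^ 2) • 1
  X_succ : ∀ k, X (k + 1) = F k * X k * (F k)ᵀ + W

namespace SlowSystem

variable {μ ν κ δ β θ : ℝ} {T₀ : ℕ} {P F E X : ℕ → Matrix (Fin n) (Fin n) ℝ}
  {W : Matrix (Fin n) (Fin n) ℝ}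

theorem kappa_pos (s : SlowSystem μ ν κ δ β θ T₀ P F E X W) : 0 < κ :=
  one_pos.trans_le s.one_le_kappa

theorem nu_pos (s : SlowSystem μ ν κ δ β θ T₀ P F E X W) : 0 < ν := by
  rw [← s.kappa_sq_mul]
  have := s.kappa_pos
  have := s.mu_pos
  positivity

theorem mu_div_nu (s : SlowSystem μ ν κ δ β θ T₀ P F E X W) : μ / ν = 1 / κ ^ 2 := by
  have := s.kappa_pos
  have := s.mu_pos
  rw [← s.kappa_sq_mul]; field_simp

theorem P_nonneg (s : SlowSystem μ ν κ δ β θ T₀ P F E X W) (k : ℕ) : 0 ≤ P k :=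
  (s.cert k).nonneg s.mu_pos

theorem P_symm (s : SlowSystem μ ν κ δ β θ T₀ P F E X W) (k : ℕ) : (P k)ᵀ = P k :=
  isSymm_of_nonneg (s.P_nonneg k)

theorem rate_bounds (s : SlowSystem μ ν κ δ β θ T₀ P F E X W) :
    0 ≤ 1 - 3 / (4 * κ ^ 2) ∧ 1 - 3 / (4 * κ ^ 2) < 1 := by
  have h1 : 1 ≤ κ ^ 2 := one_le_pow₀ s.one_le_kappa
  have h2 : 0 < 3 / (4 * κ ^ 2) := by positivity
  refine ⟨?_, by linarith⟩
  rw [sub_nonneg, div_le_one (by positivity)]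
  linarith

theorem P_succ_le (s : SlowSystem μ ν κ δ β θ T₀ P F E X W) (k : ℕ) :
    P (k + 1) ≤ (1 + 1 / (4 * κ ^ 2)) • P k := by
  have hκ := s.kappa_pos
  have hμ := s.mu_pos
  have hT : (0 : ℝ) < T₀ := by exact_mod_cast (two_pos.trans_le s.two_le)
  have h1 : ‖P (k + 1) - P k‖ ≤ μ / (4 * κ ^ 2) := by
    refine (s.P_diff k).trans (le_trans ?_ s.delta_le)
    have hk : (0 : ℝ) ≤ k := k.cast_nonneg
    have := s.delta_nonneg
    gcongr
    linarith
  have h2 := le_smul_one_of_norm_le (by simp [s.P_symm]) h1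
  have h3 := smul_le_smul_matrix (c := 1 / (4 * κ ^ 2)) (by positivity) (s.cert k).lower
  rw [smul_smul, one_div_mul_eq_div] at h3
  rw [add_smul, one_smul]
  exact sub_le_iff_le_add'.1 (h2.trans h3)

/-- tr(P_k Z) is the Lyapunov function. Drift of the certificate and contraction combine to (1 +
1/(4κ²))(1 - 1/κ²) ≤ 1 - 3/(4κ²); the factor 5/4 bounds the drift since κ ≥ 1. -/
theorem trace_step (s : SlowSystem μ ν κ δ β θ T₀ P F E X W) (k : ℕ)
    {Z N : Matrix (Fin n) (Fin n) ℝ} (hZ : 0 ≤ Z) (hN : 0 ≤ N) :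
    (P (k + 1) * (F k * Z * (F k)ᵀ + N)).trace ≤
      (1 - 3 / (4 * κ ^ 2)) * (P k * Z).trace + 5 / 4 * ν * N.trace := by
  have hκ := s.kappa_pos
  have h1κ : 1 ≤ κ ^ 2 := one_le_pow₀ s.one_le_kappa
  have hν := s.nu_pos
  have hFZ := conj_nonneg' hZ (F k)
  have h1 := trace_mul_mono (s.P_succ_le k) (add_nonneg hFZ hN)
  rw [Matrix.smul_mul, Matrix.trace_smul, smul_eq_mul, Matrix.mul_add (P k), Matrix.trace_add] at h1
  have h2 := (s.cert k).trace_mul_conj_le s.mu_pos s.nu_pos hZ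
  have h3 := trace_mul_le_of_le_smul_one (s.cert k).upper hN
  have h4 := trace_mul_nonneg (s.P_nonneg k) hZ
  have h5 := trace_nonneg_of_nonneg hN
  rw [s.mu_div_nu] at h2
  refine h1.trans ?_
  have e1 : (1 + 1 / (4 * κ ^ 2)) * (1 - 1 / κ ^ 2) ≤ 1 - 3 / (4 * κ ^ 2) := by
    have : (1 + 1 / (4 * κ ^ 2)) * (1 - 1 / κ ^ 2) =
        1 - 3 / (4 * κ ^ 2) - 1 / (4 * κ ^ 4) := by field_simp; ring
    rw [this]
    exact sub_le_self _ (by positivity)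
  have e2 : 1 + 1 / (4 * κ ^ 2) ≤ 5 / 4 := by
    have : 1 / (4 * κ ^ 2) ≤ 1 / 4 := by gcongr; linarith
    linarith
  calc _ ≤ (1 + 1 / (4 * κ ^ 2)) * ((1 - 1 / κ ^ 2) * (P k * Z).trace + ν * N.trace) := by gcongr
    _ = (1 + 1 / (4 * κ ^ 2)) * (1 - 1 / κ ^ 2) * (P k * Z).trace +
        (1 + 1 / (4 * κ ^ 2)) * (ν * N.trace) := by ring
    _ ≤ (1 - 3 / (4 * κ ^ 2)) * (P k * Z).trace + 5 / 4 * (ν * N.trace) := by gcongr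
    _ = _ := by ring

theorem trace_le_of_trace_mul (s : SlowSystem μ ν κ δ β θ T₀ P F E X W) (k : ℕ)
    {Z : Matrix (Fin n) (Fin n) ℝ} (hZ : 0 ≤ Z) : Z.trace ≤ (P k * Z).trace / μ := by
  rw [le_div_iff₀ s.mu_pos, mul_comm]
  exact le_trace_mul_of_smul_one_le (s.cert k).lower hZ

/-- The transient is kept as a separate geometric term: its sum is bounded, so only the stationary
part 2κ⁴ tr W will multiply the logarithm. -/
theorem trace_X_le (s : SlowSystem μ ν κ δ β θ T₀ P F E X W) (k : ℕ) :
    (X k).trace ≤ 2 * κ ^ 4 * W.trace + κ ^ 2 * (X 0).trace * (1 - 3 / (4 * κ ^ 2)) ^ k := by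
  have hκ := s.kappa_pos
  have hμ := s.mu_pos
  have hν := s.nu_pos
  obtain ⟨hq0, hq1⟩ := s.rate_bounds
  have hω := trace_nonneg_of_nonneg s.W_nonneg
  have h1 := le_of_contraction hq0 hq1 (c := 5 / 4 * ν * W.trace) (by positivity)
    (a := fun k => (P k * X k).trace) (fun k => by
      simp only [s.X_succ k]
      exact s.trace_step k (s.X_nonneg k) s.W_nonneg) k
  refine (s.trace_le_of_trace_mul k (s.X_nonneg k)).trans ?_
  rw [div_le_iff₀ hμ]
  refine h1.trans ?_
  have h2 := trace_mul_le_of_le_smul_one (s.cert 0).upper (s.X_nonneg 0)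
  have h3 : 5 / 4 * ν * W.trace / (1 - (1 - 3 / (4 * κ ^ 2))) = 5 / 3 * κ ^ 4 * W.trace * μ := by
    rw [← s.kappa_sq_mul]; field_simp; ring
  calc _ ≤ (1 - 3 / (4 * κ ^ 2)) ^ k * (ν * (X 0).trace) + 5 / 3 * κ ^ 4 * W.trace * μ := by
        rw [h3]; gcongr
    _ ≤ (1 - 3 / (4 * κ ^ 2)) ^ k * (ν * (X 0).trace) + 2 * κ ^ 4 * W.trace * μ := by
        gcongr; norm_num
    _ = _ := by rw [← s.kappa_sq_mul]; ring

theorem norm_F_le (s : SlowSystem μ ν κ δ β θ T₀ P F E X W) (k : ℕ) : ‖F k‖ ≤ κ :=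
  (s.cert k).norm_le s.mu_pos s.kappa_pos.le s.kappa_sq_mul

/-- The increments of the second moments are dominated by matrices whose traces contract up to a
summable perturbation plus a perturbation of order `1 / t`. -/
theorem exists_dominating (s : SlowSystem μ ν κ δ β θ T₀ P F E X W) :
    ∃ Z : ℕ → Matrix (Fin n) (Fin n) ℝ,
      (∀ k, 0 ≤ Z k ∧ -Z k ≤ X (k + 1) - X k ∧ X (k + 1) - X k ≤ Z k) ∧
      Z 0 = X 0 + X 1 ∧
      ∀ k, (P (k + 1) * Z (k + 1)).trace ≤ (1 - 3 / (4 * κ ^ 2)) * (P k * Z k).trace +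
        5 / 4 * ν * ((2 * κ * (β / ((T₀ : ℝ) + k + 1)) + (β / ((T₀ : ℝ) + k + 1)) ^ 2) *
          (X (k + 1)).trace) := by
  have hν := s.nu_pos
  have hN : ∀ k, ∃ N : Matrix (Fin n) (Fin n) ℝ, 0 ≤ N ∧
      -N ≤ F (k + 1) * X (k + 1) * (F (k + 1))ᵀ - F k * X (k + 1) * (F k)ᵀ ∧
      F (k + 1) * X (k + 1) * (F (k + 1))ᵀ - F k * X (k + 1) * (F k)ᵀ ≤ N ∧
      N.trace ≤ (2 * κ * (β / ((T₀ : ℝ) + k + 1)) + (β / ((T₀ : ℝ) + k + 1)) ^ 2) *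
        (X (k + 1)).trace := fun k =>
    conj_sub_conj_bounds (s.X_nonneg (k + 1)) s.kappa_pos
      (div_pos s.beta_pos (by positivity)) (s.norm_F_le k) (s.F_diff k)
  choose N hN0 hN1 hN2 hN3 using hN
  -- X_{k+2} - X_{k+1} is the F_k-conjugate of the previous increment plus the effect on X_{k+1} of
  -- replacing F_k by F_{k+1}, which N_k dominates. The increments are indefinite; Z follows the
  -- same recursion while staying positive semidefinite.
  let Z : ℕ → Matrix (Fin n) (Fin n) ℝ := fun k =>
    Nat.rec (X 0 + X 1) (fun k Zk => F k * Zk * (F k)ᵀ + N k) k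
  have hZs : ∀ k, Z (k + 1) = F k * Z k * (F k)ᵀ + N k := fun k => rfl
  have hZ : ∀ k, 0 ≤ Z k ∧ -Z k ≤ X (k + 1) - X k ∧ X (k + 1) - X k ≤ Z k := by
    intro k
    induction k with
    | zero =>
      have h0 := s.X_nonneg 0
      have h1 := s.X_nonneg 1
      refine ⟨add_nonneg h0 h1, ?_, ?_⟩
      · rw [← sub_nonneg]
        convert add_nonneg h1 h1 using 1
        change X 1 - X 0 - -(X 0 + X 1) = _
        abel
      · rw [← sub_nonneg]
        convert add_nonneg h0 h0 using 1
        change X 0 + X 1 - (X 1 - X 0) = _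
        abel
    | succ k ih =>
      obtain ⟨i0, i1, i2⟩ := ih
      have e : X (k + 1 + 1) - X (k + 1) = F k * (X (k + 1) - X k) * (F k)ᵀ +
          (F (k + 1) * X (k + 1) * (F (k + 1))ᵀ - F k * X (k + 1) * (F k)ᵀ) := by
        have hx : W = X (k + 1) - F k * X k * (F k)ᵀ := by rw [s.X_succ k]; abel
        rw [s.X_succ (k + 1), Matrix.mul_sub, Matrix.sub_mul, hx]
        abel
      rw [hZs, e]
      refine ⟨add_nonneg (conj_nonneg' i0 _) (hN0 k), ?_, add_le_add (conj_mono' i2 _) (hN2 k)⟩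
      rw [neg_add]
      refine add_le_add ?_ (hN1 k)
      have := conj_mono' i1 (F k)
      simpa using this
  refine ⟨Z, hZ, rfl, fun k => ?_⟩
  rw [hZs]
  refine (s.trace_step k (hZ k).1 (hN0 k)).trans ?_
  gcongr
  exact hN3 k

/-- Coefficient of the logarithm in `abs_sum_le`. -/
def slowCoeff (μ ν κ δ β θ ω : ℝ) : ℝ :=
  (ν + δ) / μ * (4 * κ ^ 2 / 3 * (5 / 4 * ν * (2 * κ * β * (2 * κ ^ 4 * ω)))) +
    θ * (2 * κ ^ 4 * ω)

/-- Constant term in `abs_sum_le`, as a function of the trace `x` of the first two second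
moments. -/
def slowConst (μ ν κ δ β θ ω x : ℝ) : ℝ :=
  (ν + δ) / μ * (4 * κ ^ 2 / 3 * (ν * x + 5 / 4 * ν * (β ^ 2 * (2 * κ ^ 4 * ω) +
    (2 * κ * β + β ^ 2) * (κ ^ 2 * x) * (4 * κ ^ 2 / 3)))) + θ * (κ ^ 2 * x) * (4 * κ ^ 2 / 3)

theorem sum_pow_rate_le (s : SlowSystem μ ν κ δ β θ T₀ P F E X W) (N : ℕ) :
    ∑ k ∈ Finset.range N, (1 - 3 / (4 * κ ^ 2)) ^ k ≤ 4 * κ ^ 2 / 3 := by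
  have hκ := s.kappa_pos
  obtain ⟨hq0, hq1⟩ := s.rate_bounds
  refine (sum_pow_le hq0 hq1 N).trans_eq ?_
  field_simp; ring

/-- Summing the contraction, the sources split into a 1/t part that produces the logarithm and 1/t²
and geometric parts that stay bounded. -/
theorem sum_dominating_le (s : SlowSystem μ ν κ δ β θ T₀ P F E X W) {x : ℝ}
    (hx : (X 0).trace + (X 1).trace ≤ x) {Z : ℕ → Matrix (Fin n) (Fin n) ℝ}
    (hZ0 : Z 0 = X 0 + X 1) (hZ : ∀ k, 0 ≤ Z k)
    (hZs : ∀ k, (P (k + 1) * Z (k + 1)).trace ≤ (1 - 3 / (4 * κ ^ 2)) * (P k * Z k).trace +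
        5 / 4 * ν * ((2 * κ * (β / ((T₀ : ℝ) + k + 1)) + (β / ((T₀ : ℝ) + k + 1)) ^ 2) *
          (X (k + 1)).trace)) (N : ℕ) :
    ∑ k ∈ Finset.range N, (P k * Z k).trace ≤ 4 * κ ^ 2 / 3 * (ν * x + 5 / 4 * ν *
      (2 * κ * β * (2 * κ ^ 4 * W.trace) * Real.log ((T₀ + N : ℕ) : ℝ) +
        (β ^ 2 * (2 * κ ^ 4 * W.trace) +
          (2 * κ * β + β ^ 2) * (κ ^ 2 * x) * (4 * κ ^ 2 / 3)))) := by
  have hκ := s.kappa_pos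
  have hν := s.nu_pos
  have hβ := s.beta_pos
  obtain ⟨hq0, hq1⟩ := s.rate_bounds
  have hω := trace_nonneg_of_nonneg s.W_nonneg
  have hx0 := trace_nonneg_of_nonneg (s.X_nonneg 0)
  have hx1 := trace_nonneg_of_nonneg (s.X_nonneg 1)
  have hxn : 0 ≤ x := by linarith
  have hT : (2 : ℝ) ≤ T₀ := by exact_mod_cast s.two_le
  set Ξ := 2 * κ ^ 4 * W.trace with hΞ
  have hΞ0 : 0 ≤ Ξ := by positivity
  set q := 1 - 3 / (4 * κ ^ 2) with hq
  have h1 := sum_le_of_contraction hq1 (fun k => trace_mul_nonneg (s.P_nonneg k) (hZ k)) hZs N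
  have h2 : ∀ k ∈ Finset.range N,
      5 / 4 * ν * ((2 * κ * (β / ((T₀ : ℝ) + k + 1)) + (β / ((T₀ : ℝ) + k + 1)) ^ 2) *
        (X (k + 1)).trace) ≤ 5 / 4 * ν * (2 * κ * β * Ξ * (1 / ((T₀ : ℝ) + k)) +
          (β ^ 2 * Ξ * (1 / ((T₀ : ℝ) + k)) ^ 2 + (2 * κ * β + β ^ 2) * (κ ^ 2 * x) * q ^ k)) := by
    intro k _
    have hk : (0 : ℝ) ≤ k := k.cast_nonneg
    have hX : (X (k + 1)).trace ≤ Ξ + κ ^ 2 * x * q ^ k := by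
      refine (s.trace_X_le (k + 1)).trans ?_
      have : q ^ (k + 1) ≤ q ^ k := pow_le_pow_of_le_one hq0 hq1.le (Nat.le_succ k)
      gcongr
      linarith
    have hτ : β / ((T₀ : ℝ) + k + 1) ≤ β * (1 / ((T₀ : ℝ) + k)) := by
      rw [mul_one_div]
      exact div_le_div_of_nonneg_left hβ.le (by linarith) (by linarith)
    have hτ1 : 1 / ((T₀ : ℝ) + k) ≤ 1 := by
      rw [div_le_one (by linarith)]; linarith
    set τ := 1 / ((T₀ : ℝ) + k) with hτd
    have hτ0 : 0 ≤ τ := by rw [hτd]; exact div_nonneg zero_le_one (by linarith)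
    have hqk : 0 ≤ q ^ k := pow_nonneg hq0 k
    have hτ2 : τ ^ 2 ≤ 1 := pow_le_one₀ hτ0 hτ1
    gcongr 5 / 4 * ν * ?_
    calc _ ≤ (2 * κ * (β * τ) + (β * τ) ^ 2) * (Ξ + κ ^ 2 * x * q ^ k) := by
          gcongr
          exact trace_nonneg_of_nonneg (s.X_nonneg _)
      _ = 2 * κ * β * Ξ * τ + (β ^ 2 * Ξ * τ ^ 2 +
          (2 * κ * β * τ + β ^ 2 * τ ^ 2) * (κ ^ 2 * x) * q ^ k) := by ring
      _ ≤ 2 * κ * β * Ξ * τ + (β ^ 2 * Ξ * τ ^ 2 +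
          (2 * κ * β * 1 + β ^ 2 * 1) * (κ ^ 2 * x) * q ^ k) := by gcongr
      _ = _ := by ring
  have h3 := Finset.sum_le_sum h2
  rw [← Finset.mul_sum] at h1
  rw [← Finset.mul_sum, ← Finset.mul_sum, Finset.sum_add_distrib, Finset.sum_add_distrib,
    ← Finset.mul_sum, ← Finset.mul_sum, ← Finset.mul_sum] at h3
  have h4 : (P 0 * Z 0).trace ≤ ν * x := by
    refine (trace_mul_le_of_le_smul_one (s.cert 0).upper (hZ 0)).trans ?_
    rw [hZ0, Matrix.trace_add]
    gcongr
  have e : 1 / (1 - q) = 4 * κ ^ 2 / 3 := by rw [hq]; field_simp; ring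
  rw [div_eq_mul_one_div, e, mul_comm] at h1
  refine h1.trans ?_
  gcongr
  refine (le_of_mul_le_mul_left h3 (by positivity)).trans ?_
  refine add_le_add ?_ (add_le_add ?_ ?_)
  · gcongr
    exact sum_inv_le_log s.two_le N
  · exact mul_le_of_le_one_right (by positivity) (sum_inv_sq_le s.two_le N)
  · gcongr
    exact s.sum_pow_rate_le N

theorem sum_residual_le (s : SlowSystem μ ν κ δ β θ T₀ P F E X W) {x : ℝ}
    (hx : (X 0).trace + (X 1).trace ≤ x) (N : ℕ) :
    ∑ k ∈ Finset.range N, ((T₀ : ℝ) + k) * (E k * X k).trace ≤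
      θ * (2 * κ ^ 4 * W.trace) * Real.log ((T₀ + N : ℕ) : ℝ) +
        θ * (κ ^ 2 * x) * (4 * κ ^ 2 / 3) := by
  have hκ := s.kappa_pos
  have hθ := s.theta_nonneg
  obtain ⟨hq0, hq1⟩ := s.rate_bounds
  have hω := trace_nonneg_of_nonneg s.W_nonneg
  have hx0 := trace_nonneg_of_nonneg (s.X_nonneg 0)
  have hx1 := trace_nonneg_of_nonneg (s.X_nonneg 1)
  have hxn : 0 ≤ x := by linarith
  have hT : (2 : ℝ) ≤ T₀ := by exact_mod_cast s.two_le
  set q := 1 - 3 / (4 * κ ^ 2) with hq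
  have h2 : ∀ k ∈ Finset.range N, ((T₀ : ℝ) + k) * (E k * X k).trace ≤
      θ * (2 * κ ^ 4 * W.trace) * (1 / ((T₀ : ℝ) + k)) + θ * (κ ^ 2 * x) * q ^ k := by
    intro k _
    have hk : (0 : ℝ) ≤ k := k.cast_nonneg
    have hpos : 0 < (T₀ : ℝ) + k := by linarith
    have hqk : 0 ≤ q ^ k := pow_nonneg hq0 k
    have hX : (X k).trace ≤ 2 * κ ^ 4 * W.trace + κ ^ 2 * x * q ^ k := by
      refine (s.trace_X_le k).trans ?_
      gcongr
      linarith
    have hE := trace_mul_le_of_le_smul_one (s.E_le k) (s.X_nonneg k)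
    have hτ1 : 1 / ((T₀ : ℝ) + k) ≤ 1 := by
      rw [div_le_one hpos]; linarith
    calc _ ≤ ((T₀ : ℝ) + k) * (θ / ((T₀ : ℝ) + k) ^ 2 *
          (2 * κ ^ 4 * W.trace + κ ^ 2 * x * q ^ k)) := by
          gcongr
          exact hE.trans (by gcongr)
      _ = θ * (2 * κ ^ 4 * W.trace) * (1 / ((T₀ : ℝ) + k)) +
          θ * (κ ^ 2 * x) * q ^ k * (1 / ((T₀ : ℝ) + k)) := by field_simp
      _ ≤ θ * (2 * κ ^ 4 * W.trace) * (1 / ((T₀ : ℝ) + k)) +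
          θ * (κ ^ 2 * x) * q ^ k * 1 := by gcongr
      _ = _ := by ring
  refine (Finset.sum_le_sum h2).trans ?_
  rw [Finset.sum_add_distrib, ← Finset.mul_sum, ← Finset.mul_sum]
  gcongr
  · exact sum_inv_le_log s.two_le N
  · exact s.sum_pow_rate_le N

/-- The costs along the system differ from a telescoping sum by `O(log T)`. -/
theorem abs_sum_le (s : SlowSystem μ ν κ δ β θ T₀ P F E X W) {x : ℝ}
    (hx : (X 0).trace + (X 1).trace ≤ x) (N : ℕ) :
    |∑ k ∈ Finset.range N, (((T₀ : ℝ) + k) * (E k * X k).trace -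
      ((P k + ((T₀ : ℝ) + k + 1) • (P (k + 1) - P k)) * (X (k + 1) - X k)).trace)| ≤
      slowCoeff μ ν κ δ β θ W.trace * Real.log ((T₀ + N : ℕ) : ℝ) +
        slowConst μ ν κ δ β θ W.trace x := by
  have hν := s.nu_pos
  have hμ := s.mu_pos
  have hδ := s.delta_nonneg
  obtain ⟨Z, hZ, hZ0, hZs⟩ := s.exists_dominating
  have h1 := s.sum_dominating_le hx hZ0 (fun k => (hZ k).1) hZs N
  have h2 := s.sum_residual_le hx N
  -- The weight is bounded by ν + δ, since the factor T₀ + k + 1 exactly cancels the decay of the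
  -- certificate increment.
  have h3 : ∀ k, |((P k + ((T₀ : ℝ) + k + 1) • (P (k + 1) - P k)) * (X (k + 1) - X k)).trace| ≤
      (ν + δ) / μ * (P k * Z k).trace := by
    intro k
    have hpos : (0 : ℝ) < (T₀ : ℝ) + k + 1 := by positivity
    refine (abs_trace_mul_le (u := ν + δ) (by simp [s.P_symm]) ?_ (hZ k).2.1 (hZ k).2.2).trans ?_
    · refine (norm_add_le _ _).trans (add_le_add
        (norm_le_of_nonneg_of_le hν.le (s.P_nonneg k) (s.cert k).upper) ?_)
      rw [norm_smul, Real.norm_of_nonneg hpos.le]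
      calc _ ≤ ((T₀ : ℝ) + k + 1) * (δ / ((T₀ : ℝ) + k + 1)) := by gcongr; exact s.P_diff k
        _ = δ := by field_simp
    · rw [div_mul_eq_mul_div, mul_div_assoc]
      gcongr
      exact s.trace_le_of_trace_mul k (hZ k).1
  rw [Finset.sum_sub_distrib]
  refine (abs_sub _ _).trans ?_
  have h4 : |∑ k ∈ Finset.range N, ((T₀ : ℝ) + k) * (E k * X k).trace| ≤
      θ * (2 * κ ^ 4 * W.trace) * Real.log ((T₀ + N : ℕ) : ℝ) +
        θ * (κ ^ 2 * x) * (4 * κ ^ 2 / 3) := by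
    rw [abs_of_nonneg]
    · exact h2
    · exact Finset.sum_nonneg fun k _ => mul_nonneg (by positivity)
        (trace_mul_nonneg (s.E_nonneg k) (s.X_nonneg k))
  have h5 := (Finset.abs_sum_le_sum_abs _ _).trans (Finset.sum_le_sum fun k (_ : k ∈
    Finset.range N) => h3 k)
  rw [← Finset.mul_sum] at h5
  have h6 := h5.trans (mul_le_mul_of_nonneg_left h1 (by positivity : 0 ≤ (ν + δ) / μ))
  refine (add_le_add h4 h6).trans_eq ?_
  rw [slowCoeff, slowConst]
  ring

end SlowSystem

end SecondMoments

/-! ### Fixed policies: lower and upper bounds on the cost -/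

section FixedPolicy

theorem sum_Icc_one {M : Type*} [AddCommMonoid M] (f : ℕ → M) (T : ℕ) :
    ∑ t ∈ Finset.Icc 1 T, f t = ∑ s ∈ Finset.range T, f (s + 1) := by
  induction T with
  | zero => simp
  | succ T ih => rw [Finset.sum_Icc_succ_top (by omega), ih, Finset.sum_range_succ]

theorem sum_succ_mul_sub (p : ℕ → ℝ) (N : ℕ) :
    ∑ i ∈ Finset.range N, ((i : ℝ) + 1) * (p i - p (i + 1)) =
      ∑ i ∈ Finset.range N, p i - N * p N := by
  induction N with
  | zero => simp
  | succ N ih =>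
    rw [Finset.sum_range_succ, Finset.sum_range_succ, ih]
    push_cast
    ring

/-- A lower bound on the cost from a dynamic programming recursion: the deficit caused by the
transient is absorbed by the suboptimality gap. -/
theorem le_cost_of_recursion {a c p e η : ℕ → ℝ} {μ σ ν δ cost : ℝ} {T : ℕ}
    (hμ : 0 < μ) (hμσ : μ ≤ σ) (hν : 0 ≤ ν) (hδ : 0 ≤ δ) (ha : ∀ i, 0 ≤ a i) (hp : ∀ i, 0 ≤ p i)
    (he : ∀ i, 0 ≤ e i) (hc : ∀ i, μ * a i ≤ c i) (hpa : ∀ i, p i ≤ ν * a i)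
    (hrec : ∀ i, p (i + 1) = p i - c i + e i - η i) (hη0 : ∀ i, 0 ≤ η i)
    (hη : ∀ i, η i ≤ δ * a i) (hT : 2 * σ ≤ μ * T)
    (hcost : ∀ N : ℕ, N ≤ T →
      ∑ i ∈ Finset.range N, (T * c i - σ * (i + 1) * a i) ≤ cost) :
    T * p 0 - (10 * (σ / μ) * (ν / μ) + 2 * T * δ / μ) * p 0 ≤ cost := by
  have hσ : 0 < σ := hμ.trans_le hμσ
  have hT0 : (0 : ℝ) < T := by
    by_contra h
    have : (T : ℝ) ≤ 0 := not_lt.1 h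
    nlinarith
  -- Only a policy that is cheaper than T p_0 needs an argument; its low cost then bounds its
  -- excitation.
  rcases le_or_gt (T * p 0) cost with h | h
  · have : 0 ≤ (10 * (σ / μ) * (ν / μ) + 2 * T * δ / μ) * p 0 := by
      have := hp 0
      positivity
    linarith
  -- Up to this horizon the deficit σ(i+1)a_i uses at most half of T c_i.
  set y := μ * T / (2 * σ) with hy
  have hy1 : 1 ≤ y := by rw [hy, one_le_div (by positivity)]; exact hT
  set N := ⌊y⌋₊ with hN
  have hN1 : 1 ≤ N := (Nat.one_le_floor_iff y).2 hy1
  have hNy : (N : ℝ) ≤ y := Nat.floor_le (by linarith)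
  have hyN : y ≤ 2 * N := by
    have h1 := (Nat.lt_floor_add_one y).le
    have h2 : (1 : ℝ) ≤ N := by exact_mod_cast hN1
    linarith
  have hNσ : 2 * σ * N ≤ μ * T := by
    rw [hy, le_div_iff₀ (by positivity)] at hNy
    linarith
  have hTN : T * μ ≤ 4 * σ * N := by
    rw [hy, div_le_iff₀ (by positivity)] at hyN
    linarith
  have hNT : N ≤ T := by
    have : (N : ℝ) ≤ T := by
      have h1 : y ≤ T := by
        rw [hy, div_le_iff₀ (by positivity)]
        nlinarith
      linarith
    exact_mod_cast this
  have hN0 : (0 : ℝ) < N := by exact_mod_cast hN1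
  -- the total excitation is bounded
  have hsum_a : μ * ∑ i ∈ Finset.range N, a i ≤ 2 * p 0 := by
    have h1 : ∑ i ∈ Finset.range N, T * μ / 2 * a i ≤
        ∑ i ∈ Finset.range N, (T * c i - σ * (i + 1) * a i) := by
      refine Finset.sum_le_sum fun i hi => ?_
      have hi1 : (i : ℝ) + 1 ≤ N := by exact_mod_cast Finset.mem_range.1 hi
      have h2 : T * (μ * a i) ≤ T * c i := by gcongr; exact hc i
      have h3 : σ * (i + 1) * a i ≤ T * μ / 2 * a i := by
        have := ha i
        gcongr
        nlinarith
      linarith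
    have h2 := h1.trans (hcost N hNT)
    rw [← Finset.mul_sum] at h2
    have h3 : T * (μ * ∑ i ∈ Finset.range N, a i) ≤ T * (2 * p 0) := by linarith
    exact le_of_mul_le_mul_left h3 hT0
  have hsum_p : ∑ i ∈ Finset.range N, p i ≤ ν / μ * (2 * p 0) := by
    calc _ ≤ ∑ i ∈ Finset.range N, ν * a i := Finset.sum_le_sum fun i _ => hpa i
      _ = ν / μ * (μ * ∑ i ∈ Finset.range N, a i) := by rw [← Finset.mul_sum]; field_simp
      _ ≤ _ := by gcongr
  -- Pigeonhole: some p is at most the average. Stopping there leaves T p_{N₁} = O(1), as N is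
  -- proportional to T; no mixing rate of the policy is needed.
  obtain ⟨N₁, hN₁, hpN⟩ : ∃ N₁ ∈ Finset.range N, p N₁ ≤ ν / μ * (2 * p 0) / N := by
    by_contra hcon
    push Not at hcon
    have := Finset.sum_lt_sum_of_nonempty (Finset.nonempty_range_iff.2 (by omega)) hcon
    rw [Finset.sum_const, Finset.card_range, nsmul_eq_mul, mul_div_cancel₀ _ hN0.ne'] at this
    linarith
  have hN₁N : N₁ < N := Finset.mem_range.1 hN₁
  have hsub : Finset.range N₁ ⊆ Finset.range N := Finset.range_mono hN₁N.le
  have hsum_a₁ : ∑ i ∈ Finset.range N₁, a i ≤ 2 * p 0 / μ := by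
    rw [le_div_iff₀ hμ, mul_comm]
    refine le_trans ?_ hsum_a
    gcongr
    exact fun i _ _ => ha i
  have hsum_p₁ : ∑ i ∈ Finset.range N₁, p i ≤ ν / μ * (2 * p 0) :=
    (Finset.sum_le_sum_of_subset_of_nonneg hsub fun i _ _ => hp i).trans hsum_p
  have hTp : T * p N₁ ≤ 8 * (σ / μ) * (ν / μ) * p 0 := by
    have := hp 0
    calc T * p N₁ ≤ T * (ν / μ * (2 * p 0) / N) := by gcongr
      _ = (T * μ) * (ν / μ * (2 * p 0) / (N * μ)) := by field_simp
      _ ≤ (4 * σ * N) * (ν / μ * (2 * p 0) / (N * μ)) := by gcongr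
      _ = _ := by field_simp; ring
  have hsum_c : ∑ i ∈ Finset.range N₁, c i = p 0 - p N₁ + ∑ i ∈ Finset.range N₁, e i -
      ∑ i ∈ Finset.range N₁, η i := by
    have h1 : ∀ i ∈ Finset.range N₁, c i = p i - p (i + 1) + e i - η i := fun i _ => by
      have := hrec i; linarith
    rw [Finset.sum_congr rfl h1, Finset.sum_sub_distrib, Finset.sum_add_distrib,
      Finset.sum_range_sub']
  have hsum_η : ∑ i ∈ Finset.range N₁, η i ≤ δ * (2 * p 0 / μ) := by
    refine (Finset.sum_le_sum fun i _ => hη i).trans ?_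
    rw [← Finset.mul_sum]
    gcongr
  have hsum_e : 0 ≤ ∑ i ∈ Finset.range N₁, e i := Finset.sum_nonneg fun i _ => he i
  -- Bound μ a_i by p_i - p_{i+1} + e_i and sum by parts: the weights i+1 leave the plain sum of the
  -- p_i plus at most N times the gaps.
  have hw : μ * ∑ i ∈ Finset.range N₁, ((i : ℝ) + 1) * a i ≤
      ν / μ * (2 * p 0) + N * ∑ i ∈ Finset.range N₁, e i := by
    have h1 : μ * ∑ i ∈ Finset.range N₁, ((i : ℝ) + 1) * a i ≤
        ∑ i ∈ Finset.range N₁, (((i : ℝ) + 1) * (p i - p (i + 1)) + N * e i) := by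
      rw [Finset.mul_sum]
      refine Finset.sum_le_sum fun i hi => ?_
      have hi1 : (i : ℝ) + 1 ≤ N := by
        have : i + 1 ≤ N := by have := Finset.mem_range.1 hi; omega
        exact_mod_cast this
      have h2 : c i ≤ p i - p (i + 1) + e i := by
        have := hrec i; have := hη0 i; linarith
      have h3 : ((i : ℝ) + 1) * (μ * a i) ≤ ((i : ℝ) + 1) * (p i - p (i + 1) + e i) := by
        gcongr
        exact (hc i).trans h2
      have h4 : ((i : ℝ) + 1) * e i ≤ N * e i := by
        have := he i
        gcongr
      linarith
    rw [Finset.sum_add_distrib, sum_succ_mul_sub, ← Finset.mul_sum] at h1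
    have h5 : 0 ≤ (N₁ : ℝ) * p N₁ := mul_nonneg N₁.cast_nonneg (hp _)
    linarith
  have hfin := hcost N₁ (hN₁N.le.trans hNT)
  rw [Finset.sum_sub_distrib, ← Finset.mul_sum, hsum_c] at hfin
  have hσw : ∑ i ∈ Finset.range N₁, σ * ((i : ℝ) + 1) * a i ≤
      σ / μ * (ν / μ * (2 * p 0)) + T * ∑ i ∈ Finset.range N₁, e i := by
    have e1 : ∑ i ∈ Finset.range N₁, σ * ((i : ℝ) + 1) * a i =
        σ / μ * (μ * ∑ i ∈ Finset.range N₁, ((i : ℝ) + 1) * a i) := by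
      rw [← mul_assoc, div_mul_cancel₀ _ hμ.ne', Finset.mul_sum]
      exact Finset.sum_congr rfl fun i _ => by ring
    rw [e1]
    have h1 : σ / μ * (μ * ∑ i ∈ Finset.range N₁, ((i : ℝ) + 1) * a i) ≤
        σ / μ * (ν / μ * (2 * p 0) + N * ∑ i ∈ Finset.range N₁, e i) := by gcongr
    -- The absorption: multiplied by σ/μ, the gap part of the deficit is at most T Σ e_i, which the
    -- dynamic programming identity supplies with a positive sign.
    have h2 : σ / μ * N ≤ T := by
      rw [div_mul_eq_mul_div, div_le_iff₀ hμ]; nlinarith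
    have h3 : σ / μ * N * ∑ i ∈ Finset.range N₁, e i ≤ T * ∑ i ∈ Finset.range N₁, e i := by gcongr
    linarith
  have hTη : T * ∑ i ∈ Finset.range N₁, η i ≤ 2 * T * δ / μ * p 0 := by
    calc _ ≤ T * (δ * (2 * p 0 / μ)) := by gcongr
      _ = _ := by ring
  have e3 : T * (p 0 - p N₁ + ∑ i ∈ Finset.range N₁, e i - ∑ i ∈ Finset.range N₁, η i) =
      T * p 0 - T * p N₁ + T * ∑ i ∈ Finset.range N₁, e i - T * ∑ i ∈ Finset.range N₁, η i := by
    ring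
  rw [e3] at hfin
  -- The 8 comes from stopping at N₁, the remaining 2 from the summation by parts.
  have e4 : (10 * (σ / μ) * (ν / μ) + 2 * T * δ / μ) * p 0 =
      8 * (σ / μ) * (ν / μ) * p 0 + 2 * T * δ / μ * p 0 + σ / μ * (ν / μ * (2 * p 0)) := by ring
  rw [e4]
  linarith

variable {n m : ℕ}

/-- The contribution `Fⁱ W (Fⁱ)ᵀ` of the noise after `i` steps. -/
def noiseResponse (F W : Matrix (Fin n) (Fin n) ℝ) (i : ℕ) : Matrix (Fin n) (Fin n) ℝ :=
  F ^ i * W * (F ^ i)ᵀ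

theorem noiseResponse_zero (F W : Matrix (Fin n) (Fin n) ℝ) : noiseResponse F W 0 = W := by
  simp [noiseResponse]

theorem noiseResponse_succ (F W : Matrix (Fin n) (Fin n) ℝ) (i : ℕ) :
    noiseResponse F W (i + 1) = F * noiseResponse F W i * Fᵀ := by
  rw [noiseResponse, noiseResponse, pow_succ', Matrix.transpose_mul]
  simp only [Matrix.mul_assoc]

theorem noiseResponse_nonneg (F : Matrix (Fin n) (Fin n) ℝ) {W : Matrix (Fin n) (Fin n) ℝ}
    (hW : 0 ≤ W) (i : ℕ) : 0 ≤ noiseResponse F W i :=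
  conj_nonneg' hW _

theorem secondMoment_eq_sum {F W : Matrix (Fin n) (Fin n) ℝ} {X : ℕ → Matrix (Fin n) (Fin n) ℝ}
    (hX : ∀ t, 1 ≤ t → X (t + 1) = F * X t * Fᵀ + W) (s : ℕ) :
    X (s + 1) = noiseResponse F (X 1) s + ∑ i ∈ Finset.range s, noiseResponse F W i := by
  induction s with
  | zero => simp [noiseResponse_zero]
  | succ s ih =>
    rw [hX (s + 1) (by omega), ih, Matrix.mul_add, Matrix.add_mul, Finset.sum_range_succ',
      noiseResponse_succ, noiseResponse_zero, Matrix.mul_sum, Matrix.sum_mul]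
    simp only [noiseResponse_succ]
    abel

variable {A : Matrix (Fin n) (Fin n) ℝ} {B : Matrix (Fin n) (Fin m) ℝ}
  {Q : ℕ → Matrix (Fin n) (Fin n) ℝ} {R : ℕ → Matrix (Fin m) (Fin m) ℝ} {μ σ ν : ℝ}

theorem CostAssumption.le_stageCost (h : CostAssumption Q R μ σ) (hμ : 0 < μ) {t : ℕ} (ht : 1 ≤ t)
    (K : Matrix (Fin m) (Fin n) ℝ) : μ • stageCost 1 1 K ≤ stageCost (Q t) (R t) K := by
  rw [← stageCost_smul_one]
  exact stageCost_mono (h.Q_bounds hμ t ht).1 (h.R_bounds hμ t ht).1 K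

theorem CostAssumption.stageCost_le (h : CostAssumption Q R μ σ) (hμ : 0 < μ) {t : ℕ} (ht : 1 ≤ t)
    (K : Matrix (Fin m) (Fin n) ℝ) : stageCost (Q t) (R t) K ≤ σ • stageCost 1 1 K := by
  rw [← stageCost_smul_one]
  exact stageCost_mono (h.Q_bounds hμ t ht).2 (h.R_bounds hμ t ht).2 K

theorem CostAssumption.le_stageCost_runAvg (h : CostAssumption Q R μ σ) (hμ : 0 < μ) {t : ℕ}
    (ht : 1 ≤ t) (K : Matrix (Fin m) (Fin n) ℝ) :
    μ • stageCost 1 1 K ≤ stageCost (runAvg Q t) (runAvg R t) K := by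
  rw [← stageCost_smul_one]
  exact stageCost_mono (h.runAvg_Q_bounds hμ ht).1 (h.runAvg_R_bounds hμ ht).1 K

theorem stageCost_one_nonneg (K : Matrix (Fin m) (Fin n) ℝ) :
    (0 : Matrix (Fin n) (Fin n) ℝ) ≤ stageCost 1 1 K :=
  one_nonneg_matrix.trans (one_le_stageCost_one K)

theorem CostAssumption.stageCost_nonneg (h : CostAssumption Q R μ σ) (hμ : 0 < μ) {t : ℕ}
    (ht : 1 ≤ t) (K : Matrix (Fin m) (Fin n) ℝ) : 0 ≤ stageCost (Q t) (R t) K :=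
  (smul_nonneg_matrix hμ.le (stageCost_one_nonneg K)).trans (h.le_stageCost hμ ht K)

theorem sum_trace_stageCost (T : ℕ) (K : Matrix (Fin m) (Fin n) ℝ)
    (Z : Matrix (Fin n) (Fin n) ℝ) :
    ∑ t ∈ Finset.Icc 1 T, (stageCost (Q t) (R t) K * Z).trace =
      T * (stageCost (runAvg Q T) (runAvg R T) K * Z).trace := by
  rw [← Matrix.trace_sum, ← Matrix.sum_mul, ← smul_stageCost_runAvg, Matrix.smul_mul,
    Matrix.trace_smul, smul_eq_mul]

/-- Any fixed policy costs at least `T tr(P W) - O(1)`, where `P` nearly solves the Bellman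
equation for the average costs. -/
theorem le_cost_fixed (h : CostAssumption Q R μ σ) (hμ : 0 < μ) (hμσ : μ ≤ σ) {T : ℕ}
    {P W : Matrix (Fin n) (Fin n) ℝ} (hP : 0 ≤ P) (hPν : P ≤ ν • 1) (hν : 0 ≤ ν) (hW : 0 ≤ W)
    {δ : ℝ} (hδ : 0 ≤ δ)
    (hE0 : 0 ≤ bellmanResidual A B (runAvg Q T) (runAvg R T) P)
    (hE : bellmanResidual A B (runAvg Q T) (runAvg R T) P ≤ δ • 1) (hT : 2 * σ ≤ μ * T)
    (K : Matrix (Fin m) (Fin n) ℝ) {X : ℕ → Matrix (Fin n) (Fin n) ℝ} (hX1 : 0 ≤ X 1)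
    (hX : ∀ t, 1 ≤ t → X (t + 1) = closedLoop A B K * X t * (closedLoop A B K)ᵀ + W) :
    T * (P * W).trace - (10 * (σ / μ) * (ν / μ) + 2 * T * δ / μ) * (P * W).trace ≤
      ∑ t ∈ Finset.Icc 1 T, (stageCost (Q t) (R t) K * X t).trace := by
  have hσ : 0 < σ := hμ.trans_le hμσ
  have hT1 : 1 ≤ T := by
    by_contra hcon
    have : T = 0 := by omega
    subst this
    simp at hT
    linarith
  set F := closedLoop A B K with hF
  set V := noiseResponse F W with hV
  have hV0 : ∀ i, 0 ≤ V i := fun i => noiseResponse_nonneg F hW i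
  set E := bellmanResidual A B (runAvg Q T) (runAvg R T) P with hEd
  set G := gain A B (runAvg R T) P with hG
  set S := Bᵀ * P * B + runAvg R T with hS
  have hR := (h.runAvg_R_bounds hμ hT1).1
  have hS0 : 0 ≤ S := (smul_nonneg_matrix hμ.le one_nonneg_matrix).trans
    (smul_one_le_conj_add hP hR)
  have hsq := bellman_eq_gain_add (A := A) (B := B) hμ hP hR (runAvg Q T) K
  -- The dynamic programming identity for an arbitrary K: its gap over the improved gain enters with
  -- a plus sign, the residual of P with a minus sign.
  have hbell : Fᵀ * P * F = P - stageCost (runAvg Q T) (runAvg R T) K +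
      (K - G)ᵀ * S * (K - G) - E := by
    rw [← hF, ← hG, ← hS] at hsq
    have : Fᵀ * P * F = (Fᵀ * P * F + stageCost (runAvg Q T) (runAvg R T) K) -
      stageCost (runAvg Q T) (runAvg R T) K := by abel
    rw [this, hsq, hEd, bellmanResidual, ← hG]
    abel
  have hp0 : (P * W).trace = (P * V 0).trace := by rw [hV, noiseResponse_zero]
  rw [hp0]
  refine le_cost_of_recursion (a := fun i => (stageCost 1 1 K * V i).trace)
    (c := fun i => (stageCost (runAvg Q T) (runAvg R T) K * V i).trace)
    (p := fun i => (P * V i).trace) (e := fun i => ((K - G)ᵀ * S * (K - G) * V i).trace)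
    (η := fun i => (E * V i).trace) hμ hμσ hν hδ
    (fun i => trace_mul_nonneg (stageCost_one_nonneg K) (hV0 i))
    (fun i => trace_mul_nonneg hP (hV0 i))
    (fun i => trace_mul_nonneg (conj_nonneg hS0 _) (hV0 i)) (fun i => ?_) (fun i => ?_)
    (fun i => ?_) (fun i => trace_mul_nonneg hE0 (hV0 i)) (fun i => ?_) hT (fun N hN => ?_)
  · have := trace_mul_mono (h.le_stageCost_runAvg hμ hT1 K) (hV0 i)
    rwa [Matrix.smul_mul, Matrix.trace_smul, smul_eq_mul] at this
  · have h1 : P ≤ ν • stageCost 1 1 K :=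
      hPν.trans (smul_le_smul_matrix hν (one_le_stageCost_one K))
    have := trace_mul_mono h1 (hV0 i)
    rwa [Matrix.smul_mul, Matrix.trace_smul, smul_eq_mul] at this
  · rw [hV, noiseResponse_succ, ← hV, ← trace_conj_mul, hbell]
    simp only [Matrix.sub_mul, Matrix.add_mul, Matrix.trace_sub, Matrix.trace_add]
  · have h1 : E ≤ δ • stageCost 1 1 K :=
      hE.trans (smul_le_smul_matrix hδ (one_le_stageCost_one K))
    have := trace_mul_mono h1 (hV0 i)
    rwa [Matrix.smul_mul, Matrix.trace_smul, smul_eq_mul] at this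
  · have key : ∀ s ∈ Finset.range T,
        ∑ i ∈ Finset.range N, ((stageCost (Q (s + 1)) (R (s + 1)) K * V i).trace -
          if s ≤ i then σ * (stageCost 1 1 K * V i).trace else 0) ≤
        (stageCost (Q (s + 1)) (R (s + 1)) K * X (s + 1)).trace := by
      intro s _
      have hC := h.stageCost_nonneg hμ (t := s + 1) (by omega) K
      rw [secondMoment_eq_sum hX s, Matrix.mul_add, Matrix.trace_add, Matrix.mul_sum,
        Matrix.trace_sum]
      refine le_add_of_nonneg_of_le (trace_mul_nonneg hC (noiseResponse_nonneg F hX1 s)) ?_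
      have h1 : ∀ i ∈ Finset.range N, ((stageCost (Q (s + 1)) (R (s + 1)) K * V i).trace -
          if s ≤ i then σ * (stageCost 1 1 K * V i).trace else 0) ≤
          if i < s then (stageCost (Q (s + 1)) (R (s + 1)) K * V i).trace else 0 := by
        intro i _
        by_cases hi : s ≤ i
        · rw [if_pos hi, if_neg (by omega), sub_nonpos]
          have := trace_mul_mono (h.stageCost_le hμ (t := s + 1) (by omega) K) (hV0 i)
          rwa [Matrix.smul_mul, Matrix.trace_smul, smul_eq_mul] at this
        · rw [if_neg hi, if_pos (by omega), sub_zero]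
      refine (Finset.sum_le_sum h1).trans ?_
      rw [← Finset.sum_filter]
      refine Finset.sum_le_sum_of_subset_of_nonneg ?_
        fun i _ _ => trace_mul_nonneg hC (hV0 i)
      intro i hi
      exact Finset.mem_range.2 (Finset.mem_filter.1 hi).2
    rw [sum_Icc_one]
    refine le_trans ?_ (Finset.sum_le_sum key)
    rw [Finset.sum_comm]
    refine Finset.sum_le_sum fun i _ => ?_
    rw [Finset.sum_sub_distrib, ← sum_Icc_one (fun t => (stageCost (Q t) (R t) K * V i).trace),
      sum_trace_stageCost]
    refine sub_le_sub_left ?_ _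
    have ha := trace_mul_nonneg (stageCost_one_nonneg K) (hV0 i)
    rw [← Finset.sum_filter, Finset.sum_const, nsmul_eq_mul]
    have hcard : ((Finset.range T).filter fun s => s ≤ i).card ≤ i + 1 := by
      refine (Finset.card_le_card (t := Finset.range (i + 1)) ?_).trans_eq (Finset.card_range _)
      intro s hs
      exact Finset.mem_range.2 (Nat.lt_succ_of_le (Finset.mem_filter.1 hs).2)
    have hcard' : (((Finset.range T).filter fun s => s ≤ i).card : ℝ) ≤ i + 1 := by
      exact_mod_cast hcard
    calc _ ≤ ((i : ℝ) + 1) * (σ * (stageCost 1 1 K * V i).trace) := by gcongr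
      _ = _ := by ring

/-- The policy with value `P` under the average costs costs at most `T tr(P W) + O(1)`. -/
theorem cost_fixed_le (h : CostAssumption Q R μ σ) (hμ : 0 < μ) (hμσ : μ ≤ σ) {T : ℕ}
    (hT1 : 1 ≤ T) {P W : Matrix (Fin n) (Fin n) ℝ} (hP : 0 ≤ P) (hPν : P ≤ ν • 1) (hW : 0 ≤ W)
    {K : Matrix (Fin m) (Fin n) ℝ} (hv : IsPolicyValue A B (runAvg Q T) (runAvg R T) K P)
    {X : ℕ → Matrix (Fin n) (Fin n) ℝ} (hX1 : 0 ≤ X 1)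
    (hX : ∀ t, 1 ≤ t → X (t + 1) = closedLoop A B K * X t * (closedLoop A B K)ᵀ + W) :
    ∑ t ∈ Finset.Icc 1 T, (stageCost (Q t) (R t) K * X t).trace ≤
      T * (P * W).trace + σ / μ * (ν * (X 1).trace) := by
  have hσ : 0 < σ := hμ.trans_le hμσ
  set F := closedLoop A B K with hF
  set C := stageCost (runAvg Q T) (runAvg R T) K with hC
  have hC0 : 0 ≤ C := (smul_nonneg_matrix hμ.le (stageCost_one_nonneg K)).trans
    (h.le_stageCost_runAvg hμ hT1 K)
  have htel : ∀ Y : Matrix (Fin n) (Fin n) ℝ, 0 ≤ Y →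
      ∑ i ∈ Finset.range T, (C * noiseResponse F Y i).trace ≤ (P * Y).trace := by
    intro Y hY
    have h1 : ∀ i ∈ Finset.range T, (C * noiseResponse F Y i).trace =
        (P * noiseResponse F Y i).trace - (P * noiseResponse F Y (i + 1)).trace := by
      intro i _
      rw [noiseResponse_succ, ← trace_conj_mul, ← Matrix.trace_sub, ← Matrix.sub_mul]
      congr 2
      have := hv.eq_add_stageCost
      exact eq_sub_of_add_eq (by rw [add_comm]; exact this.symm)
    rw [Finset.sum_congr rfl h1, Finset.sum_range_sub', noiseResponse_zero]
    exact sub_le_self _ (trace_mul_nonneg hP (noiseResponse_nonneg F hY T))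
  -- Needed only for the initial transient, where one lag meets one time and the costs do not
  -- average; the noise part keeps the exact average.
  have hle : ∀ s, stageCost (Q (s + 1)) (R (s + 1)) K ≤ (σ / μ) • C := by
    intro s
    refine (h.stageCost_le hμ (by omega) K).trans ?_
    have := smul_le_smul_matrix (c := σ / μ) (by positivity) (h.le_stageCost_runAvg hμ hT1 K)
    rwa [smul_smul, div_mul_cancel₀ _ hμ.ne'] at this
  have h1 : ∀ s ∈ Finset.range T, (stageCost (Q (s + 1)) (R (s + 1)) K * X (s + 1)).trace ≤
      σ / μ * (C * noiseResponse F (X 1) s).trace +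
        ∑ i ∈ Finset.range T, (stageCost (Q (s + 1)) (R (s + 1)) K * noiseResponse F W i).trace := by
    intro s hs
    rw [secondMoment_eq_sum hX s, Matrix.mul_add, Matrix.trace_add, Matrix.mul_sum,
      Matrix.trace_sum]
    refine add_le_add ?_ ?_
    · have := trace_mul_mono (hle s) (noiseResponse_nonneg F hX1 s)
      rwa [Matrix.smul_mul, Matrix.trace_smul, smul_eq_mul] at this
    · exact Finset.sum_le_sum_of_subset_of_nonneg
        (Finset.range_mono (Finset.mem_range.1 hs).le) fun i _ _ =>
          trace_mul_nonneg (h.stageCost_nonneg hμ (by omega) K) (noiseResponse_nonneg F hW i)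
  rw [sum_Icc_one]
  refine (Finset.sum_le_sum h1).trans ?_
  rw [Finset.sum_add_distrib, ← Finset.mul_sum, Finset.sum_comm, add_comm]
  refine add_le_add ?_ ?_
  · have h2 : ∀ i ∈ Finset.range T, ∑ s ∈ Finset.range T,
        (stageCost (Q (s + 1)) (R (s + 1)) K * noiseResponse F W i).trace =
        T * (C * noiseResponse F W i).trace := fun i _ => by
      rw [← sum_Icc_one (fun t => (stageCost (Q t) (R t) K * noiseResponse F W i).trace),
        sum_trace_stageCost]
    rw [Finset.sum_congr rfl h2, ← Finset.mul_sum]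
    gcongr
    exact htel W hW
  · gcongr
    exact (htel (X 1) hX1).trans (trace_mul_le_of_le_smul_one hPν hX1)

end FixedPolicy

/-! ### The second moments of the state -/

section Probability

variable {n m : ℕ} {Ω : Type*} [MeasurableSpace Ω] {Pr : Measure Ω}

section Gaussian

variable {x : Ω → EuclideanSpace ℝ (Fin n)} {ξ : EuclideanSpace ℝ (Fin n)}
  {S : Matrix (Fin n) (Fin n) ℝ}

theorem memLp_coord_of_hasLaw (hx : HasLaw x (multivariateGaussian ξ S) Pr) (i : Fin n) :
    MemLp (fun ω => x ω i) 2 Pr := by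
  have h1 : MemLp (fun y : EuclideanSpace ℝ (Fin n) => y i) 2 (multivariateGaussian ξ S) :=
    (EuclideanSpace.proj (𝕜 := ℝ) i).comp_memLp' IsGaussian.memLp_two_id
  rw [← hx.map_eq] at h1
  exact (memLp_map_measure_iff h1.1 hx.aemeasurable).1 h1

theorem integral_coord_of_hasLaw (hx : HasLaw x (multivariateGaussian ξ S) Pr) (i : Fin n) :
    ∫ ω, x ω i ∂Pr = ξ i := by
  have h1 := (EuclideanSpace.proj (𝕜 := ℝ) i).integral_comp_comm
    (IsGaussian.integrable_fun_id (μ := multivariateGaussian ξ S))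
  rw [integral_id_multivariateGaussian] at h1
  have h2 := hx.integral_comp (f := fun y : EuclideanSpace ℝ (Fin n) => y i)
    (by fun_prop)
  exact h2.trans h1

theorem integral_coord_mul_coord_of_hasLaw [IsProbabilityMeasure Pr] (hS : S.PosSemidef)
    (hx : HasLaw x (multivariateGaussian 0 S) Pr) (i j : Fin n) :
    ∫ ω, x ω i * x ω j ∂Pr = S i j := by
  have h1 := covariance_eval_multivariateGaussian (μ := 0) hS i j
  rw [← hx.covariance_fun_comp (f := fun y : EuclideanSpace ℝ (Fin n) => y i)
    (g := fun y : EuclideanSpace ℝ (Fin n) => y j) (by fun_prop) (by fun_prop),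
    covariance_eq_sub (memLp_coord_of_hasLaw hx i) (memLp_coord_of_hasLaw hx j),
    integral_coord_of_hasLaw hx i] at h1
  simpa using h1

end Gaussian

theorem integrable_mul_of_memLp_two {f g : Ω → ℝ} (hf : MemLp f 2 Pr) (hg : MemLp g 2 Pr) :
    Integrable (fun ω => f ω * g ω) Pr :=
  hf.integrable_mul hg

theorem secondMoment_nonneg {x : Ω → EuclideanSpace ℝ (Fin n)}
    (hx : ∀ i, MemLp (fun ω => x ω i) 2 Pr) : 0 ≤ secondMoment Pr x := by
  rw [nonneg_iff_dotProduct]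
  · intro v
    have h1 : v ⬝ᵥ secondMoment Pr x *ᵥ v = ∫ ω, (∑ i, v i * x ω i) ^ 2 ∂Pr := by
      have h2 : ∀ ω, (∑ i, v i * x ω i) ^ 2 = ∑ i, ∑ j, v i * v j * (x ω i * x ω j) := by
        intro ω
        rw [sq, Finset.sum_mul_sum]
        exact Finset.sum_congr rfl fun i _ => Finset.sum_congr rfl fun j _ => by ring
      simp only [h2]
      have hint : ∀ i j, Integrable (fun ω => v i * v j * (x ω i * x ω j)) Pr :=
        fun i j => (integrable_mul_of_memLp_two (hx i) (hx j)).const_mul _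
      rw [integral_finsetSum _ fun i _ => integrable_finsetSum _ fun j _ => hint i j]
      simp only [dotProduct, Matrix.mulVec, Finset.mul_sum]
      refine Finset.sum_congr rfl fun i _ => ?_
      rw [integral_finsetSum _ fun j _ => hint i j]
      refine Finset.sum_congr rfl fun j _ => ?_
      rw [integral_const_mul, secondMoment, Matrix.of_apply]
      ring
    rw [h1]
    exact integral_nonneg fun ω => sq_nonneg _
  · ext i j
    simp only [secondMoment, Matrix.transpose_apply, Matrix.of_apply, mul_comm]

/-- The expectation of a quadratic form. -/
theorem integral_quadratic {x : Ω → EuclideanSpace ℝ (Fin n)}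
    (hx : ∀ i, MemLp (fun ω => x ω i) 2 Pr) (C : Matrix (Fin n) (Fin n) ℝ) :
    ∫ ω, (x ω).ofLp ⬝ᵥ (C *ᵥ (x ω).ofLp) ∂Pr = (C * secondMoment Pr x).trace := by
  have hint : ∀ i j, Integrable (fun ω => C i j * (x ω j * x ω i)) Pr :=
    fun i j => (integrable_mul_of_memLp_two (hx j) (hx i)).const_mul _
  have h2 : ∀ ω, (x ω).ofLp ⬝ᵥ (C *ᵥ (x ω).ofLp) = ∑ i, ∑ j, C i j * (x ω j * x ω i) := by
    intro ω
    simp only [dotProduct, Matrix.mulVec, Finset.mul_sum]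
    exact Finset.sum_congr rfl fun i _ => Finset.sum_congr rfl fun j _ => by ring
  simp only [h2]
  rw [integral_finsetSum _ fun i _ => integrable_finsetSum _ fun j _ => hint i j, Matrix.trace]
  refine Finset.sum_congr rfl fun i _ => ?_
  rw [integral_finsetSum _ fun j _ => hint i j, Matrix.diag_apply, Matrix.mul_apply]
  refine Finset.sum_congr rfl fun j _ => ?_
  rw [integral_const_mul, secondMoment, Matrix.of_apply]

section State

variable {A : Matrix (Fin n) (Fin n) ℝ} {B : Matrix (Fin n) (Fin m) ℝ}
  {W : Matrix (Fin n) (Fin n) ℝ} {x₁ : Ω → EuclideanSpace ℝ (Fin n)}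
  {w : ℕ → Ω → EuclideanSpace ℝ (Fin n)} {K : ℕ → Matrix (Fin m) (Fin n) ℝ}

theorem state_succ_apply {Ω' : Type*} {x₁ : Ω' → EuclideanSpace ℝ (Fin n)}
    {w : ℕ → Ω' → EuclideanSpace ℝ (Fin n)} {t : ℕ} (ht : 1 ≤ t) (ω : Ω') (i : Fin n) :
    state A B x₁ w K (t + 1) ω i =
      ∑ k, closedLoop A B (K t) i k * state A B x₁ w K t ω k + w t ω i := by
  obtain ⟨s, rfl⟩ : ∃ s, t = s + 1 := ⟨t - 1, by omega⟩
  set y := state A B x₁ w K (s + 1) ω with hy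
  have h1 : (state A B x₁ w K (s + 1 + 1) ω).ofLp =
      closedLoop A B (K (s + 1)) *ᵥ y.ofLp + (w (s + 1) ω).ofLp := by
    simp only [state, ← hy, closedLoop, Matrix.sub_mulVec, ← Matrix.mulVec_mulVec,
      WithLp.ofLp_add, Matrix.toEuclideanLin, map_neg]
    simp [sub_eq_add_neg]
  have h2 := congrFun h1 i
  rw [h2]
  rfl

/-- The covariance structure of the noise and the initial state. -/
structure NoiseModel (Pr : Measure Ω) (x₁ : Ω → EuclideanSpace ℝ (Fin n))
    (w : ℕ → Ω → EuclideanSpace ℝ (Fin n)) (W : Matrix (Fin n) (Fin n) ℝ) : Prop where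
  memLp_init : ∀ i, MemLp (fun ω => x₁ ω i) 2 Pr
  memLp_noise : ∀ t, 1 ≤ t → ∀ i, MemLp (fun ω => w t ω i) 2 Pr
  noise_cov : ∀ t, 1 ≤ t → ∀ i j, ∫ ω, w t ω i * w t ω j ∂Pr = W i j
  init_noise : ∀ t, 1 ≤ t → ∀ i j, ∫ ω, x₁ ω i * w t ω j ∂Pr = 0
  noise_noise : ∀ s t, 1 ≤ s → s < t → ∀ i j, ∫ ω, w s ω i * w t ω j ∂Pr = 0

/-- The regret depends on the probability space only through second moments, so independence and
Gaussian laws are reduced here to vanishing cross moments. -/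
theorem noiseModel_of_gaussian [IsProbabilityMeasure Pr] {ξ : EuclideanSpace ℝ (Fin n)}
    {X₁ : Matrix (Fin n) (Fin n) ℝ} (hW : W.PosSemidef)
    (hx₁ : HasLaw x₁ (multivariateGaussian ξ X₁) Pr)
    (hw : ∀ t, 1 ≤ t → HasLaw (w t) (multivariateGaussian 0 W) Pr)
    (hw_indep : iIndepFun (fun t : ℕ => w (t + 1)) Pr)
    (hx₁w : IndepFun x₁ (fun ω (t : ℕ) => w (t + 1) ω) Pr) : NoiseModel Pr x₁ w W where
  memLp_init := memLp_coord_of_hasLaw hx₁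
  memLp_noise t ht := memLp_coord_of_hasLaw (hw t ht)
  noise_cov t ht := integral_coord_mul_coord_of_hasLaw hW (hw t ht)
  init_noise t ht i j := by
    obtain ⟨s, rfl⟩ : ∃ s, t = s + 1 := ⟨t - 1, by omega⟩
    have h1 : IndepFun (fun ω => x₁ ω i) (fun ω => w (s + 1) ω j) Pr :=
      hx₁w.comp (φ := fun y : EuclideanSpace ℝ (Fin n) => y i)
        (ψ := fun y : ℕ → EuclideanSpace ℝ (Fin n) => y s j) (by fun_prop) (by fun_prop)
    rw [h1.integral_fun_mul_eq_mul_integral (memLp_coord_of_hasLaw hx₁ i).1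
      (memLp_coord_of_hasLaw (hw _ ht) j).1, integral_coord_of_hasLaw (hw _ ht) j]
    simp
  noise_noise s t hs hst i j := by
    obtain ⟨s, rfl⟩ : ∃ s', s = s' + 1 := ⟨s - 1, by omega⟩
    obtain ⟨t, rfl⟩ : ∃ t', t = t' + 1 := ⟨t - 1, by omega⟩
    have h1 : IndepFun (fun ω => w (s + 1) ω i) (fun ω => w (t + 1) ω j) Pr :=
      (hw_indep.indepFun (show s ≠ t by omega)).comp
        (φ := fun y : EuclideanSpace ℝ (Fin n) => y i)
        (ψ := fun y : EuclideanSpace ℝ (Fin n) => y j) (by fun_prop) (by fun_prop)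
    rw [h1.integral_fun_mul_eq_mul_integral (memLp_coord_of_hasLaw (hw _ hs) i).1
      (memLp_coord_of_hasLaw (hw _ (by omega)) j).1,
      integral_coord_of_hasLaw (hw (t + 1) (by omega)) j]
    simp

namespace NoiseModel

theorem memLp_state (h : NoiseModel Pr x₁ w W) {t : ℕ} (ht : 1 ≤ t) (i : Fin n) :
    MemLp (fun ω => state A B x₁ w K t ω i) 2 Pr := by
  induction t, ht using Nat.le_induction generalizing i with
  | base => exact h.memLp_init i
  | succ t ht ih =>
    simp only [state_succ_apply ht]
    exact (memLp_finsetSum _ fun k _ => (ih k).const_mul _).add (h.memLp_noise t ht i)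

/-- By linearity the state at time t combines x_1 and w_1, …, w_{t-1}, each uncorrelated with w_s
for s ≥ t; s stays fixed in the induction. -/
theorem integral_state_mul_noise (h : NoiseModel Pr x₁ w W) {t s : ℕ} (ht : 1 ≤ t) (hts : t ≤ s)
    (i j : Fin n) : ∫ ω, state A B x₁ w K t ω i * w s ω j ∂Pr = 0 := by
  induction t, ht using Nat.le_induction generalizing i with
  | base => exact h.init_noise s hts i j
  | succ t ht ih =>
    have hs : 1 ≤ s := by omega
    have e : ∀ ω, state A B x₁ w K (t + 1) ω i * w s ω j =
        ∑ k, closedLoop A B (K t) i k * (state A B x₁ w K t ω k * w s ω j) +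
          w t ω i * w s ω j := by
      intro ω
      rw [state_succ_apply ht, add_mul, Finset.sum_mul]
      simp only [mul_assoc]
    have hint : ∀ k, Integrable (fun ω => closedLoop A B (K t) i k *
        (state A B x₁ w K t ω k * w s ω j)) Pr := fun k =>
      (integrable_mul_of_memLp_two (h.memLp_state ht k) (h.memLp_noise s hs j)).const_mul _
    simp only [e]
    rw [integral_add (integrable_finsetSum _ fun k _ => hint k)
      (integrable_mul_of_memLp_two (h.memLp_noise t ht i) (h.memLp_noise s hs j)),
      integral_finsetSum _ fun k _ => hint k, h.noise_noise t s ht (by omega)]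
    simp only [integral_const_mul, ih (by omega), mul_zero, Finset.sum_const_zero, add_zero]

/-- The second moments satisfy the Lyapunov recursion. -/
theorem secondMoment_succ (h : NoiseModel Pr x₁ w W) {t : ℕ} (ht : 1 ≤ t) :
    secondMoment Pr (state A B x₁ w K (t + 1)) =
      closedLoop A B (K t) * secondMoment Pr (state A B x₁ w K t) * (closedLoop A B (K t))ᵀ +
        W := by
  ext i j
  set F := closedLoop A B (K t) with hF
  set x := state A B x₁ w K t with hx
  have hxm : ∀ k, MemLp (fun ω => x ω k) 2 Pr := fun k => h.memLp_state ht k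
  have hwm := h.memLp_noise t ht
  have e : ∀ ω, state A B x₁ w K (t + 1) ω i * state A B x₁ w K (t + 1) ω j =
      ∑ k, ∑ l, F i k * F j l * (x ω k * x ω l) + ∑ k, F i k * (x ω k * w t ω j) +
        ∑ l, F j l * (x ω l * w t ω i) + w t ω i * w t ω j := by
    intro ω
    rw [state_succ_apply ht, state_succ_apply ht, ← hF, ← hx]
    rw [add_mul, mul_add, mul_add, Finset.sum_mul_sum, Finset.sum_mul, Finset.mul_sum]
    have e1 : ∑ k, ∑ l, F i k * x ω k * (F j l * x ω l) =
        ∑ k, ∑ l, F i k * F j l * (x ω k * x ω l) :=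
      Finset.sum_congr rfl fun k _ => Finset.sum_congr rfl fun l _ => by ring
    have e2 : ∑ k, F i k * x ω k * w t ω j = ∑ k, F i k * (x ω k * w t ω j) :=
      Finset.sum_congr rfl fun k _ => by ring
    have e3 : ∑ l, w t ω i * (F j l * x ω l) = ∑ l, F j l * (x ω l * w t ω i) :=
      Finset.sum_congr rfl fun k _ => by ring
    rw [e1, e2, e3]
    ring
  have i1 : ∀ k l, Integrable (fun ω => F i k * F j l * (x ω k * x ω l)) Pr :=
    fun k l => (integrable_mul_of_memLp_two (hxm k) (hxm l)).const_mul _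
  have i2 : ∀ (a : Fin n → ℝ) (b k : Fin n), Integrable (fun ω => a k * (x ω k * w t ω b)) Pr :=
    fun a b k => (integrable_mul_of_memLp_two (hxm k) (hwm b)).const_mul _
  have j1 : Integrable (fun ω => ∑ k, ∑ l, F i k * F j l * (x ω k * x ω l)) Pr :=
    integrable_finsetSum _ fun k _ => integrable_finsetSum _ fun l _ => i1 k l
  have j2 : ∀ (a : Fin n → ℝ) (b : Fin n),
      Integrable (fun ω => ∑ k, a k * (x ω k * w t ω b)) Pr :=
    fun a b => integrable_finsetSum _ fun k _ => i2 a b k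
  have j12 : Integrable (fun ω => ∑ k, ∑ l, F i k * F j l * (x ω k * x ω l) +
      ∑ k, F i k * (x ω k * w t ω j)) Pr := j1.add (j2 (F i) j)
  have j123 : Integrable (fun ω => ∑ k, ∑ l, F i k * F j l * (x ω k * x ω l) +
      ∑ k, F i k * (x ω k * w t ω j) + ∑ l, F j l * (x ω l * w t ω i)) Pr :=
    j12.add (j2 (F j) i)
  have z : ∀ k b, ∫ ω, x ω k * w t ω b ∂Pr = 0 := fun k b =>
    h.integral_state_mul_noise ht le_rfl k b
  have z2 : ∀ (a : Fin n → ℝ) (b : Fin n), ∫ ω, ∑ k, a k * (x ω k * w t ω b) ∂Pr = 0 := by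
    intro a b
    rw [integral_finsetSum _ fun k _ => i2 a b k]
    simp only [integral_const_mul, z, mul_zero, Finset.sum_const_zero]
  rw [secondMoment, Matrix.of_apply]
  simp only [e]
  rw [integral_add j123 (integrable_mul_of_memLp_two (hwm i) (hwm j)),
    integral_add j12 (j2 (F j) i), integral_add j1 (j2 (F i) j), z2, z2, h.noise_cov t ht,
    add_zero, add_zero, integral_finsetSum _ fun k _ => integrable_finsetSum _ fun l _ => i1 k l,
    Matrix.add_apply, Matrix.mul_assoc, Matrix.mul_apply]
  congr 1
  refine Finset.sum_congr rfl fun k _ => ?_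
  rw [integral_finsetSum _ fun l _ => i1 k l, Matrix.mul_apply, Finset.mul_sum]
  refine Finset.sum_congr rfl fun l _ => ?_
  rw [integral_const_mul, secondMoment, Matrix.of_apply, Matrix.transpose_apply]
  ring

theorem secondMoment_state_nonneg (h : NoiseModel Pr x₁ w W) {t : ℕ} (ht : 1 ≤ t) :
    0 ≤ secondMoment Pr (state A B x₁ w K t) :=
  secondMoment_nonneg fun i => h.memLp_state ht i

/-- The expected cost in terms of the second moments. -/
theorem stepCost_eq (h : NoiseModel Pr x₁ w W) {Q : ℕ → Matrix (Fin n) (Fin n) ℝ}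
    {R : ℕ → Matrix (Fin m) (Fin m) ℝ} {t : ℕ} (ht : 1 ≤ t) :
    stepCost A B Q R Pr x₁ w K t =
      (stageCost (Q t) (R t) (K t) * secondMoment Pr (state A B x₁ w K t)).trace := by
  rw [← integral_quadratic fun i => h.memLp_state ht i, stepCost]
  congr 1
  ext ω
  simp only [stageCost, Matrix.add_mulVec, dotProduct_add, Matrix.toEuclideanLin]
  congr 1
  simp [Matrix.mulVec_neg, ← Matrix.mulVec_mulVec, Matrix.dotProduct_mulVec,
    Matrix.vecMul_transpose, Matrix.neg_vecMul, neg_dotProduct]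

end NoiseModel

end State

end Probability

/-! ### Regret bounds -/

section Regret

variable {n m : ℕ} {Ω : Type*} [MeasurableSpace Ω] {Pr : Measure Ω}
  {A : Matrix (Fin n) (Fin n) ℝ} {B : Matrix (Fin n) (Fin m) ℝ}
  {W : Matrix (Fin n) (Fin n) ℝ} {x₁ : Ω → EuclideanSpace ℝ (Fin n)}
  {w : ℕ → Ω → EuclideanSpace ℝ (Fin n)}
  {Qs : ℕ → Matrix (Fin n) (Fin n) ℝ} {Rs : ℕ → Matrix (Fin m) (Fin m) ℝ} {μ σ ν : ℝ}

theorem stepCost_nonneg (hN : NoiseModel Pr x₁ w W) (h : CostAssumption Qs Rs μ σ) (hμ : 0 < μ)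
    (K : ℕ → Matrix (Fin m) (Fin n) ℝ) {t : ℕ} (ht : 1 ≤ t) :
    0 ≤ stepCost A B Qs Rs Pr x₁ w K t := by
  rw [hN.stepCost_eq ht]
  exact trace_mul_nonneg (h.stageCost_nonneg hμ ht _) (hN.secondMoment_state_nonneg ht)

theorem stepCost_le (hN : NoiseModel Pr x₁ w W) (h : CostAssumption Qs Rs μ σ) (hμ : 0 < μ)
    (hσ : 0 ≤ σ) (K : ℕ → Matrix (Fin m) (Fin n) ℝ) {t : ℕ} (ht : 1 ≤ t) :
    stepCost A B Qs Rs Pr x₁ w K t ≤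
      σ * (1 + ‖K t‖ ^ 2) * (secondMoment Pr (state A B x₁ w K t)).trace := by
  rw [hN.stepCost_eq ht]
  refine trace_mul_le_of_le_smul_one ((h.stageCost_le hμ ht _).trans ?_)
    (hN.secondMoment_state_nonneg ht)
  rw [mul_smul]
  exact smul_le_smul_matrix hσ (stageCost_one_le _)

theorem sum_stepCost_nonneg (hN : NoiseModel Pr x₁ w W) (h : CostAssumption Qs Rs μ σ) (hμ : 0 < μ)
    (K : ℕ → Matrix (Fin m) (Fin n) ℝ) (T : ℕ) :
    0 ≤ ∑ t ∈ Finset.Icc 1 T, stepCost A B Qs Rs Pr x₁ w K t :=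
  Finset.sum_nonneg fun _ ht => stepCost_nonneg hN h hμ K (Finset.mem_Icc.1 ht).1

/-- Stabilizability makes the infimum range over a nonempty family; over an empty one it would be
the default value 0. -/
theorem regret_le_of_forall_le (hAB : IsStabilizable A B) {K : ℕ → Matrix (Fin m) (Fin n) ℝ}
    {T : ℕ} {c : ℝ} (h : ∀ K' : Matrix (Fin m) (Fin n) ℝ,
      c ≤ ∑ t ∈ Finset.Icc 1 T, stepCost A B Qs Rs Pr x₁ w (fun _ => K') t) :
    regret A B Qs Rs Pr x₁ w K T ≤
      ∑ t ∈ Finset.Icc 1 T, stepCost A B Qs Rs Pr x₁ w K t - c := by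
  obtain ⟨K₀, hK₀⟩ := hAB
  have : Nonempty {K' : Matrix (Fin m) (Fin n) ℝ // IsStable A B K'} := ⟨⟨K₀, hK₀⟩⟩
  have h1 : c ≤ ⨅ K' : {K' : Matrix (Fin m) (Fin n) ℝ // IsStable A B K'},
      ∑ t ∈ Finset.Icc 1 T, stepCost A B Qs Rs Pr x₁ w (fun _ => K'.1) t :=
    le_ciInf fun K' => h K'.1
  unfold regret
  linarith

/-- Nonnegative costs bound the family below, so that the real infimum is genuine. -/
theorem le_regret (hN : NoiseModel Pr x₁ w W) (h : CostAssumption Qs Rs μ σ) (hμ : 0 < μ)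
    {K : ℕ → Matrix (Fin m) (Fin n) ℝ} (T : ℕ) {K' : Matrix (Fin m) (Fin n) ℝ}
    (hK' : IsStable A B K') :
    ∑ t ∈ Finset.Icc 1 T, stepCost A B Qs Rs Pr x₁ w K t -
      ∑ t ∈ Finset.Icc 1 T, stepCost A B Qs Rs Pr x₁ w (fun _ => K') t ≤
      regret A B Qs Rs Pr x₁ w K T := by
  have h0 : BddBelow (Set.range fun K'' : {K' : Matrix (Fin m) (Fin n) ℝ // IsStable A B K'} =>
      ∑ t ∈ Finset.Icc 1 T, stepCost A B Qs Rs Pr x₁ w (fun _ => K''.1) t) := by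
    refine ⟨0, ?_⟩
    rintro _ ⟨K'', rfl⟩
    exact sum_stepCost_nonneg hN h hμ _ T
  have h1 := ciInf_le h0 ⟨K', hK'⟩
  unfold regret
  linarith

theorem sum_fixed_eq (hN : NoiseModel Pr x₁ w W) (T : ℕ) (K : Matrix (Fin m) (Fin n) ℝ) :
    ∑ t ∈ Finset.Icc 1 T, stepCost A B Qs Rs Pr x₁ w (fun _ => K) t =
      ∑ t ∈ Finset.Icc 1 T, (stageCost (Qs t) (Rs t) K *
        secondMoment Pr (state A B x₁ w (fun _ => K) t)).trace :=
  Finset.sum_congr rfl fun _ ht => hN.stepCost_eq (Finset.mem_Icc.1 ht).1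

/-- A bound on the trace of the second moment at time `t`. -/
def momentBound (κ x ω : ℝ) (t : ℕ) : ℝ :=
  (1 + κ ^ 2) ^ t * (x + ω)

/-- The cost up to time `T` is at most `initialCost`. -/
def initialCost (σ κ x ω : ℝ) (T : ℕ) : ℝ :=
  ∑ t ∈ Finset.Icc 1 T, σ * (1 + κ ^ 2) * momentBound κ x ω t

theorem momentBound_nonneg {κ x ω : ℝ} (hx : 0 ≤ x) (hω : 0 ≤ ω) (t : ℕ) :
    0 ≤ momentBound κ x ω t := by
  unfold momentBound; positivity

namespace BoundedRun

variable {r : Run A B Qs Rs μ σ ν}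

/-- A crude exponential bound, used only up to `tailStart B μ σ ν + 2`, a time fixed by the
parameters; this keeps the constants uniform over runs. -/
theorem trace_secondMoment_le (hr : BoundedRun r) (hN : NoiseModel Pr x₁ w W) (hW : 0 ≤ W) {t : ℕ}
    (ht : 1 ≤ t) : (secondMoment Pr (state A B x₁ w r.K t)).trace ≤
      momentBound (kappa μ ν) (secondMoment Pr x₁).trace W.trace t := by
  have hω := trace_nonneg_of_nonneg hW
  have hx := trace_nonneg_of_nonneg (secondMoment_nonneg hN.memLp_init)
  unfold momentBound
  induction t, ht using Nat.le_induction with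
  | base =>
    rw [pow_one]
    change (secondMoment Pr x₁).trace ≤ _
    nlinarith [sq_nonneg (kappa μ ν)]
  | succ t ht ih =>
    rw [hN.secondMoment_succ ht, Matrix.trace_add]
    have h1 := trace_conj_le (hN.secondMoment_state_nonneg (A := A) (B := B) (K := r.K) ht)
      (closedLoop A B (r.K t))
    have h2 : ‖closedLoop A B (r.K t)‖ ^ 2 ≤ kappa μ ν ^ 2 := by
      gcongr; exact hr.norm_closedLoop_le ht
    have h3 := trace_nonneg_of_nonneg (hN.secondMoment_state_nonneg (A := A) (B := B) (K := r.K) ht)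
    have h4 : (1 : ℝ) ≤ (1 + kappa μ ν ^ 2) ^ t := one_le_pow₀ (by
      have := sq_nonneg (kappa μ ν); linarith)
    have h5 : W.trace ≤ (1 + kappa μ ν ^ 2) ^ t * ((secondMoment Pr x₁).trace + W.trace) := by
      nlinarith
    calc _ ≤ kappa μ ν ^ 2 * ((1 + kappa μ ν ^ 2) ^ t * ((secondMoment Pr x₁).trace + W.trace)) +
          (1 + kappa μ ν ^ 2) ^ t * ((secondMoment Pr x₁).trace + W.trace) :=
        add_le_add (h1.trans (by gcongr)) h5
      _ = _ := by ring

theorem sum_stepCost_le (hr : BoundedRun r) (hN : NoiseModel Pr x₁ w W) (hW : 0 ≤ W) {S T : ℕ}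
    (hST : S ≤ T) : ∑ t ∈ Finset.Icc 1 S, stepCost A B Qs Rs Pr x₁ w r.K t ≤
      initialCost σ (kappa μ ν) (secondMoment Pr x₁).trace W.trace T := by
  have hω := trace_nonneg_of_nonneg hW
  have hx := trace_nonneg_of_nonneg (secondMoment_nonneg hN.memLp_init)
  have hσ := hr.sigma_pos
  have h1 : ∀ t ∈ Finset.Icc 1 S, stepCost A B Qs Rs Pr x₁ w r.K t ≤
      σ * (1 + kappa μ ν ^ 2) *
        momentBound (kappa μ ν) (secondMoment Pr x₁).trace W.trace t := by
    intro t ht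
    have ht := (Finset.mem_Icc.1 ht).1
    refine (stepCost_le hN hr.cost hr.mu_pos hσ.le r.K ht).trans ?_
    have hX := trace_nonneg_of_nonneg (hN.secondMoment_state_nonneg (A := A) (B := B) (K := r.K) ht)
    gcongr
    · exact hr.norm_K_le ht
    · exact hr.trace_secondMoment_le hN hW ht
  refine (Finset.sum_le_sum h1).trans (Finset.sum_le_sum_of_subset_of_nonneg
    (Finset.Icc_subset_Icc_right hST) fun t _ _ => ?_)
  have := momentBound_nonneg (κ := kappa μ ν) hx hω t
  positivity

theorem two_le_tailStart (hr : BoundedRun r) : 2 ≤ tailStart B μ σ ν := by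
  have := hr.two_le_resetTime
  unfold tailStart
  omega

/-- Index shift: P_t certifies K_{t+1}, which acts on the state at time t+1, so index k pairs P at
time T₀ + k with the second moment at T₀ + k + 1. -/
theorem slowSystem (hr : BoundedRun r) (hN : NoiseModel Pr x₁ w W) (hW : 0 ≤ W) :
    SlowSystem μ ν (kappa μ ν) (4 * kappa μ ν ^ 4 * σ) (5 * ‖B‖ ^ 2 * kappa μ ν ^ 5 * σ / μ)
      (25 * ‖B‖ ^ 2 * kappa μ ν ^ 10 * σ ^ 2 / μ) (tailStart B μ σ ν)
      (fun k => r.P (tailStart B μ σ ν + k))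
      (fun k => closedLoop A B (r.K (tailStart B μ σ ν + k + 1)))
      (fun k => bellmanResidual A B (runAvg Qs (tailStart B μ σ ν + k))
        (runAvg Rs (tailStart B μ σ ν + k)) (r.P (tailStart B μ σ ν + k)))
      (fun k => secondMoment Pr (state A B x₁ w r.K (tailStart B μ σ ν + k + 1))) W where
  mu_pos := hr.mu_pos
  one_le_kappa := hr.one_le_kappa
  kappa_sq_mul := hr.kappa_sq_mul
  two_le := hr.two_le_tailStart
  delta_nonneg := by
    have := hr.kappa_pos
    have := hr.sigma_pos
    positivity
  beta_pos := by
    have := hr.kappa_pos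
    have := hr.sigma_pos
    have := hr.mu_pos
    have := hr.norm_B_pos
    positivity
  theta_nonneg := by
    have := hr.kappa_pos
    have := hr.mu_pos
    positivity
  W_nonneg := hW
  X_nonneg k := hN.secondMoment_state_nonneg (by omega)
  cert k := hr.isCert (by have := hr.two_le_tailStart; omega)
  P_diff k := by
    have := hr.norm_P_succ_sub_le_tail (t := tailStart B μ σ ν + k) (by omega)
    push_cast at this
    exact this
  delta_le := hr.rate_le_tail (by omega)
  F_diff k := by
    have := hr.norm_closedLoop_sub_le_tail (t := tailStart B μ σ ν + k) (by omega)
    push_cast at this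
    exact this
  E_nonneg k := hr.bellmanResidual_nonneg (by have := hr.two_le_tailStart; omega)
  E_le k := by
    have h2 := hr.two_le_tailStart
    obtain ⟨s, hs⟩ : ∃ s, tailStart B μ σ ν + k = s + 1 := ⟨tailStart B μ σ ν + k - 1, by omega⟩
    have := hr.residual_succ_le_tail (t := s) (by omega)
    have hc : ((tailStart B μ σ ν : ℝ) + k) = (s : ℝ) + 1 := by exact_mod_cast hs
    rw [hs, hc]
    exact this
  X_succ k := hN.secondMoment_succ (by omega)

theorem resetTime_lt_of_tailStart_le {t : ℕ} (ht : tailStart B μ σ ν ≤ t) :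
    resetTime B μ σ ν + 1 < t := by
  unfold tailStart at ht
  omega

/-- The cost at a late time is a telescoping term plus a small error. -/
theorem stepCost_succ_eq (hN : NoiseModel Pr x₁ w W) {t : ℕ}
    (ht : tailStart B μ σ ν ≤ t) :
    stepCost A B Qs Rs Pr x₁ w r.K (t + 1) =
      ((t : ℝ) + 1) * (r.P (t + 1) * W).trace - t * (r.P t * W).trace +
      (t * (bellmanResidual A B (runAvg Qs t) (runAvg Rs t) (r.P t) *
          secondMoment Pr (state A B x₁ w r.K (t + 1))).trace -
        ((r.P t + ((t : ℝ) + 1) • (r.P (t + 1) - r.P t)) *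
          (secondMoment Pr (state A B x₁ w r.K (t + 2)) -
            secondMoment Pr (state A B x₁ w r.K (t + 1)))).trace) := by
  have hts := resetTime_lt_of_tailStart_le ht
  set K := r.K (t + 1) with hK
  set X := secondMoment Pr (state A B x₁ w r.K (t + 1)) with hX
  set X' := secondMoment Pr (state A B x₁ w r.K (t + 2)) with hX'
  have hXs : X' = closedLoop A B K * X * (closedLoop A B K)ᵀ + W :=
    hN.secondMoment_succ (by omega)
  have hv := (r.P_eq (t + 1) (by omega) (by omega)).eq_add_stageCost
  have hv' : r.P (t + 1) = (closedLoop A B K)ᵀ * r.P (t + 1) * closedLoop A B K +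
      stageCost (runAvg Qs (t + 1)) (runAvg Rs (t + 1)) K + 0 := by
    rw [add_zero]; exact hv
  have h1 := trace_stageCost_mul hv' hXs
  have hE : r.P t = (closedLoop A B K)ᵀ * r.P t * closedLoop A B K +
      stageCost (runAvg Qs t) (runAvg Rs t) K +
      bellmanResidual A B (runAvg Qs t) (runAvg Rs t) (r.P t) := by
    rw [bellmanResidual, ← r.K_succ t (by omega), ← hK]; abel
  have h2 := trace_stageCost_mul hE hXs
  -- The current cost is a difference of two cumulative costs, each evaluated by its own P: exactly
  -- at t+1, up to the residual at t.
  have h3 : stageCost (Qs (t + 1)) (Rs (t + 1)) K =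
      ((t : ℝ) + 1) • stageCost (runAvg Qs (t + 1)) (runAvg Rs (t + 1)) K -
        (t : ℝ) • stageCost (runAvg Qs t) (runAvg Rs t) K := by
    have := smul_stageCost_runAvg (Q := Qs) (R := Rs) (t + 1) K
    rw [Finset.sum_Icc_succ_top (by omega), ← smul_stageCost_runAvg] at this
    push_cast at this
    rw [this]; abel
  rw [hN.stepCost_eq (by omega), ← hK, ← hX, h3, Matrix.sub_mul, Matrix.trace_sub, Matrix.smul_mul,
    Matrix.smul_mul, Matrix.trace_smul, Matrix.trace_smul, h1, h2]
  simp only [smul_eq_mul, Matrix.zero_mul, Matrix.trace_zero, sub_zero, Matrix.add_mul,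
    Matrix.smul_mul, Matrix.sub_mul, Matrix.trace_add, Matrix.trace_smul, Matrix.trace_sub]
  ring

/-- Telescoping from T₀ onwards. The head of the sum and the boundary term at T₀ are bounded
independently of the run. -/
theorem sum_stepCost_tail (hr : BoundedRun r) (hN : NoiseModel Pr x₁ w W) (hW : 0 ≤ W) (N : ℕ) :
    |∑ t ∈ Finset.Icc 1 (tailStart B μ σ ν + N), stepCost A B Qs Rs Pr x₁ w r.K t -
      ((tailStart B μ σ ν + N : ℕ) : ℝ) * (r.P (tailStart B μ σ ν + N) * W).trace| ≤
      SlowSystem.slowCoeff μ ν (kappa μ ν) (4 * kappa μ ν ^ 4 * σ)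
        (5 * ‖B‖ ^ 2 * kappa μ ν ^ 5 * σ / μ) (25 * ‖B‖ ^ 2 * kappa μ ν ^ 10 * σ ^ 2 / μ) W.trace *
        Real.log ((tailStart B μ σ ν + N : ℕ) : ℝ) +
      (SlowSystem.slowConst μ ν (kappa μ ν) (4 * kappa μ ν ^ 4 * σ)
        (5 * ‖B‖ ^ 2 * kappa μ ν ^ 5 * σ / μ) (25 * ‖B‖ ^ 2 * kappa μ ν ^ 10 * σ ^ 2 / μ) W.trace
        (momentBound (kappa μ ν) (secondMoment Pr x₁).trace W.trace (tailStart B μ σ ν + 1) +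
          momentBound (kappa μ ν) (secondMoment Pr x₁).trace W.trace (tailStart B μ σ ν + 2)) +
        initialCost σ (kappa μ ν) (secondMoment Pr x₁).trace W.trace (tailStart B μ σ ν) +
        tailStart B μ σ ν * (ν * W.trace)) := by
  set T₀ := tailStart B μ σ ν with hT₀
  have h2 := hr.two_le_tailStart
  have hs := (hr.slowSystem hN hW).abs_sum_le
    (add_le_add (hr.trace_secondMoment_le hN hW (t := T₀ + 1) (by omega))
      (hr.trace_secondMoment_le hN hW (t := T₀ + 2) (by omega))) N
  rw [← hT₀] at hs
  have hsum : ∀ N : ℕ, ∑ t ∈ Finset.Icc 1 (T₀ + N), stepCost A B Qs Rs Pr x₁ w r.K t =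
      ∑ t ∈ Finset.Icc 1 T₀, stepCost A B Qs Rs Pr x₁ w r.K t +
      (((T₀ + N : ℕ) : ℝ) * (r.P (T₀ + N) * W).trace - T₀ * (r.P T₀ * W).trace) +
      ∑ k ∈ Finset.range N, (((T₀ : ℝ) + k) * (bellmanResidual A B (runAvg Qs (T₀ + k))
          (runAvg Rs (T₀ + k)) (r.P (T₀ + k)) *
          secondMoment Pr (state A B x₁ w r.K (T₀ + k + 1))).trace -
        ((r.P (T₀ + k) + ((T₀ : ℝ) + k + 1) • (r.P (T₀ + (k + 1)) - r.P (T₀ + k))) *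
          (secondMoment Pr (state A B x₁ w r.K (T₀ + (k + 1) + 1)) -
            secondMoment Pr (state A B x₁ w r.K (T₀ + k + 1)))).trace) := by
    intro N
    induction N with
    | zero => simp
    | succ N ih =>
      rw [← add_assoc T₀ N 1, Finset.sum_Icc_succ_top (by omega), ih, Finset.sum_range_succ,
        stepCost_succ_eq hN (t := T₀ + N) (by omega)]
      push_cast
      rw [← add_assoc T₀ N 1]
      ring
  have a1 := hr.sum_stepCost_le hN hW (le_refl T₀)
  have a2 := sum_stepCost_nonneg (A := A) (B := B) hN hr.cost hr.mu_pos r.K T₀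
  have a3 := trace_mul_nonneg (hr.P_nonneg (t := T₀) (by omega)) hW
  have a4 := trace_mul_le_of_le_smul_one (hr.P_le T₀ (by omega)) hW
  have a5 : (T₀ : ℝ) * (r.P T₀ * W).trace ≤ T₀ * (ν * W.trace) := by gcongr
  have a6 : 0 ≤ (T₀ : ℝ) * (r.P T₀ * W).trace := by positivity
  rw [hsum N]
  have hs' := abs_le.1 hs
  rw [abs_le]
  constructor <;> linarith [hs'.1, hs'.2]

/-- Any fixed policy costs at least `T tr(P_T W) - O(1)` at late times `T`. -/
theorem le_sum_fixed (hr : BoundedRun r) (hN : NoiseModel Pr x₁ w W) (hW : 0 ≤ W) {T : ℕ}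
    (hT : tailStart B μ σ ν ≤ T) (K : Matrix (Fin m) (Fin n) ℝ) :
    T * (r.P T * W).trace - (10 * (σ / μ) * (ν / μ) +
      2 * (25 * ‖B‖ ^ 2 * kappa μ ν ^ 10 * σ ^ 2 / μ) / μ) * (ν * W.trace) ≤
      ∑ t ∈ Finset.Icc 1 T, stepCost A B Qs Rs Pr x₁ w (fun _ => K) t := by
  have h2 := hr.two_le_tailStart
  have hμ := hr.mu_pos
  have hσ := hr.sigma_pos
  have hν := hr.nu_pos
  have hκ := hr.one_le_kappa
  obtain ⟨s, rfl⟩ : ∃ s, T = s + 1 := ⟨T - 1, by omega⟩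
  obtain ⟨-, -, hb⟩ := hr.tailStart_bounds hT
  have hT2 : 2 * σ ≤ μ * ((s + 1 : ℕ) : ℝ) := by
    rw [div_le_iff₀ hμ] at hb
    have h1 : σ ≤ kappa μ ν ^ 6 * σ := le_mul_of_one_le_left hσ.le (one_le_pow₀ hκ)
    push_cast
    nlinarith
  rw [sum_fixed_eq hN]
  have hE := hr.residual_succ_le_tail hT
  refine le_trans ?_ (le_cost_fixed hr.cost hμ hr.mu_lt.le (hr.P_nonneg (by omega))
    (hr.P_le _ (by omega)) hν.le hW (by positivity) (hr.bellmanResidual_nonneg (by omega)) hE hT2 K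
    (hN.secondMoment_state_nonneg le_rfl) fun t ht => hN.secondMoment_succ ht)
  have a4 := trace_mul_le_of_le_smul_one (hr.P_le (s + 1) (by omega)) hW
  have a3 := trace_mul_nonneg (hr.P_nonneg (t := s + 1) (by omega)) hW
  have hω := trace_nonneg_of_nonneg hW
  refine sub_le_sub_left ?_ _
  push_cast
  set θ := 25 * ‖B‖ ^ 2 * kappa μ ν ^ 10 * σ ^ 2 / μ
  have hθ : 0 ≤ θ := by positivity
  have hs1 : (1 : ℝ) ≤ (s : ℝ) + 1 := by have := s.cast_nonneg (α := ℝ); linarith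
  have e : ((s : ℝ) + 1) * θ / (s + 1) ^ 2 = θ / (s + 1) := by field_simp
  -- The residual at time T is O(1/T²), so T times it stays bounded.
  have h4 : 2 * ((s : ℝ) + 1) * (θ / (s + 1) ^ 2) / μ ≤ 2 * θ / μ := by
    rw [mul_assoc, ← mul_div_assoc, e]
    gcongr
    exact div_le_self hθ hs1
  have h5 : (r.P (s + 1) * W).trace ≤ ν * W.trace := a4
  have h6 : 0 ≤ 2 * ((s : ℝ) + 1) * (θ / (s + 1) ^ 2) / μ := by positivity
  gcongr

/-- K_T is a stable competitor whose averaged value is the same P_T that appears in the cost of the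
run, so the leading terms cancel in the lower bound on the regret. -/
theorem sum_fixed_le (hr : BoundedRun r) (hN : NoiseModel Pr x₁ w W) (hW : 0 ≤ W) {T : ℕ}
    (hT : tailStart B μ σ ν ≤ T) :
    ∑ t ∈ Finset.Icc 1 T, stepCost A B Qs Rs Pr x₁ w (fun _ => r.K T) t ≤
      T * (r.P T * W).trace + σ / μ * (ν * (secondMoment Pr x₁).trace) := by
  have h2 := hr.two_le_tailStart
  have hts := resetTime_lt_of_tailStart_le hT
  rw [sum_fixed_eq hN]
  exact cost_fixed_le hr.cost hr.mu_pos hr.mu_lt.le (by omega) (hr.P_nonneg (by omega))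
    (hr.P_le _ (by omega)) hW (r.P_eq T (by omega) (by omega))
    (X := fun t => secondMoment Pr (state A B x₁ w (fun _ => r.K T) t))
    (hN.secondMoment_state_nonneg le_rfl) fun t ht => hN.secondMoment_succ ht

end BoundedRun

/-- The coefficient of `log T` in the regret bound of `exists_regret_bound`. -/
def regretCoeff (B : Matrix (Fin n) (Fin m) ℝ) (W : Matrix (Fin n) (Fin n) ℝ) (μ σ ν : ℝ) : ℝ :=
  SlowSystem.slowCoeff μ ν (kappa μ ν) (4 * kappa μ ν ^ 4 * σ)
    (5 * ‖B‖ ^ 2 * kappa μ ν ^ 5 * σ / μ) (25 * ‖B‖ ^ 2 * kappa μ ν ^ 10 * σ ^ 2 / μ) W.trace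

theorem regretCoeff_nonneg {B : Matrix (Fin n) (Fin m) ℝ} {r : Run A B Qs Rs μ σ ν}
    (hr : BoundedRun r) (hW : 0 ≤ W) : 0 ≤ regretCoeff B W μ σ ν := by
  have hμ := hr.mu_pos
  have hσ := hr.sigma_pos
  have hν := hr.nu_pos
  have hκ := hr.kappa_pos
  have hω := trace_nonneg_of_nonneg hW
  unfold regretCoeff SlowSystem.slowCoeff
  positivity

/-- The regret is `O(log T)`, with constants that do not depend on the costs or on the run. -/
theorem exists_regret_bound (hN : NoiseModel Pr x₁ w W) (hW : 0 ≤ W) (hAB : IsStabilizable A B)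
    (μ σ ν : ℝ) : ∃ C : ℝ, ∀ (Qs : ℕ → Matrix (Fin n) (Fin n) ℝ)
      (Rs : ℕ → Matrix (Fin m) (Fin m) ℝ) (r : Run A B Qs Rs μ σ ν), BoundedRun r →
      ∀ T : ℕ, 1 ≤ T →
        |regret A B Qs Rs Pr x₁ w r.K T| ≤ regretCoeff B W μ σ ν * Real.log T + C := by
  obtain ⟨K₀, hK₀⟩ := id hAB
  set T₀ := tailStart B μ σ ν with hT₀
  set x := (secondMoment Pr x₁).trace with hx
  set C₁ := SlowSystem.slowConst μ ν (kappa μ ν) (4 * kappa μ ν ^ 4 * σ)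
        (5 * ‖B‖ ^ 2 * kappa μ ν ^ 5 * σ / μ) (25 * ‖B‖ ^ 2 * kappa μ ν ^ 10 * σ ^ 2 / μ) W.trace
        (momentBound (kappa μ ν) x W.trace (T₀ + 1) + momentBound (kappa μ ν) x W.trace (T₀ + 2)) +
        initialCost σ (kappa μ ν) x W.trace T₀ + T₀ * (ν * W.trace) with hC₁
  set C₂ := (10 * (σ / μ) * (ν / μ) +
      2 * (25 * ‖B‖ ^ 2 * kappa μ ν ^ 10 * σ ^ 2 / μ) / μ) * (ν * W.trace) with hC₂
  set C₃ := σ / μ * (ν * x) with hC₃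
  set C₄ := initialCost σ (kappa μ ν) x W.trace T₀ with hC₄
  set C₅ := ∑ t ∈ Finset.Icc 1 T₀, σ * (1 + ‖K₀‖ ^ 2) *
    (secondMoment Pr (state A B x₁ w (fun _ => K₀) t)).trace with hC₅
  -- C₂ and C₃ serve the upper and lower bounds for T ≥ T₀, C₄ and C₅ those for T < T₀. The
  -- competitor K₀ behind C₅ is chosen from (A, B) alone, which keeps the constant uniform over
  -- runs.
  refine ⟨max (C₁ + max C₂ C₃) (max C₄ C₅), fun Qs Rs r hr T hT => ?_⟩
  have hL := regretCoeff_nonneg hr hW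
  have hlog := Real.log_natCast_nonneg T
  rcases le_or_gt T₀ T with h | h
  · obtain ⟨N, rfl⟩ := Nat.exists_eq_add_of_le h
    have h1 := abs_le.1 (hr.sum_stepCost_tail hN hW N)
    have h2 := regret_le_of_forall_le hAB (K := r.K) fun K' => hr.le_sum_fixed hN hW h K'
    have h3 := le_regret hN hr.cost hr.mu_pos (K := r.K) (T₀ + N) (hr.isStable hT)
    have h4 := hr.sum_fixed_le hN hW h
    have b1 := le_max_left (C₁ + max C₂ C₃) (max C₄ C₅)
    have b2 := le_max_left C₂ C₃
    have b3 := le_max_right C₂ C₃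
    unfold regretCoeff
    rw [abs_le]
    constructor <;> linarith [h1.1, h1.2]
  · have h1 := hr.sum_stepCost_le hN hW h.le
    have h2 := regret_le_of_forall_le hAB (K := r.K) (T := T)
      fun K' => sum_stepCost_nonneg (A := A) (B := B) hN hr.cost hr.mu_pos (fun _ => K') T
    have h3 := le_regret hN hr.cost hr.mu_pos (K := r.K) T hK₀
    have h4 := sum_stepCost_nonneg (A := A) (B := B) hN hr.cost hr.mu_pos r.K T
    have h5 : ∑ t ∈ Finset.Icc 1 T, stepCost A B Qs Rs Pr x₁ w (fun _ => K₀) t ≤ C₅ := by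
      have hσ := hr.sigma_pos
      refine (Finset.sum_le_sum fun t ht => stepCost_le hN hr.cost hr.mu_pos hσ.le (fun _ => K₀)
        (Finset.mem_Icc.1 ht).1).trans (Finset.sum_le_sum_of_subset_of_nonneg
          (Finset.Icc_subset_Icc_right h.le) fun t ht _ => ?_)
      have := trace_nonneg_of_nonneg (hN.secondMoment_state_nonneg (A := A) (B := B)
        (K := fun _ => K₀) (Finset.mem_Icc.1 ht).1)
      positivity
    have b1 := le_max_right (C₁ + max C₂ C₃) (max C₄ C₅)
    have b2 := le_max_left C₄ C₅
    have b3 := le_max_right C₄ C₅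
    have b4 := mul_nonneg hL hlog
    rw [abs_le]
    constructor <;> linarith

/-- Since m̂ ≥ 16κ⁴σ and 1 - exp(-2γ²) ≤ 2γ², the first summand of `logCoeff` is at least 512 κ²² σ²
ω ‖B‖² / μ, whereas `regretCoeff` is at most (500/3 + 50) times the same monomial. -/
theorem regretCoeff_le_logCoeff {B : Matrix (Fin n) (Fin m) ℝ} {r : Run A B Qs Rs μ σ ν}
    (hr : BoundedRun r) (hW : 0 ≤ W) : regretCoeff B W μ σ ν ≤ logCoeff B W μ σ ν r.P := by
  have hμ := hr.mu_pos
  have hσ := hr.sigma_pos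
  have hκ := hr.kappa_pos
  have hκ1 := hr.one_le_kappa
  have hb := hr.norm_B_pos
  have hω := trace_nonneg_of_nonneg hW
  have hν := hr.kappa_sq_mul
  set κ := kappa μ ν with hκd
  set b := ‖B‖ with hbd
  set ω := W.trace with hωd
  have hγ : gam μ ν = 1 / (2 * κ ^ 2) := rfl
  have hγ0 : 0 < gam μ ν := by rw [hγ]; positivity
  have hm : 16 * κ ^ 4 * σ ≤ mHat B μ σ ν r.P := by
    refine le_trans ?_ (le_max_left _ _)
    rw [resetConst_eq, ← hκd, ← hbd]
    have h1 : 0 ≤ 2 * σ / b := by positivity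
    have h2 : 8 * κ ^ 4 * σ * 2 ≤ 8 * κ ^ 4 * σ * (1 + κ ^ 2) := by
      gcongr
      nlinarith
    linarith
  set mh := mHat B μ σ ν r.P with hmh
  have hM : 2 * κ ^ 6 * ω / (μ * gam μ ν ^ 2) * b * (b * (16 * κ ^ 4 * σ)) ≤
      constM B W μ σ ν r.P := by
    unfold constM
    rw [← hκd, ← hbd, ← hωd, ← hmh]
    gcongr
    refine le_trans ?_ (le_add_of_nonneg_right (by positivity))
    gcongr
  have hE0 : 0 < 1 - Real.exp (-2 * gam μ ν ^ 2) := by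
    rw [sub_pos, Real.exp_lt_one_iff]
    have : 0 < gam μ ν ^ 2 := by positivity
    linarith
  have hE1 : 1 - Real.exp (-2 * gam μ ν ^ 2) ≤ 2 * gam μ ν ^ 2 := by
    have := Real.add_one_le_exp (-2 * gam μ ν ^ 2)
    linarith
  have hM0 : 0 ≤ constM B W μ σ ν r.P := le_trans (by positivity) hM
  have h1 : 512 * κ ^ 22 * σ ^ 2 * ω * b ^ 2 / μ ≤ logCoeff B W μ σ ν r.P := by
    unfold logCoeff
    rw [← hκd, ← hωd, ← hbd, ← hmh]
    refine le_trans ?_ (le_add_of_nonneg_right (by positivity))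
    calc 512 * κ ^ 22 * σ ^ 2 * ω * b ^ 2 / μ =
        2 * κ ^ 4 * σ * (2 * κ ^ 6 * ω / (μ * gam μ ν ^ 2) * b * (b * (16 * κ ^ 4 * σ)) /
          (2 * gam μ ν ^ 2)) := by rw [hγ]; field_simp; ring
      _ ≤ _ := by gcongr
  refine le_trans ?_ h1
  unfold regretCoeff SlowSystem.slowCoeff
  rw [← hκd, ← hωd, ← hbd]
  have hνσ : ν + 4 * κ ^ 4 * σ ≤ 5 * κ ^ 4 * σ := by
    have h2 : κ ^ 2 * μ ≤ κ ^ 4 * σ := by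
      have := hr.mu_lt.le
      gcongr
      norm_num
    linarith
  have hν0 := hr.nu_pos
  have hpow18 : κ ^ 18 ≤ κ ^ 22 := pow_le_pow_right₀ hκ1 (by norm_num)
  have hpow14 : κ ^ 14 ≤ κ ^ 22 := pow_le_pow_right₀ hκ1 (by norm_num)
  set u := σ ^ 2 * ω * b ^ 2 / μ with hu
  have hu0 : 0 ≤ u := by positivity
  calc _ ≤ 5 * κ ^ 4 * σ / μ * (4 * κ ^ 2 / 3 * (5 / 4 * ν *
        (2 * κ * (5 * b ^ 2 * κ ^ 5 * σ / μ) * (2 * κ ^ 4 * ω)))) +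
        25 * b ^ 2 * κ ^ 10 * σ ^ 2 / μ * (2 * κ ^ 4 * ω) := by gcongr
    _ = 500 / 3 * κ ^ 18 * u + 50 * κ ^ 14 * u := by
      rw [hu, ← hν]; field_simp; ring
    _ ≤ 500 / 3 * κ ^ 22 * u + 50 * κ ^ 22 * u := by gcongr
    _ ≤ 512 * κ ^ 22 * u := by nlinarith [mul_nonneg (pow_nonneg hκ.le 22) hu0]
    _ = _ := by rw [hu]; ring

/-- The explicit bound dominates any constant, if the coefficient `l` is large enough. -/
theorem exists_explicitBound {r : Run A B Qs Rs μ σ ν} (hr : BoundedRun r) (hW : 0 ≤ W)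
    (hW0 : W ≠ 0) (C : ℝ) : ∃ l : ℝ, 0 < l ∧ ∀ (T : ℕ) (Xdev : ℕ → ℝ) (dstar : ℝ),
      (∀ t, 0 ≤ Xdev t) → 0 ≤ dstar →
      logCoeff B W μ σ ν r.P * Real.log T + C ≤ explicitBound B W μ σ ν r.P Xdev dstar l T := by
  have hμ := hr.mu_pos
  have hσ := hr.sigma_pos
  have hκ := hr.kappa_pos
  have hω : 0 < W.trace := by
    refine lt_of_le_of_ne (trace_nonneg_of_nonneg hW) fun h => hW0 ?_
    exact (Matrix.nonneg_iff_posSemidef.1 hW).trace_eq_zero_iff.1 h.symm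
  have hm : 0 < mHat B μ σ ν r.P := hr.resetConst_pos.trans_le (le_max_left _ _)
  have hγ0 : 0 < gam μ ν := by unfold gam; positivity
  have hE : 0 < 1 - Real.exp (-2 * gam μ ν ^ 2) := by
    rw [sub_pos, Real.exp_lt_one_iff]
    have : 0 < gam μ ν ^ 2 := by positivity
    linarith
  have hE' : 0 < 1 - Real.exp (-2 * gam μ ν) := by
    rw [sub_pos, Real.exp_lt_one_iff]
    linarith
  -- Besides the leading logarithm, the only term with a negative sign is the one with log t⋆. D
  -- collects it with C, and l is taken large enough for ω l m̂ to cover D; W ≠ 0 makes ω positive.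
  set D := C + 2 * kappa μ ν ^ 4 * σ *
    (constM B W μ σ ν r.P / (1 - Real.exp (-2 * gam μ ν ^ 2))) *
      Real.log (resetTime B μ σ ν) with hD
  refine ⟨max 1 (D / (W.trace * mHat B μ σ ν r.P)), by positivity, fun T Xdev dstar hX hd => ?_⟩
  set l := max 1 (D / (W.trace * mHat B μ σ ν r.P)) with hl
  have h1 : D ≤ W.trace * l * mHat B μ σ ν r.P := by
    have h2 : D / (W.trace * mHat B μ σ ν r.P) ≤ l := le_max_right _ _
    rw [div_le_iff₀ (by positivity)] at h2
    linarith
  have hsup : 0 ≤ ⨆ t : Finset.Icc 1 (resetTime B μ σ ν), Xdev t :=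
    Real.iSup_nonneg fun t => hX t
  have hM' : 0 ≤ constM' B W μ σ ν r.P := by unfold constM'; positivity
  have hXt := hX (resetTime B μ σ ν)
  unfold explicitBound
  simp only
  have t1 : 0 ≤ (resetTime B μ σ ν : ℝ) * σ * (1 + kappa μ ν ^ 2) *
      (⨆ t : Finset.Icc 1 (resetTime B μ σ ν), Xdev t) := by positivity
  have t2 : 0 ≤ 2 * kappa μ ν ^ 4 * σ * (Xdev (resetTime B μ σ ν) *
      (Real.exp (-2 * gam μ ν ^ 2 * resetTime B μ σ ν) / (1 - Real.exp (-2 * gam μ ν ^ 2))) +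
      constM' B W μ σ ν r.P * Real.pi ^ 2 / (6 * (1 - Real.exp (-2 * gam μ ν ^ 2)))) := by
    positivity
  have t3 : 0 ≤ kappa μ ν ^ 4 * W.trace / (gam μ ν * μ ^ 3) *
      (‖B‖ * mHat B μ σ ν r.P + 2 * σ) ^ 2 := by positivity
  have t4 : 0 ≤ σ * (1 + kappa μ ν ^ 2) * kappa μ ν ^ 2 / (1 - Real.exp (-2 * gam μ ν)) *
      dstar := by positivity
  linarith

end Regret

end OnlineLQ

end

/-! ### The main theorem. -/

theorem mainTheorem1 {n m : ℕ}
    (A : Matrix (Fin n) (Fin n) ℝ) (B : Matrix (Fin n) (Fin m) ℝ) (hB : B ≠ 0)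
    (hAB : OnlineLQ.IsStabilizable A B)
    (W : Matrix (Fin n) (Fin n) ℝ) (hW : W.PosSemidef)
    (ξ : EuclideanSpace ℝ (Fin n)) (X₁ : Matrix (Fin n) (Fin n) ℝ) (hX₁ : X₁.PosSemidef)
    (μ σ ν : ℝ) (hμ : 0 < μ) (hμσ : μ < σ)
    {Ω : Type*} [MeasurableSpace Ω] (Pr : Measure Ω) [IsProbabilityMeasure Pr]
    (x₁ : Ω → EuclideanSpace ℝ (Fin n)) (w : ℕ → Ω → EuclideanSpace ℝ (Fin n))
    (hx₁_meas : Measurable x₁) (hw_meas : ∀ t, 1 ≤ t → Measurable (w t))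
    (hx₁_law : HasLaw x₁ (multivariateGaussian ξ X₁) Pr)
    (hw_law : ∀ t, 1 ≤ t → HasLaw (w t) (multivariateGaussian 0 W) Pr)
    (hw_indep : iIndepFun (fun t : ℕ => w (t + 1)) Pr)
    (hx₁w_indep : IndepFun x₁ (fun ω (t : ℕ) => w (t + 1) ω) Pr) :
    ∃ C : ℝ,
      ∀ (Q : ℕ → Matrix (Fin n) (Fin n) ℝ) (R : ℕ → Matrix (Fin m) (Fin m) ℝ),
        OnlineLQ.CostAssumption Q R μ σ →
        ∀ r : OnlineLQ.Run A B Q R μ σ ν,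
          (∀ t, 1 ≤ t → (ν • (1 : Matrix (Fin n) (Fin n) ℝ) - r.P t).PosSemidef) →
          (∀ T : ℕ, 2 ≤ T → |OnlineLQ.regret A B Q R Pr x₁ w r.K T| ≤ C * Real.log T) ∧
          (∀ T : ℕ, 1 ≤ T → OnlineLQ.regret A B Q R Pr x₁ w r.K T ≤
            OnlineLQ.logCoeff B W μ σ ν r.P * Real.log T + C) ∧
          (W ≠ 0 → ∃ l : ℝ, 0 < l ∧ ∀ T : ℕ, 1 ≤ T → ∀ Pstar : Matrix (Fin n) (Fin n) ℝ,
            OnlineLQ.IsDARESolution A B (OnlineLQ.runAvg Q T) (OnlineLQ.runAvg R T) Pstar →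
            OnlineLQ.regret A B Q R Pr x₁ w r.K T ≤
              OnlineLQ.explicitBound B W μ σ ν r.P
                (fun t => ‖OnlineLQ.secondMoment Pr (OnlineLQ.state A B x₁ w r.K t) -
                  OnlineLQ.steadyCov A B W (r.K t)‖)
                ‖OnlineLQ.steadyCov A B W
                    (OnlineLQ.gain A B (OnlineLQ.runAvg R T) Pstar) -
                  OnlineLQ.secondMoment Pr x₁‖
                l T) := by
  have hN := OnlineLQ.noiseModel_of_gaussian hW hx₁_law hw_law hw_indep hx₁w_indep
  have hW' := Matrix.nonneg_iff_posSemidef.2 hW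
  obtain ⟨C, hC⟩ := OnlineLQ.exists_regret_bound hN hW' hAB μ σ ν
  have hlog2 : 0 < Real.log 2 := Real.log_pos one_lt_two
  set L := OnlineLQ.regretCoeff B W μ σ ν
  -- One constant for both claims: for T ≥ 2 the additive C is at most (|C| / log 2) log T, and the
  -- last |C| serves the additive bound.
  refine ⟨L + |C| / Real.log 2 + |C|, fun Q R hcost r hP => ?_⟩
  have hr : OnlineLQ.BoundedRun r :=
    ⟨hB, hμ, hμσ, hcost, fun t ht => Matrix.le_iff.2 (hP t ht)⟩
  have hL0 : 0 ≤ L := OnlineLQ.regretCoeff_nonneg hr hW'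
  have hL : L ≤ OnlineLQ.logCoeff B W μ σ ν r.P := OnlineLQ.regretCoeff_le_logCoeff hr hW'
  have hbound : ∀ T : ℕ, 1 ≤ T → OnlineLQ.regret A B Q R Pr x₁ w r.K T ≤
      OnlineLQ.logCoeff B W μ σ ν r.P * Real.log T + C := fun T hT => by
    have h1 := (le_abs_self _).trans (hC Q R r hr T hT)
    have h2 := mul_le_mul_of_nonneg_right hL (Real.log_natCast_nonneg T)
    linarith
  have hCabs := le_abs_self C
  have hC0 : 0 ≤ |C| := abs_nonneg C
  have hC2 : 0 ≤ |C| / Real.log 2 := by positivity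
  refine ⟨fun T hT => (hC Q R r hr T (by omega)).trans ?_,
    fun T hT => (hbound T hT).trans (by linarith), fun hW0 => ?_⟩
  · have hlogT : Real.log 2 ≤ Real.log T :=
      Real.log_le_log two_pos (by exact_mod_cast hT)
    have h1 : |C| ≤ |C| / Real.log 2 * Real.log T := by
      calc |C| = |C| / Real.log 2 * Real.log 2 := by field_simp
        _ ≤ _ := by gcongr
    have h2 : 0 ≤ |C| * Real.log T := by positivity
    linarith
  -- Here l is fixed before T and P⋆; these enter the remainder only through norms, which are
  -- nonnegative.
  · obtain ⟨l, hl, h⟩ := OnlineLQ.exists_explicitBound hr hW' hW0 C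
    exact ⟨l, hl, fun T hT Pstar _ => (hbound T hT).trans
      (h T _ _ (fun t => norm_nonneg _) (norm_nonneg _))⟩
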